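/- Let $d\ge 1$, let $D\subset\mathbb{R}^d$ be a bounded domain (nonempty, open, connected) and let $n\in C^1(\overline D)$ be real-valued with $n>0$ in $D$. Let $G_0(x,y)$ be the outgoing free space Green function of the Helmholtz equation with wave number $1$, $(\Delta_x+1)G_0(x,y)=\delta(x-y)$, that is $$G_0(x,y)=-\tfrac{i}{4}\,(2\pi|x-y|)^{-\frac{d-2}{2}}\,H^{(1)}_{\frac{d-2}{2}}(|x-y|),$$ which for $d=3$ is $-e^{i|x-y|}/(4\pi|x-y|)$. Then the formula $$K_D[f](x)=\int_D G_0(x,y)\,n(y)\,f(y)\,dy$$ (the integral converging absolutely for almost every $x\in D$) defines a bounded linear operator $K_D$ on $L^2(D)$ (complex-valued functions), and for every complex $\lambda\neq 0$: $\lambda$ belongs to the spectrum $\sigma(K_D)$ if and only if there is a nontrivial (not almost everywhere zero) function $u\in H^2_{\mathrm{loc}}(\mathbb{R}^d)$ with $$(\Delta+1)u=\frac1\lambda\, n\,u\ \text{ a.e. in } D,\qquad (\Delta+1)u=0\ \text{ a.e. in }\mathbb{R}^d\setminus D,$$ that satisfies the Sommerfeld radiation condition: $u$ is (after modification on a null set)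 differentiable near infinity and $|x|^{\frac{d-1}{2}}\big(\partial_{|x|}u(x)-i\,u(x)\big)\to 0$ as $|x|\to\infty$, uniformly in all directions. These functions $u$ are called resonant modes. Equivalently, for the operator with the opposite sign, $-K_D$: a complex number $\lambda\ne0$ belongs to $\sigma(-K_D)$ if and only if the same problem with $-\frac1\lambda\,n\,u$ in place of $\frac1\lambda\,n\,u$ has a nontrivial solution. -/

import Mathlib

open MeasureTheory Filter Topology
open scoped ContDiff Laplacian InnerProductSpace

/-- The Euclidean space of dimension `d`. -/
abbrev E (d : ℕ) := EuclideanSpace ℝ (Fin d)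

noncomputable section

/-- The Hankel function of the first kind of real order `ν ≥ 0`, at `r > 0`, by the classical
integral formula
`H_ν(r) = √(2/(π r)) e^{i(r - νπ/2 - π/4)} / Γ(ν + 1/2)
  * ∫_0^∞ e^{-t} t^{ν - 1/2} (1 + i t/(2r))^{ν - 1/2} dt`. -/
def hankelNonneg (ν r : ℝ) : ℂ :=
  (Real.sqrt (2 / (Real.pi * r)) : ℂ)
    * Complex.exp (Complex.I * ((r - ν * Real.pi / 2 - Real.pi / 4 : ℝ) : ℂ))
    / (Real.Gamma (ν + 1 / 2) : ℂ)
    * ∫ t in Set.Ioi (0 : ℝ),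
        ((Real.exp (-t) * t ^ (ν - 1 / 2) : ℝ) : ℂ)
          * (1 + Complex.I * ((t / (2 * r) : ℝ) : ℂ)) ^ ((ν - 1 / 2 : ℝ) : ℂ)

/-- The Hankel function of the first kind of real order `ν`, at `r > 0`; negative orders are
reduced to positive ones by the reflection formula `H_ν = e^{-iνπ} H_{-ν}`. -/
def hankelOne (ν r : ℝ) : ℂ :=
  if 0 ≤ ν then hankelNonneg ν r
  else Complex.exp (-Complex.I * ((ν * Real.pi : ℝ) : ℂ)) * hankelNonneg (-ν) r

/-- The outgoing free space Green function with wave number `1`, normalised by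
`(Δ + 1) G₀ = δ`, as a function of `x - y`:
`G₀(z) = -(i/4) (2π|z|)^{-(d-2)/2} H_{(d-2)/2}(|z|)`
(for `d = 3` this is `-e^{i|z|} / (4π|z|)`). -/
def freeGreen (d : ℕ) (z : E d) : ℂ :=
  -(Complex.I / 4) * (((2 * Real.pi * ‖z‖) ^ (-(((d : ℝ) - 2) / 2)) : ℝ) : ℂ)
    * hankelOne (((d : ℝ) - 2) / 2) ‖z‖

/-- The integral `∫_D G₀(x, y) n(y) f(y) dy`. -/
def potential {d : ℕ} (D : Set (E d)) (n : E d → ℝ) (f : E d → ℂ) (x : E d) : ℂ :=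
  ∫ y in D, freeGreen d (x - y) * (n y : ℂ) * f y

/-- The bounded operator `K` on `L²(D)` is the integral operator with kernel `G₀(x, y) n(y)`:
for every `f ∈ L²(D)` and almost every `x ∈ D` the integral converges absolutely and equals
`(K f)(x)`. This determines `K`. -/
def IsSourceOperator {d : ℕ} (D : Set (E d)) (n : E d → ℝ)
    (K : Lp ℂ 2 (volume.restrict D) →L[ℂ] Lp ℂ 2 (volume.restrict D)) : Prop :=
  ∀ f : Lp ℂ 2 (volume.restrict D), ∀ᵐ x ∂(volume.restrict D),
    IntegrableOn (fun y => freeGreen d (x - y) * (n y : ℂ) * f y) D ∧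
      K f x = potential D n f x

/-- `n ∈ C¹(D̄)` for an open set `D`: `n` is differentiable in `D`, and `n` and its derivative
extend continuously to the closure of `D`. -/
def IsC1UpToBoundary {d : ℕ} (n : E d → ℝ) (D : Set (E d)) : Prop :=
  ContinuousOn n (closure D) ∧
    ∃ g : E d → (E d →L[ℝ] ℝ), ContinuousOn g (closure D) ∧ ∀ x ∈ D, HasFDerivAt n (g x) x

/-- Smooth compactly supported real test functions on the whole space. -/
def IsTestFunction {d : ℕ} (φ : E d → ℝ) : Prop :=
  ContDiff ℝ ∞ φ ∧ HasCompactSupport φ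

/-- `v` is the weak partial derivative of `u` in the `i`-th coordinate direction. -/
def HasWeakPartial {d : ℕ} (i : Fin d) (u v : E d → ℂ) : Prop :=
  LocallyIntegrable u ∧ LocallyIntegrable v ∧
    ∀ φ : E d → ℝ, IsTestFunction φ →
      ∫ x, fderiv ℝ φ x (EuclideanSpace.single i 1) • u x = -∫ x, φ x • v x

/-- `w` is the Laplacian of `u` in the weak sense. -/
def HasWeakLaplacian {d : ℕ} (u w : E d → ℂ) : Prop :=
  LocallyIntegrable u ∧ LocallyIntegrable w ∧
    ∀ φ : E d → ℝ, IsTestFunction φ → ∫ x, (Δ φ) x • u x = ∫ x, φ x • w x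

/-- `u ∈ L²_loc(ℝᵈ)`. -/
def MemL2Loc {d : ℕ} (u : E d → ℂ) : Prop :=
  ∀ C : Set (E d), IsCompact C → MemLp u 2 (volume.restrict C)

/-- `u ∈ H²_loc(ℝᵈ)`: `u` and its weak partial derivatives of orders one and two are in
`L²_loc(ℝᵈ)`. -/
def MemH2Loc {d : ℕ} (u : E d → ℂ) : Prop :=
  MemL2Loc u ∧
    ∃ (g : Fin d → E d → ℂ) (h : Fin d → Fin d → E d → ℂ),
      (∀ i, MemL2Loc (g i) ∧ HasWeakPartial i u (g i)) ∧
        ∀ i j, MemL2Loc (h i j) ∧ HasWeakPartial j (g i) (h i j)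

/-- The Sommerfeld radiation condition with wave number `1`: `u` is differentiable near infinity
and `|x|^{(d-1)/2} (∂u/∂|x| - i u) → 0` as `|x| → ∞`, uniformly in all directions. -/
def SommerfeldRadiation {d : ℕ} (u : E d → ℂ) : Prop :=
  (∀ᶠ x in Bornology.cobounded (E d), DifferentiableAt ℝ u x) ∧
    Tendsto
      (fun x : E d => ((‖x‖ ^ (((d : ℝ) - 1) / 2) : ℝ) : ℂ)
        * (fderiv ℝ u x (‖x‖⁻¹ • x) - Complex.I * u x))
      (Bornology.cobounded (E d)) (𝓝 0)

/-- `u` is a nontrivial `H²_loc(ℝᵈ)` solution of `(Δ + 1) u = c n u` in `D`,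
`(Δ + 1) u = 0` in `ℝᵈ \ D` (almost everywhere) that satisfies the Sommerfeld radiation
condition. -/
def IsResonantMode {d : ℕ} (D : Set (E d)) (n : E d → ℝ) (c : ℂ) (u : E d → ℂ) : Prop :=
  MemH2Loc u ∧ ¬ (u =ᵐ[volume] 0) ∧
    (∃ w : E d → ℂ, HasWeakLaplacian u w ∧
      (∀ᵐ x, x ∈ D → w x + u x = c * (n x : ℂ) * u x) ∧
      (∀ᵐ x, x ∉ D → w x + u x = 0)) ∧
    SommerfeldRadiation u

end

/-! Let G * h denote convolution with `freeGreen d`. For λ ≠ 0 the eigenvalue equation K f = λ f in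
D is the same as the integral equation u = G * (n u 1_D) / λ on the whole space: its right-hand side
sees u only in D, so an eigenfunction extends to all of ℝᵈ and a solution restricts to an
eigenfunction. The operator K is compact (Young's inequality for the truncated kernel, then
approximation by finite-rank operators), so its nonzero spectrum consists of eigenvalues. What
remains is the equivalence between the integral equation and the differential equation with the
radiation condition; it is assembled in `hasEigenvalue_iff_exists_isResonantMode`.

From the integral to the differential equation, three facts about h ∈ L² with bounded support are
needed: (Δ + 1)(G * h) = h weakly (`hasWeakLaplacian_cv_freeGreen`), G * h is in H²_loc
(`memH2Loc_cv_freeGreen`), and G * h radiates (`sommerfeldRadiation_cv_freeGreen`). Conversely, if u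
is a resonant mode and h = n u 1_D / λ, then u - G * h is a radiating weak solution of (Δ + 1) z = 0
on all of ℝᵈ. It is smooth by Weyl's lemma (`exists_smooth_of_hasWeakLaplacian`) and therefore zero
(`eq_zero_of_sommerfeldRadiation`).

The explicit Green function enters only through its evenness and `IsOutgoingProfile`: the radial
equation away from 0, the flux r^(d-1) g'(r) tending to the reciprocal of the sphere area, and the
decay of g and of g' - i g, the latter one order better. For d ≥ 2 these are read off from the
integral of e^(r(i-s)) (s(1 + is/2))^b with b = (d-3)/2. The flux limit makes G a fundamental
solution: cutting out the singularity at scale ε leaves a commutator that converges to the delta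
function. Truncating G at infinity instead gives a compactly supported parametrix with a smooth
error, which yields both Weyl's lemma and H² regularity, the latter through the identity ∑ ‖∂ᵢ∂ⱼψ‖²
= ‖Δψ‖² for test functions.

Uniqueness combines two estimates on shells of radius comparable to R. Since the flux of an entire
solution W has no imaginary part, the weighted integral of |∂ᵣW|² + |W|² equals that of |∂ᵣW - iW|²,
which the radiation condition makes small. On the other hand, representing a cut-off W by the Green
function bounds |W(x₀)| by the same energy on the shell. -/

/-- The partial derivative in the `i`-th coordinate direction. -/
noncomputable def pd {d : ℕ} (i : Fin d) (f : E d → ℂ) (x : E d) : ℂ :=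
  fderiv ℝ f x (EuclideanSpace.single i 1)

/-- The Laplacian as the sum of the second partial derivatives. -/
noncomputable def lap {d : ℕ} (f : E d → ℂ) (x : E d) : ℂ := ∑ i, pd i (pd i f) x

/-- Complex-valued smooth functions with compact support. -/
structure IsTest {d : ℕ} (ψ : E d → ℂ) : Prop where
  smooth : ContDiff ℝ ∞ ψ
  cpt : HasCompactSupport ψ

/-! ### Partial derivatives, test functions and integration by parts -/

section Calculus

variable {d : ℕ} {f g ψ φ : E d → ℂ}

lemma ContDiff.pd (hf : ContDiff ℝ ∞ f) (i : Fin d) : ContDiff ℝ ∞ (pd i f) :=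
  (hf.fderiv_right (m := ∞) (by simp)).clm_apply contDiff_const

lemma ContDiff.lap (hf : ContDiff ℝ ∞ f) : ContDiff ℝ ∞ (lap f) :=
  ContDiff.sum fun i _ => (hf.pd i).pd i

lemma ContDiff.diffAt (hf : ContDiff ℝ ∞ f) (x : E d) : DifferentiableAt ℝ f x :=
  (hf.differentiable (by simp)) x

lemma HasCompactSupport.pd (hf : HasCompactSupport f) (i : Fin d) : HasCompactSupport (pd i f) :=
  hf.fderiv_apply (𝕜 := ℝ) _

lemma IsTest.pd (hψ : IsTest ψ) (i : Fin d) : IsTest (pd i ψ) :=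
  ⟨hψ.smooth.pd i, hψ.cpt.pd i⟩

lemma IsTest.add (hψ : IsTest ψ) (hφ : IsTest φ) : IsTest (fun x => ψ x + φ x) :=
  ⟨hψ.smooth.add hφ.smooth, hψ.cpt.add hφ.cpt⟩

lemma IsTest.mul_right (hψ : IsTest ψ) (hf : ContDiff ℝ ∞ f) : IsTest (fun x => ψ x * f x) :=
  ⟨hψ.smooth.mul hf, hψ.cpt.mul_right⟩

lemma HasCompactSupport.lap (hψ : HasCompactSupport ψ) : HasCompactSupport (lap ψ) := by
  refine HasCompactSupport.of_support_subset_isCompact hψ.isCompact fun x hx => ?_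
  by_contra hx'
  apply hx
  refine Finset.sum_eq_zero fun i _ => image_eq_zero_of_notMem_tsupport fun h => hx' ?_
  have key : ∀ {F : E d → ℂ}, tsupport (_root_.pd i F) ⊆ tsupport F := fun {F} =>
    closure_minimal (fun y hy => support_fderiv_subset ℝ (fun h0 => hy (by
      simp [_root_.pd, h0]))) (isClosed_tsupport _)
  exact key (key h)

lemma IsTest.lap (hψ : IsTest ψ) : IsTest (lap ψ) := ⟨hψ.smooth.lap, hψ.cpt.lap⟩

lemma IsTest.integrable (hψ : IsTest ψ) : Integrable ψ :=
  hψ.smooth.continuous.integrable_of_hasCompactSupport hψ.cpt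

lemma IsTest.memLp (hψ : IsTest ψ) (p : ENNReal) : MemLp ψ p :=
  hψ.smooth.continuous.memLp_of_hasCompactSupport hψ.cpt

lemma IsTest.conj (hψ : IsTest ψ) : IsTest (fun x => (starRingEnd ℂ) (ψ x)) :=
  ⟨Complex.conjCLE.contDiff.comp hψ.smooth, hψ.cpt.comp_left (map_zero _)⟩

lemma pd_mul (i : Fin d) {x : E d} (hf : DifferentiableAt ℝ f x) (hg : DifferentiableAt ℝ g x) :
    pd i (fun y => f y * g y) x = f x * pd i g x + pd i f x * g x := by
  simp [pd, fderiv_fun_mul hf hg]; ring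

lemma pd_add (i : Fin d) {x : E d} (hf : DifferentiableAt ℝ f x) (hg : DifferentiableAt ℝ g x) :
    pd i (fun y => f y + g y) x = pd i f x + pd i g x := by
  simp [pd, fderiv_fun_add hf hg]

lemma pd_sub (i : Fin d) {x : E d} (hf : DifferentiableAt ℝ f x) (hg : DifferentiableAt ℝ g x) :
    pd i (fun y => f y - g y) x = pd i f x - pd i g x := by
  simp [pd, fderiv_fun_sub hf hg]

lemma pd_conj (i : Fin d) {x : E d} (hf : DifferentiableAt ℝ f x) :
    pd i (fun y => (starRingEnd ℂ) (f y)) x = (starRingEnd ℂ) (pd i f x) := by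
  have h := (Complex.conjCLE.toContinuousLinearMap.hasFDerivAt.comp x hf.hasFDerivAt).fderiv
  have h2 : (fun y => (starRingEnd ℂ) (f y)) = (Complex.conjCLE.toContinuousLinearMap ∘ f) := by
    ext y; simp
  rw [pd, h2, h]; simp [pd]

lemma pd_congr (i : Fin d) {x : E d} (h : f =ᶠ[𝓝 x] g) : pd i f x = pd i g x := by
  simp [pd, h.fderiv_eq]

lemma lap_mul (hf : ContDiff ℝ ∞ f) (hg : ContDiff ℝ ∞ g) (x : E d) :
    lap (fun y => f y * g y) x
      = f x * lap g x + 2 * ∑ i, pd i f x * pd i g x + lap f x * g x := by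
  have h : ∀ i : Fin d, pd i (pd i fun y => f y * g y) x
      = f x * pd i (pd i g) x + 2 * (pd i f x * pd i g x) + pd i (pd i f) x * g x := fun i => by
    have h1 : pd i (fun y => f y * g y) = fun y => f y * pd i g y + pd i f y * g y := by
      ext y; exact pd_mul i (hf.diffAt y) (hg.diffAt y)
    rw [h1, pd_add i ((hf.mul (hg.pd i)).diffAt x) (((hf.pd i).mul hg).diffAt x),
      pd_mul i (hf.diffAt x) ((hg.pd i).diffAt x), pd_mul i ((hf.pd i).diffAt x) (hg.diffAt x)]
    ring
  simp only [lap, h, Finset.sum_add_distrib, Finset.mul_sum, Finset.sum_mul]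

lemma pd_comm (hf : ContDiff ℝ ∞ f) (i j : Fin d) : pd i (pd j f) = pd j (pd i f) := by
  ext x
  have h2 : ∀ (v w : E d), fderiv ℝ (fun y => fderiv ℝ f y v) x w
      = fderiv ℝ (fderiv ℝ f) x w v := fun v w => by
    rw [fderiv_clm_apply (((hf.fderiv_right (m := ∞) (by simp)).differentiable (by simp)) x)
      (differentiableAt_const _)]
    simp
  have hs : IsSymmSndFDerivAt ℝ f x := hf.contDiffAt.isSymmSndFDerivAt (by simpa using ENat.LEInfty.out)
  change fderiv ℝ (fun y => fderiv ℝ f y _) x _ = fderiv ℝ (fun y => fderiv ℝ f y _) x _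
  rw [h2, h2]
  exact hs _ _

lemma MeasureTheory.LocallyIntegrable.integrable_mul_test (hf : LocallyIntegrable f) (hψ : IsTest ψ) :
    Integrable (fun x => f x * ψ x) := by
  simpa [mul_comm] using hf.integrable_smul_left_of_hasCompactSupport hψ.smooth.continuous hψ.cpt

lemma integral_mul_pd (hf : ContDiff ℝ ∞ f) (hψ : IsTest ψ) (i : Fin d) :
    ∫ x, f x * pd i ψ x = -∫ x, pd i f x * ψ x :=
  integral_mul_fderiv_eq_neg_fderiv_mul_of_integrable
    ((hf.pd i).continuous.locallyIntegrable.integrable_mul_test hψ)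
    (hf.continuous.locallyIntegrable.integrable_mul_test (hψ.pd i))
    (hf.continuous.locallyIntegrable.integrable_mul_test hψ)
    (fun x _ => hf.diffAt x) (fun x _ => hψ.smooth.diffAt x)

lemma integral_mul_lap_eq_neg_sum (hf : ContDiff ℝ ∞ f) (hψ : IsTest ψ) :
    ∫ x, f x * lap ψ x = -∑ i, ∫ x, pd i f x * pd i ψ x := by
  simp only [lap, Finset.mul_sum]
  rw [integral_finsetSum _ fun i _ =>
    hf.continuous.locallyIntegrable.integrable_mul_test ((hψ.pd i).pd i), ← Finset.sum_neg_distrib]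
  exact Finset.sum_congr rfl fun i _ => integral_mul_pd hf (hψ.pd i) i

lemma integral_mul_lap (hf : ContDiff ℝ ∞ f) (hψ : IsTest ψ) :
    ∫ x, f x * lap ψ x = ∫ x, lap f x * ψ x := by
  rw [integral_mul_lap_eq_neg_sum hf hψ]
  simp only [lap, Finset.sum_mul]
  rw [integral_finsetSum _ fun i _ =>
    ((hf.pd i).pd i).continuous.locallyIntegrable.integrable_mul_test hψ, ← Finset.sum_neg_distrib]
  exact Finset.sum_congr rfl fun i _ => by rw [integral_mul_pd (hf.pd i) hψ i, neg_neg]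

lemma pd_ofReal (i : Fin d) {φ : E d → ℝ} {x : E d} (hφ : DifferentiableAt ℝ φ x) :
    pd i (fun y => (φ y : ℂ)) x = (fderiv ℝ φ x (EuclideanSpace.single i 1) : ℂ) := by
  have h := (Complex.ofRealCLM.hasFDerivAt.comp x hφ.hasFDerivAt).fderiv
  have h2 : (fun y => (φ y : ℂ)) = (Complex.ofRealCLM ∘ φ) := by ext y; simp
  rw [pd, h2, h]; simp

lemma IsTestFunction.isTest {φ : E d → ℝ} (hφ : IsTestFunction φ) :
    IsTest (fun x => (φ x : ℂ)) :=
  ⟨Complex.ofRealCLM.contDiff.comp hφ.1, hφ.2.comp_left Complex.ofReal_zero⟩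

lemma ofReal_laplacian {φ : E d → ℝ} (hφ : ContDiff ℝ ∞ φ) (x : E d) :
    ((Δ φ x : ℝ) : ℂ) = lap (fun y => (φ y : ℂ)) x := by
  have hd : Differentiable ℝ φ := hφ.differentiable (by simp)
  have hd2 : Differentiable ℝ (fderiv ℝ φ) :=
    (hφ.fderiv_right (m := ∞) (by simp)).differentiable (by simp)
  rw [InnerProductSpace.laplacian_eq_iteratedFDeriv_orthonormalBasis φ
    (EuclideanSpace.basisFun (Fin d) ℝ)]
  push_cast
  refine Finset.sum_congr rfl fun i _ => ?_
  have h1 : pd i (fun y => (φ y : ℂ))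
      = fun y => ((fderiv ℝ φ y (EuclideanSpace.single i 1) : ℝ) : ℂ) := by
    ext y; exact pd_ofReal i (hd y)
  rw [h1, pd_ofReal i ((hd2 x).clm_apply (differentiableAt_const _)),
    fderiv_clm_apply (hd2 x) (differentiableAt_const _), iteratedFDeriv_two_apply]
  simp

end Calculus

/-! ### Radial functions and the radial Helmholtz operator -/

section Radial

variable {d : ℕ}

lemma hasFDerivAt_norm_of_ne {x : E d} (hx : x ≠ 0) :
    HasFDerivAt (fun y : E d => ‖y‖) (‖x‖⁻¹ • innerSL ℝ x) x := by
  have hpos : 0 < ‖x‖ := norm_pos_iff.2 hx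
  have h := (hasStrictFDerivAt_norm_sq x).hasFDerivAt.sqrt (by positivity)
  simp only [Real.sqrt_sq (norm_nonneg _)] at h
  refine h.congr_fderiv ?_
  ext y
  simp
  field_simp

lemma hasFDerivAt_radial {f : ℝ → ℂ} {f' : ℂ} {x : E d} (hx : x ≠ 0)
    (h : HasDerivAt f f' ‖x‖) :
    HasFDerivAt (fun y : E d => f ‖y‖) ((‖x‖⁻¹ • innerSL ℝ x).smulRight f') x := by
  refine (h.hasFDerivAt.comp x (hasFDerivAt_norm_of_ne hx)).congr_fderiv ?_
  ext y
  simp [mul_assoc]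

lemma pd_radial {f : ℝ → ℂ} {f' : ℂ} {x : E d} (hx : x ≠ 0)
    (h : HasDerivAt f f' ‖x‖) (i : Fin d) :
    pd i (fun y => f ‖y‖) x = f' * ((x i / ‖x‖ : ℝ) : ℂ) := by
  rw [pd, (hasFDerivAt_radial hx h).fderiv]
  simp [EuclideanSpace.inner_single_right]
  ring

/-- The radial part `f'' + (d - 1) / r f' + f` of the operator `Δ + 1`. -/
noncomputable def radOp (d : ℕ) (f : ℝ → ℂ) (r : ℝ) : ℂ :=
  deriv (deriv f) r + (((d : ℝ) - 1) / r : ℝ) * deriv f r + f r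

lemma ContDiffOn.hasDerivAt_Ioi {f : ℝ → ℂ} (hf : ContDiffOn ℝ ∞ f (Set.Ioi 0)) {r : ℝ}
    (hr : 0 < r) : HasDerivAt f (deriv f r) r :=
  ((hf.contDiffAt (Ioi_mem_nhds hr)).differentiableAt (by simp)).hasDerivAt

lemma ContDiffOn.deriv_Ioi {f : ℝ → ℂ} (hf : ContDiffOn ℝ ∞ f (Set.Ioi 0)) :
    ContDiffOn ℝ ∞ (deriv f) (Set.Ioi 0) :=
  ((contDiffOn_infty_iff_deriv_of_isOpen isOpen_Ioi).1 hf).2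

lemma contDiffOn_radOp {f : ℝ → ℂ} (hf : ContDiffOn ℝ ∞ f (Set.Ioi 0)) :
    ContDiffOn ℝ ∞ (radOp d f) (Set.Ioi 0) := by
  refine (hf.deriv_Ioi.deriv_Ioi.add (ContDiffOn.mul ?_ hf.deriv_Ioi)).add hf
  exact Complex.ofRealCLM.contDiff.comp_contDiffOn
    (contDiffOn_const.div contDiffOn_id fun x hx => (Set.mem_Ioi.1 hx).ne')

/-- The first partials are k(|x|) xᵢ with k(r) = f'(r)/r. Differentiating again and summing with ∑
xᵢ² = |x|² gives d·k + |x| k', which is f'' + (d - 1) f'/r. -/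
lemma lap_radial {f : ℝ → ℂ} (hf : ContDiffOn ℝ ∞ f (Set.Ioi 0)) {x : E d} (hx : x ≠ 0) :
    lap (fun y => f ‖y‖) x + f ‖x‖ = radOp d f ‖x‖ := by
  have hpos : 0 < ‖x‖ := norm_pos_iff.2 hx
  have hC : ((‖x‖ : ℝ) : ℂ) ≠ 0 := by exact_mod_cast hpos.ne'
  set k : ℝ → ℂ := fun r => deriv f r * ((r⁻¹ : ℝ) : ℂ) with hk
  have hk' : HasDerivAt k (deriv (deriv f) ‖x‖ * ((‖x‖⁻¹ : ℝ) : ℂ)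
      + deriv f ‖x‖ * ((-(‖x‖ ^ 2)⁻¹ : ℝ) : ℂ)) ‖x‖ :=
    (hf.deriv_Ioi.hasDerivAt_Ioi hpos).mul (hasDerivAt_inv hpos.ne').ofReal_comp
  have hcoord : ∀ i : Fin d, HasFDerivAt (fun y : E d => ((y i : ℝ) : ℂ))
      (Complex.ofRealCLM.comp (EuclideanSpace.proj i : E d →L[ℝ] ℝ)) x := fun i =>
    (Complex.ofRealCLM.comp (EuclideanSpace.proj i : E d →L[ℝ] ℝ)).hasFDerivAt
  have hterm : ∀ i : Fin d, pd i (pd i fun y => f ‖y‖) x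
      = k ‖x‖ + (deriv (deriv f) ‖x‖ * ((‖x‖⁻¹ : ℝ) : ℂ)
      + deriv f ‖x‖ * ((-(‖x‖ ^ 2)⁻¹ : ℝ) : ℂ)) * ((x i ^ 2 / ‖x‖ : ℝ) : ℂ) := fun i => by
    have h1 : pd i (fun y : E d => f ‖y‖) =ᶠ[𝓝 x] fun y => k ‖y‖ * ((y i : ℝ) : ℂ) := by
      filter_upwards [isOpen_ne.mem_nhds hx] with y hy
      rw [pd_radial hy (hf.hasDerivAt_Ioi (norm_pos_iff.2 hy)) i]
      simp only [hk]; push_cast; ring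
    have h2 : pd i (fun y : E d => ((y i : ℝ) : ℂ)) x = 1 := by
      rw [pd, (hcoord i).fderiv]; simp
    rw [pd_congr i h1, pd_mul i (hasFDerivAt_radial hx hk').differentiableAt
      (hcoord i).differentiableAt, pd_radial hx hk' i, h2]
    push_cast; ring
  have hsum : ∑ i : Fin d, ((x i ^ 2 / ‖x‖ : ℝ) : ℂ) = (‖x‖ : ℂ) := by
    rw [← Complex.ofReal_sum, ← Finset.sum_div, ← EuclideanSpace.real_norm_sq_eq, sq,
      mul_div_cancel_right₀ _ hpos.ne']
  simp only [lap, hterm, Finset.sum_add_distrib, ← Finset.mul_sum, hsum, radOp, hk]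
  simp
  field_simp
  ring

/-- Constancy near 0 takes care of the one point where the norm is not smooth. -/
lemma contDiff_radial {f : ℝ → ℂ} (hf : ContDiffOn ℝ ∞ f (Set.Ioi 0)) {δ : ℝ} (hδ : 0 < δ)
    {c : ℂ} (h0 : ∀ r < δ, f r = c) : ContDiff ℝ ∞ (fun x : E d => f ‖x‖) := by
  rw [contDiff_iff_contDiffAt]
  intro x
  by_cases hx : x = 0
  · refine (contDiffAt_const (c := c)).congr_of_eventuallyEq ?_
    filter_upwards [Metric.ball_mem_nhds x hδ] with y hy
    exact h0 _ (by simpa [hx] using hy)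
  · exact (hf.contDiffAt (Ioi_mem_nhds (norm_pos_iff.2 hx))).comp x (contDiffAt_norm ℝ hx)

end Radial

/-! ### Flux at the origin and the commutator with a shrinking cutoff -/

section Delta

variable {d : ℕ}

/-- The reciprocal of the surface area of the unit sphere in `ℝᵈ`. -/
noncomputable def sphereConst (d : ℕ) : ℝ := (d * volume.real (Metric.ball (0 : E d) 1))⁻¹

lemma nontrivial_E (hd : 1 ≤ d) : Nontrivial (E d) := by
  have : Nonempty (Fin d) := ⟨⟨0, hd⟩⟩
  infer_instance

/-- The limit bounds r^m f'(r) near 0, and the mean value inequality on [r, ρ] carries this to f.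
The resulting bound on f is crude, but for m = d - 1 it suffices for local integrability. -/
lemma exists_bound_of_tendsto_deriv {f : ℝ → ℂ} (hf : ContDiffOn ℝ ∞ f (Set.Ioi 0)) {m : ℕ}
    {κ : ℂ} (hlim : Tendsto (fun r : ℝ => ((r ^ m : ℝ) : ℂ) * deriv f r) (𝓝[>] 0) (𝓝 κ)) :
    ∃ ρ B : ℝ, 0 < ρ ∧ 0 < B ∧ ∀ r, 0 < r → r < ρ →
      r ^ m * ‖deriv f r‖ ≤ B ∧ r ^ m * ‖f r‖ ≤ B := by
  have h1 : ∀ᶠ r : ℝ in 𝓝[>] 0, r ^ m * ‖deriv f r‖ < ‖κ‖ + 1 := by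
    have := hlim.norm.eventually (gt_mem_nhds (lt_add_one ‖κ‖))
    filter_upwards [this, self_mem_nhdsWithin] with r hr (hr0 : 0 < r)
    simpa [abs_of_pos hr0] using hr
  obtain ⟨ρ', hρ', h2⟩ := mem_nhdsGT_iff_exists_Ioo_subset.1 h1
  -- Strictly inside the interval where the bound on f' holds, and at most 1 so that r^m ≤ 1 and |r
  -- - ρ| ≤ 1 below.
  set ρ : ℝ := min ρ' 1 / 2 with hρdef
  have hρ : 0 < ρ := by have : 0 < min ρ' 1 := lt_min hρ' one_pos; positivity
  have hρ1 : ρ < ρ' := by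
    have := min_le_left ρ' 1; have : 0 < min ρ' 1 := lt_min hρ' one_pos; linarith
  have hρ2 : ρ ≤ 1 := by have := min_le_right ρ' 1; linarith
  refine ⟨ρ, ‖κ‖ + 1 + ‖f ρ‖, hρ, by positivity, fun r hr hrρ => ⟨?_, ?_⟩⟩
  · have := h2 ⟨hr, hrρ.trans hρ1⟩
    exact (le_of_lt this).trans (by simp)
  · have hr1 : r ^ m ≤ 1 := pow_le_one₀ hr.le (hrρ.le.trans hρ2)
    have hrm : 0 < r ^ m := by positivity
    have key : ‖f r - f ρ‖ ≤ (‖κ‖ + 1) / r ^ m * ‖r - ρ‖ := by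
      refine (convex_Icc r ρ).norm_image_sub_le_of_norm_hasDerivWithin_le (f' := deriv f)
        (fun x hx => (hf.hasDerivAt_Ioi (hr.trans_le hx.1)).hasDerivWithinAt) (fun x hx => ?_)
        ⟨hrρ.le, le_rfl⟩ ⟨le_rfl, hrρ.le⟩
      rw [le_div_iff₀ hrm, mul_comm]
      have := h2 ⟨hr.trans_le hx.1, hx.2.trans_lt hρ1⟩
      refine le_trans ?_ (le_of_lt this)
      gcongr
      exact hx.1
    have h3 : ‖r - ρ‖ ≤ 1 := by
      rw [Real.norm_eq_abs, abs_le]; constructor <;> linarith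
    have h4 : ‖f r‖ ≤ (‖κ‖ + 1) / r ^ m + ‖f ρ‖ := by
      have h5 := norm_le_norm_add_norm_sub' (f r) (f ρ)
      have : (‖κ‖ + 1) / r ^ m * ‖r - ρ‖ ≤ (‖κ‖ + 1) / r ^ m := mul_le_of_le_one_right (by positivity) h3
      linarith
    calc r ^ m * ‖f r‖ ≤ r ^ m * ((‖κ‖ + 1) / r ^ m + ‖f ρ‖) := by gcongr
      _ = (‖κ‖ + 1) + r ^ m * ‖f ρ‖ := by field_simp
      _ ≤ _ := by
        gcongr; exact mul_le_of_le_one_left (norm_nonneg _) hr1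

/-- In polar coordinates the Jacobian r^(d-1) absorbs the singularity at 0. -/
lemma locallyIntegrable_radial (hd : 1 ≤ d) {f : ℝ → ℂ} (hf : ContinuousOn f (Set.Ioi 0))
    {ρ B : ℝ} (hρ : 0 < ρ) (hB : ∀ r, 0 < r → r < ρ → r ^ (d - 1) * ‖f r‖ ≤ B) :
    LocallyIntegrable (fun x : E d => f ‖x‖) := by
  have := nontrivial_E hd
  intro x
  refine ⟨Metric.ball 0 (‖x‖ + 1), Metric.isOpen_ball.mem_nhds (by simp), ?_⟩
  set R := ‖x‖ + 1
  rw [integrableOn_fun_norm_addHaar]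
  simp only [finrank_euclideanSpace, Fintype.card_fin]
  have hcont : ContinuousOn (fun y : ℝ => y ^ (d - 1) • f y) (Set.Ioi 0) :=
    (continuous_pow (d - 1)).continuousOn.smul hf
  obtain ⟨B', hB'⟩ := (isCompact_Icc (a := ρ) (b := R)).exists_bound_of_continuousOn
    (hcont.mono fun y hy => hρ.trans_le hy.1)
  refine Integrable.of_bound
    ((hcont.mono fun y hy => hy.1).aestronglyMeasurable measurableSet_Ioo) (max B B') ?_
  filter_upwards [ae_restrict_mem measurableSet_Ioo] with y hy
  rcases lt_or_ge y ρ with h | h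
  · have := hB y hy.1 h
    rw [norm_smul, Real.norm_of_nonneg (pow_nonneg hy.1.le _)]
    exact this.trans (le_max_left _ _)
  · exact (hB' y ⟨h, hy.2.le⟩).trans (le_max_right _ _)

lemma sphereConst_pos (hd : 1 ≤ d) : 0 < sphereConst d := by
  have h : 0 < volume.real (Metric.ball (0 : E d) 1) :=
    ENNReal.toReal_pos (Metric.measure_ball_pos volume _ one_pos).ne'
      measure_ball_lt_top.ne
  unfold sphereConst; positivity

lemma integral_radial (hd : 1 ≤ d) (h : ℝ → ℂ) :
    ∫ x : E d, h ‖x‖ = ((sphereConst d)⁻¹ : ℝ) * ∫ r in Set.Ioi (0 : ℝ), ((r ^ (d - 1) : ℝ) : ℂ) * h r := by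
  have := nontrivial_E hd
  rw [integral_fun_norm_addHaar]
  simp [sphereConst, mul_assoc]

/-- The radial cutoff, equal to `0` for `r ≤ ε` and to `1` for `r ≥ 2 ε`. -/
noncomputable def innerCutoff (ε r : ℝ) : ℂ := (Real.smoothTransition (r / ε - 1) : ℂ)

lemma contDiff_innerCutoff (ε : ℝ) : ContDiff ℝ ∞ (innerCutoff ε) :=
  Complex.ofRealCLM.contDiff.comp
    (Real.smoothTransition.contDiff.comp ((contDiff_id.div_const ε).sub contDiff_const))

lemma innerCutoff_eq_zero {ε r : ℝ} (hε : 0 < ε) (h : r ≤ ε) : innerCutoff ε r = 0 := by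
  have : r / ε ≤ 1 := (div_le_one hε).2 h
  simp [innerCutoff, Real.smoothTransition.zero_of_nonpos (sub_nonpos.2 this)]

lemma innerCutoff_eq_one {ε r : ℝ} (hε : 0 < ε) (h : 2 * ε ≤ r) : innerCutoff ε r = 1 := by
  have : 2 ≤ r / ε := (le_div_iff₀ hε).2 h
  simp [innerCutoff, Real.smoothTransition.one_of_one_le (by linarith : 1 ≤ r / ε - 1)]

lemma norm_innerCutoff_le (ε r : ℝ) : ‖innerCutoff ε r‖ ≤ 1 := by
  rw [innerCutoff, Complex.norm_real, Real.norm_of_nonneg (Real.smoothTransition.nonneg _)]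
  exact Real.smoothTransition.le_one _

lemma innerCutoff_scale (ε r : ℝ) : innerCutoff ε r = innerCutoff 1 (ε⁻¹ * r) := by
  simp [innerCutoff, div_eq_inv_mul]

lemma deriv_innerCutoff (ε r : ℝ) :
    deriv (innerCutoff ε) r = (ε⁻¹ : ℝ) * deriv (innerCutoff 1) (ε⁻¹ * r) := by
  rw [show innerCutoff ε = fun r => innerCutoff 1 (ε⁻¹ * r) from funext (innerCutoff_scale ε)]
  rw [deriv_comp_mul_left]; simp

lemma deriv_deriv_innerCutoff (ε r : ℝ) :
    deriv (deriv (innerCutoff ε)) r = (ε⁻¹ ^ 2 : ℝ) * deriv (deriv (innerCutoff 1)) (ε⁻¹ * r) := by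
  rw [show deriv (innerCutoff ε) = fun r => ((ε⁻¹ : ℝ) : ℂ) * deriv (innerCutoff 1) (ε⁻¹ * r) from
    funext (deriv_innerCutoff ε)]
  rw [deriv_const_mul_field, deriv_comp_mul_left]; simp; ring

lemma deriv_innerCutoff_eq_zero {ε r : ℝ} (hε : 0 < ε) (h : r < ε ∨ 2 * ε < r) :
    deriv (innerCutoff ε) r = 0 ∧ deriv (deriv (innerCutoff ε)) r = 0 := by
  have key : ∀ (c : ℂ) (s : Set ℝ), IsOpen s → r ∈ s → (∀ y ∈ s, innerCutoff ε y = c) →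
      deriv (innerCutoff ε) r = 0 ∧ deriv (deriv (innerCutoff ε)) r = 0 := by
    intro c s hs hr hc
    have h1 : innerCutoff ε =ᶠ[𝓝 r] fun _ => c := by
      filter_upwards [hs.mem_nhds hr] with y hy using hc y hy
    have h2 := h1.deriv
    refine ⟨by simpa using h2.eq_of_nhds, by simpa using h2.deriv.eq_of_nhds⟩
  rcases h with h | h
  · exact key 0 (Set.Iio ε) isOpen_Iio h fun y hy => innerCutoff_eq_zero hε (le_of_lt hy)
  · exact key 1 (Set.Ioi (2 * ε)) isOpen_Ioi h fun y hy => innerCutoff_eq_one hε (le_of_lt hy)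

lemma exists_bound_deriv_innerCutoff : ∃ M : ℝ, 0 < M ∧
    ∀ r, ‖deriv (innerCutoff 1) r‖ ≤ M ∧ ‖deriv (deriv (innerCutoff 1)) r‖ ≤ M := by
  have hs1 : ContDiff ℝ ∞ (deriv (innerCutoff 1)) :=
    (contDiff_infty_iff_deriv.1 (contDiff_innerCutoff 1)).2
  have hs2 : ContDiff ℝ ∞ (deriv (deriv (innerCutoff 1))) := (contDiff_infty_iff_deriv.1 hs1).2
  obtain ⟨M1, h1⟩ := (isCompact_Icc (a := (0 : ℝ)) (b := 3)).exists_bound_of_continuousOn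
    hs1.continuous.continuousOn
  obtain ⟨M2, h2⟩ := (isCompact_Icc (a := (0 : ℝ)) (b := 3)).exists_bound_of_continuousOn
    hs2.continuous.continuousOn
  refine ⟨max 1 (max M1 M2), by positivity, fun r => ?_⟩
  by_cases hr : r ∈ Set.Icc (0 : ℝ) 3
  · exact ⟨(h1 r hr).trans (by simp), (h2 r hr).trans (by simp)⟩
  · have := deriv_innerCutoff_eq_zero one_pos (r := r) (by
      rw [Set.mem_Icc, not_and_or] at hr
      rcases hr with h | h
      · left; linarith
      · right; linarith)
    simp [this.1, this.2]

/-- The commutator of `radOp` with the inner cutoff. -/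
noncomputable def cutoffComm (d : ℕ) (f : ℝ → ℂ) (ε r : ℝ) : ℂ :=
  deriv (deriv (innerCutoff ε)) r * f r + 2 * (deriv (innerCutoff ε) r * deriv f r)
    + (((d : ℝ) - 1) / r : ℝ) * (deriv (innerCutoff ε) r * f r)

lemma radOp_mul {a f : ℝ → ℂ} (ha : ContDiffOn ℝ ∞ a (Set.Ioi 0))
    (hf : ContDiffOn ℝ ∞ f (Set.Ioi 0)) {r : ℝ} (hr : 0 < r) :
    radOp d (fun s => a s * f s) r = a r * radOp d f r + (deriv (deriv a) r * f r
      + 2 * (deriv a r * deriv f r) + (((d : ℝ) - 1) / r : ℝ) * (deriv a r * f r)) := by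
  have h1 : ∀ s, 0 < s → deriv (fun s => a s * f s) s = deriv a s * f s + a s * deriv f s :=
    fun s hs => ((ha.hasDerivAt_Ioi hs).mul (hf.hasDerivAt_Ioi hs)).deriv
  have h2 : deriv (fun s => a s * f s) =ᶠ[𝓝 r] fun s => deriv a s * f s + a s * deriv f s := by
    filter_upwards [Ioi_mem_nhds hr] with s hs using h1 s hs
  have h3 : HasDerivAt (fun s => deriv a s * f s + a s * deriv f s) _ r := (((ha.deriv_Ioi.hasDerivAt_Ioi hr).mul (hf.hasDerivAt_Ioi hr)).add
    ((ha.hasDerivAt_Ioi hr).mul (hf.deriv_Ioi.hasDerivAt_Ioi hr)))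
  rw [radOp, h2.deriv_eq, h1 r hr, h3.deriv, radOp]
  ring

/-- On the shell ε ≤ r ≤ 2ε two derivatives, or one derivative and 1/r, cost at most ε⁻², and f or
f' costs ε^(-(d-1)). The factor 3 + d collects 1 from η'' f, 2 from 2 η' f' and d from (d - 1)/r. -/
lemma norm_cutoffComm_le (hd : 1 ≤ d) {f : ℝ → ℂ} {ρ B : ℝ}
    (hB : ∀ r, 0 < r → r < ρ → r ^ (d - 1) * ‖deriv f r‖ ≤ B ∧ r ^ (d - 1) * ‖f r‖ ≤ B) :
    ∃ C : ℝ, ∀ ε, 0 < ε → ε ≤ 1 → 2 * ε < ρ → ∀ r, 0 < r →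
      ‖cutoffComm d f ε r‖ ≤ C / ε ^ (d + 1) := by
  obtain ⟨M, hM, hM'⟩ := exists_bound_deriv_innerCutoff
  refine ⟨(3 + d) * M * |B|, fun ε hε hε1 hερ r hr => ?_⟩
  by_cases hr2 : r < ε ∨ 2 * ε < r
  · have := deriv_innerCutoff_eq_zero hε hr2
    simp only [cutoffComm, this.1, this.2]
    simp only [zero_mul, mul_zero, add_zero, norm_zero]
    positivity
  · push Not at hr2
    have hp : 0 < ε ^ (d - 1) := by positivity
    have hle : ε ^ (d - 1) ≤ r ^ (d - 1) := pow_le_pow_left₀ hε.le hr2.1 _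
    have hb := hB r hr (hr2.2.trans_lt hερ)
    have hf1 : ‖deriv f r‖ ≤ |B| / ε ^ (d - 1) := by
      rw [le_div_iff₀ hp, mul_comm]
      exact (mul_le_mul_of_nonneg_right hle (norm_nonneg _)).trans (hb.1.trans (le_abs_self B))
    have hf0 : ‖f r‖ ≤ |B| / ε ^ (d - 1) := by
      rw [le_div_iff₀ hp, mul_comm]
      exact (mul_le_mul_of_nonneg_right hle (norm_nonneg _)).trans (hb.2.trans (le_abs_self B))
    have h1 : ‖deriv (innerCutoff ε) r‖ ≤ ε⁻¹ * M := by
      rw [deriv_innerCutoff, norm_mul, Complex.norm_real, Real.norm_of_nonneg (by positivity)]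
      gcongr; exact (hM' _).1
    have h2 : ‖deriv (deriv (innerCutoff ε)) r‖ ≤ ε⁻¹ ^ 2 * M := by
      rw [deriv_deriv_innerCutoff, norm_mul, Complex.norm_real, Real.norm_of_nonneg (by positivity)]
      gcongr; exact (hM' _).2
    have h3 : ‖((((d : ℝ) - 1) / r : ℝ) : ℂ)‖ ≤ d * ε⁻¹ := by
      have hd' : (1 : ℝ) ≤ d := by exact_mod_cast hd
      rw [Complex.norm_real, Real.norm_of_nonneg (div_nonneg (by linarith) hr.le), div_eq_mul_inv]
      have := inv_anti₀ hε hr2.1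
      gcongr
      linarith
    have hε2 : ε⁻¹ ≤ ε⁻¹ ^ 2 := by
      have : 1 ≤ ε⁻¹ := (one_le_inv₀ hε).2 hε1
      nlinarith
    calc ‖cutoffComm d f ε r‖
        ≤ ε⁻¹ ^ 2 * M * (|B| / ε ^ (d - 1)) + 2 * (ε⁻¹ * M * (|B| / ε ^ (d - 1)))
          + d * ε⁻¹ * (ε⁻¹ * M * (|B| / ε ^ (d - 1))) := by
          refine (norm_add₃_le).trans ?_
          simp only [norm_mul, Complex.norm_ofNat]
          gcongr
      _ ≤ ε⁻¹ ^ 2 * M * (|B| / ε ^ (d - 1)) + 2 * (ε⁻¹ ^ 2 * M * (|B| / ε ^ (d - 1)))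
          + d * ε⁻¹ * (ε⁻¹ * M * (|B| / ε ^ (d - 1))) := by gcongr
      _ = (3 + d) * M * |B| / ε ^ (d + 1) := by
          obtain ⟨m, rfl⟩ : ∃ m, d = m + 1 := ⟨d - 1, by omega⟩
          simp only [Nat.add_sub_cancel]
          field_simp
          push_cast
          ring

/-- With η the cutoff, r^(d-1) times the commutator equals (r^(d-1) η' f)' + η' · r^(d-1) f'. The
first term integrates to 0; the second averages r^(d-1) f' against η', which has total mass 1 and
concentrates at 0. -/
lemma tendsto_integral_cutoffComm (hd : 1 ≤ d) {f : ℝ → ℂ} (hf : ContDiffOn ℝ ∞ f (Set.Ioi 0))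
    {κ : ℂ}
    (hlim : Tendsto (fun r : ℝ => ((r ^ (d - 1) : ℝ) : ℂ) * deriv f r) (𝓝[>] 0) (𝓝 κ)) :
    Tendsto (fun ε => ∫ r in Set.Ioi (0 : ℝ), ((r ^ (d - 1) : ℝ) : ℂ) * cutoffComm d f ε r)
      (𝓝[>] 0) (𝓝 κ) := by
  obtain ⟨M, hM, hM'⟩ := exists_bound_deriv_innerCutoff
  rw [Metric.tendsto_nhds]
  intro τ hτ
  -- The integration interval below has length 5ε/2 and |η'| ≤ M/ε, so this tolerance leaves a total
  -- error of 5τ/6.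
  obtain ⟨ρ, hρ, hρ'⟩ := mem_nhdsGT_iff_exists_Ioo_subset.1
    (Metric.tendsto_nhds.1 hlim (τ / (3 * M)) (by positivity))
  filter_upwards [Ioo_mem_nhdsGT (show (0 : ℝ) < ρ / 3 from div_pos hρ three_pos)] with ε hε
  have hε0 : 0 < ε := hε.1
  -- The interval [ε/2, 3ε] contains the transition shell [ε, 2ε] in its interior, so the boundary
  -- terms vanish.
  have hle : ε / 2 ≤ 3 * ε := by linarith
  have hIoc : ∀ u : ℝ → ℂ, (∀ r, r < ε ∨ 2 * ε < r → u r = 0) →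
      ∫ r in Set.Ioi (0 : ℝ), u r = ∫ r in (ε / 2)..(3 * ε), u r := by
    intro u hu
    rw [intervalIntegral.integral_of_le hle]
    refine (setIntegral_eq_of_subset_of_forall_sdiff_eq_zero measurableSet_Ioi
      (fun r hr => (by linarith [hr.1] : (0 : ℝ) < r)) fun r hr => hu r ?_)
    have h2 := hr.2
    rw [Set.mem_Ioc, not_and_or] at h2
    rcases h2 with h | h
    · left; linarith
    · right; linarith
  have hpos : ∀ r ∈ Set.uIcc (ε / 2) (3 * ε), 0 < r := fun r hr => by
    rw [Set.uIcc_of_le hle] at hr; linarith [hr.1]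
  have hη1 : ContDiff ℝ ∞ (deriv (innerCutoff ε)) :=
    (contDiff_infty_iff_deriv.1 (contDiff_innerCutoff ε)).2
  have hη2 : ContDiff ℝ ∞ (deriv (deriv (innerCutoff ε))) := (contDiff_infty_iff_deriv.1 hη1).2
  have hcf : ContinuousOn f (Set.uIcc (ε / 2) (3 * ε)) := hf.continuousOn.mono hpos
  have hcf1 : ContinuousOn (deriv f) (Set.uIcc (ε / 2) (3 * ε)) :=
    hf.deriv_Ioi.continuousOn.mono hpos
  have hcp : ∀ k : ℕ, Continuous fun r : ℝ => ((r ^ k : ℝ) : ℂ) := fun k => by fun_prop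
  set P : ℝ → ℂ := fun r => ((r ^ (d - 1) : ℝ) : ℂ) * deriv (innerCutoff ε) r * f r with hP
  set P' : ℝ → ℂ := fun r => ((((d - 1 : ℕ) * r ^ (d - 1 - 1) : ℝ) : ℂ) * deriv (innerCutoff ε) r
    + ((r ^ (d - 1) : ℝ) : ℂ) * deriv (deriv (innerCutoff ε)) r) * f r
    + ((r ^ (d - 1) : ℝ) : ℂ) * deriv (innerCutoff ε) r * deriv f r with hP'
  have hPd : ∀ r ∈ Set.uIcc (ε / 2) (3 * ε), HasDerivAt P (P' r) r := fun r hr =>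
    ((hasDerivAt_pow (d - 1) r).ofReal_comp.mul (hη1.differentiable (by simp) r).hasDerivAt).mul
      (hf.hasDerivAt_Ioi (hpos r hr))
  have hP'c : ContinuousOn P' (Set.uIcc (ε / 2) (3 * ε)) := by
    refine ((((Continuous.continuousOn (by fun_prop)).mul hη1.continuous.continuousOn).add
      ((hcp _).continuousOn.mul hη2.continuous.continuousOn)).mul hcf).add
      (((hcp _).continuousOn.mul hη1.continuous.continuousOn).mul hcf1)
  set Q : ℝ → ℂ := fun r => deriv (innerCutoff ε) r * (((r ^ (d - 1) : ℝ) : ℂ) * deriv f r) with hQ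
  have hQc : ContinuousOn Q (Set.uIcc (ε / 2) (3 * ε)) :=
    hη1.continuous.continuousOn.mul ((hcp _).continuousOn.mul hcf1)
  have hsplit : ∫ r in Set.Ioi (0 : ℝ), ((r ^ (d - 1) : ℝ) : ℂ) * cutoffComm d f ε r
      = ∫ r in (ε / 2)..(3 * ε), Q r := by
    rw [hIoc]
    · have : ∫ r in (ε / 2)..(3 * ε), ((r ^ (d - 1) : ℝ) : ℂ) * cutoffComm d f ε r
          = ∫ r in (ε / 2)..(3 * ε), (P' r + Q r) := by
        refine intervalIntegral.integral_congr fun r hr => ?_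
        have hr0 := hpos r hr
        have hC : (r : ℂ) ≠ 0 := by exact_mod_cast hr0.ne'
        obtain ⟨m, rfl⟩ : ∃ m, d = m + 1 := ⟨d - 1, by omega⟩
        -- For m = 0 (dimension one) the exponent is truncated, but the factor m makes both sides
        -- zero.
        have hm : (((m : ℝ) * r ^ (m - 1) : ℝ) : ℂ) = (r : ℂ) ^ m * ((m : ℂ) / r) := by
          rcases m with _ | m
          · simp
          · simp only [Nat.add_sub_cancel]; push_cast; field_simp; ring
        simp only [cutoffComm, hP', hQ, Nat.add_sub_cancel, hm]
        push_cast
        ring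
      rw [this, intervalIntegral.integral_add hP'c.intervalIntegrable hQc.intervalIntegrable,
        intervalIntegral.integral_eq_sub_of_hasDerivAt hPd hP'c.intervalIntegrable]
      have h1 : P (3 * ε) = 0 := by
        simp [hP, (deriv_innerCutoff_eq_zero hε0 (r := 3 * ε) (Or.inr (by linarith))).1]
      have h2 : P (ε / 2) = 0 := by
        simp [hP, (deriv_innerCutoff_eq_zero hε0 (r := ε / 2) (Or.inl (by linarith))).1]
      rw [h1, h2]; simp
    · intro r hr
      have := deriv_innerCutoff_eq_zero hε0 hr
      simp [cutoffComm, this.1, this.2]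
  have hone : ∫ r in (ε / 2)..(3 * ε), deriv (innerCutoff ε) r * κ = κ := by
    rw [intervalIntegral.integral_mul_const, intervalIntegral.integral_deriv_eq_sub
      (fun r _ => (contDiff_innerCutoff ε).differentiable (by simp) r)
      hη1.continuous.continuousOn.intervalIntegrable,
      innerCutoff_eq_one hε0 (by linarith), innerCutoff_eq_zero hε0 (by linarith)]
    simp
  rw [hsplit, dist_eq_norm]
  nth_rewrite 1 [← hone]
  have hκi : IntervalIntegrable (fun r => deriv (innerCutoff ε) r * κ) volume (ε / 2) (3 * ε) :=
    (hη1.continuous.mul continuous_const).intervalIntegrable _ _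
  rw [← intervalIntegral.integral_sub hQc.intervalIntegrable hκi]
  have hbd : ∀ r ∈ Set.uIoc (ε / 2) (3 * ε), ‖Q r - deriv (innerCutoff ε) r * κ‖
      ≤ ε⁻¹ * M * (τ / (3 * M)) := by
    intro r hr
    rw [Set.uIoc_of_le hle] at hr
    by_cases hr2 : 2 * ε < r
    · have := deriv_innerCutoff_eq_zero hε0 (Or.inr hr2)
      simp only [hQ, this.1, zero_mul, sub_zero, norm_zero]
      positivity
    · rw [hQ, ← mul_sub, norm_mul, deriv_innerCutoff, norm_mul, Complex.norm_real,
        Real.norm_of_nonneg (by positivity)]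
      have h3 : r ∈ Set.Ioo 0 ρ := ⟨by linarith [hr.1], by linarith [hε.2]⟩
      have h4 : dist _ _ ≤ τ / (3 * M) := (Set.mem_ofPred.1 (hρ' h3)).le
      rw [dist_eq_norm] at h4
      gcongr
      exact (hM' _).1
  refine (intervalIntegral.norm_integral_le_of_norm_le_const hbd).trans_lt ?_
  rw [abs_of_nonneg (by linarith)]
  have : ε⁻¹ * M * (τ / (3 * M)) * (3 * ε - ε / 2) = (5 / 6) * τ := by
    field_simp; ring
  rw [this]; linarith

end Delta

/-! ### The commutator converges to the delta function -/

section Delta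

variable {d : ℕ}

/-- Averaging over ±x cancels the linear Taylor term; L is a Lipschitz constant of the derivative.
-/
lemma IsTest.exists_norm_symm_sub_le {ψ : E d → ℂ} (hψ : IsTest ψ) :
    ∃ L : ℝ, ∀ x, ‖(ψ x + ψ (-x)) / 2 - ψ 0‖ ≤ L * ‖x‖ ^ 2 := by
  obtain ⟨L, hL⟩ := ContDiff.lipschitzWith_of_hasCompactSupport (n := 1) (hψ.cpt.fderiv ℝ)
    (hψ.smooth.fderiv_right (m := 1) (by rw [one_add_one_eq_two]; exact ENat.LEInfty.out)) one_ne_zero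
  have key : ∀ x, ‖ψ x - ψ 0 - fderiv ℝ ψ 0 x‖ ≤ L * ‖x‖ ^ 2 := fun x => by
    have := (convex_closedBall (0 : E d) ‖x‖).norm_image_sub_le_of_norm_fderiv_le'
      (f := ψ) (φ := fderiv ℝ ψ 0) (C := L * ‖x‖) (x := 0) (y := x)
      (fun y _ => hψ.smooth.diffAt y) (fun y hy => ?_) (by simp) (by simp)
    · simpa [sq, mul_assoc] using this
    · have h1 := hL.dist_le_mul y 0
      rw [dist_eq_norm, dist_zero_right] at h1
      refine h1.trans ?_
      gcongr
      simpa using hy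
  refine ⟨L, fun x => ?_⟩
  have h2 := key (-x)
  rw [map_neg, norm_neg] at h2
  have h3 : (ψ x + ψ (-x)) / 2 - ψ 0 = ((ψ x - ψ 0 - fderiv ℝ ψ 0 x)
      + (ψ (-x) - ψ 0 - -fderiv ℝ ψ 0 x)) / 2 := by ring
  rw [h3, norm_div, Complex.norm_ofNat, div_le_iff₀ two_pos]
  exact (norm_add_le _ _).trans (by linarith [key x])

lemma IsTest.comp_neg {ψ : E d → ℂ} (hψ : IsTest ψ) : IsTest (fun x => ψ (-x)) :=
  ⟨hψ.smooth.comp contDiff_neg, hψ.cpt.comp_homeomorph (Homeomorph.neg (E d))⟩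

lemma isTest_cutoffComm {f : ℝ → ℂ} (hf : ContDiffOn ℝ ∞ f (Set.Ioi 0)) {ε : ℝ} (hε : 0 < ε) :
    IsTest (fun x : E d => cutoffComm d f ε ‖x‖) := by
  have h1 := (contDiff_innerCutoff ε).contDiffOn (s := Set.Ioi 0)
  refine ⟨contDiff_radial (c := 0) ?_ hε fun r hr => ?_, ?_⟩
  · refine ((h1.deriv_Ioi.deriv_Ioi.mul hf).add
      (contDiffOn_const.mul (h1.deriv_Ioi.mul hf.deriv_Ioi))).add
      (ContDiffOn.mul ?_ (h1.deriv_Ioi.mul hf))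
    exact Complex.ofRealCLM.contDiff.comp_contDiffOn
      (contDiffOn_const.div contDiffOn_id fun x hx => (Set.mem_Ioi.1 hx).ne')
  · have := deriv_innerCutoff_eq_zero hε (Or.inl hr)
    simp [cutoffComm, this.1, this.2]
  · refine HasCompactSupport.of_support_subset_isCompact (isCompact_closedBall 0 (2 * ε))
      fun x hx => ?_
    by_contra h
    have := deriv_innerCutoff_eq_zero hε (Or.inr (by simpa using h : 2 * ε < ‖x‖))
    simp [cutoffComm, this.1, this.2] at hx

/-- The weight is radial, so ψ may be replaced by its even part. The even part differs from ψ(0) by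
O(ε²) on a ball of volume O(ε^d), where the weight is O(ε^(-(d+1))), so the error is O(ε). Without
the symmetrisation the error ψ(x) - ψ(0) = O(ε) would give only a bounded term. -/
lemma tendsto_integral_cutoffComm_mul (hd : 1 ≤ d) {f : ℝ → ℂ}
    (hf : ContDiffOn ℝ ∞ f (Set.Ioi 0))
    (hlim : Tendsto (fun r : ℝ => ((r ^ (d - 1) : ℝ) : ℂ) * deriv f r) (𝓝[>] 0)
      (𝓝 (sphereConst d : ℂ))) {ψ : E d → ℂ} (hψ : IsTest ψ) :
    Tendsto (fun ε => ∫ x : E d, cutoffComm d f ε ‖x‖ * ψ x) (𝓝[>] 0) (𝓝 (ψ 0)) := by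
  obtain ⟨ρ, B, hρ, hB, hb⟩ := exists_bound_of_tendsto_deriv hf hlim
  obtain ⟨C, hC⟩ := norm_cutoffComm_le hd hb
  obtain ⟨L, hL⟩ := hψ.exists_norm_symm_sub_le
  have hκ : ((sphereConst d)⁻¹ : ℝ) * (sphereConst d : ℂ) = 1 := by
    rw [← Complex.ofReal_mul, inv_mul_cancel₀ (sphereConst_pos hd).ne', Complex.ofReal_one]
  have h1 : Tendsto (fun ε => ψ 0 * ∫ x : E d, cutoffComm d f ε ‖x‖) (𝓝[>] 0) (𝓝 (ψ 0)) := by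
    have := ((tendsto_integral_cutoffComm hd hf hlim).const_mul
      (((sphereConst d)⁻¹ : ℝ) : ℂ)).const_mul (ψ 0)
    rw [hκ, mul_one] at this
    refine this.congr fun ε => ?_
    rw [integral_radial hd]
  set V := volume.real (Metric.ball (0 : E d) 1)
  have h2 : Tendsto (fun ε => ∫ x : E d, cutoffComm d f ε ‖x‖ * ((ψ x + ψ (-x)) / 2 - ψ 0))
      (𝓝[>] 0) (𝓝 0) := by
    have h0 : Tendsto (fun ε : ℝ => (C * L * 4 * 2 ^ d * V) * ε) (𝓝[>] 0) (𝓝 0) := by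
      have : Tendsto (fun ε : ℝ => (C * L * 4 * 2 ^ d * V) * ε) (𝓝 0)
          (𝓝 ((C * L * 4 * 2 ^ d * V) * 0)) := (continuous_const.mul continuous_id).tendsto 0
      rw [mul_zero] at this
      exact this.mono_left nhdsWithin_le_nhds
    refine squeeze_zero_norm' ?_ h0
    filter_upwards [Ioo_mem_nhdsGT (show (0 : ℝ) < min 1 (ρ / 2) by positivity)] with ε hε
    have hε0 : 0 < ε := hε.1
    have hε1 : ε < 1 := hε.2.trans_le (min_le_left _ _)
    have hερ : 2 * ε < ρ := by have := hε.2.trans_le (min_le_right _ _); linarith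
    have hC0 : 0 ≤ C := by
      have := (norm_nonneg _).trans (hC ε hε0 hε1.le hερ 1 one_pos)
      by_contra hneg
      have : C / ε ^ (d + 1) < 0 := div_neg_of_neg_of_pos (not_le.1 hneg) (by positivity)
      linarith
    have hset : ∫ x : E d, cutoffComm d f ε ‖x‖ * ((ψ x + ψ (-x)) / 2 - ψ 0)
        = ∫ x in Metric.closedBall (0 : E d) (2 * ε),
          cutoffComm d f ε ‖x‖ * ((ψ x + ψ (-x)) / 2 - ψ 0) := by
      refine (setIntegral_eq_integral_of_forall_compl_eq_zero fun x hx => ?_).symm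
      have := deriv_innerCutoff_eq_zero hε0 (Or.inr (by simpa using hx : 2 * ε < ‖x‖))
      simp [cutoffComm, this.1, this.2]
    rw [hset]
    have hn := norm_setIntegral_le_of_norm_le_const (μ := volume)
      (s := Metric.closedBall (0 : E d) (2 * ε))
      (f := fun x => cutoffComm d f ε ‖x‖ * ((ψ x + ψ (-x)) / 2 - ψ 0))
      (C := C / ε ^ (d + 1) * (L * (2 * ε) ^ 2)) measure_closedBall_lt_top (fun x hx => by
        have hx' : ‖x‖ ≤ 2 * ε := by simpa using hx
        rw [norm_mul]
        have hL0 : 0 ≤ L * ‖x‖ ^ 2 := (norm_nonneg _).trans (hL x)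
        -- The bound on the commutator requires r > 0. At the origin the other factor vanishes, and
        -- a unit vector supplies the sign of L.
        rcases eq_or_ne x 0 with rfl | hx0
        · have h0 : (ψ 0 + ψ (-0)) / 2 - ψ 0 = 0 := by simp
          rw [h0, norm_zero (E := ℂ), mul_zero]
          by_cases hLn : 0 ≤ L
          · positivity
          · exfalso
            have hv : ∃ v : E d, ‖v‖ ^ 2 = 1 := by
              refine ⟨EuclideanSpace.single ⟨0, hd⟩ 1, by simp⟩
            obtain ⟨v, hv⟩ := hv
            have := (norm_nonneg _).trans (hL v)
            rw [hv] at this; linarith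
        · have hpos : 0 < ‖x‖ := norm_pos_iff.2 hx0
          have hLn : 0 ≤ L := nonneg_of_mul_nonneg_left hL0 (by positivity)
          refine mul_le_mul (hC ε hε0 hε1.le hερ _ hpos) ((hL x).trans ?_) (norm_nonneg _)
            (by positivity)
          gcongr)
    refine hn.trans (le_of_eq ?_)
    rw [Measure.addHaar_real_closedBall _ _ (by positivity), finrank_euclideanSpace,
      Fintype.card_fin, mul_pow]
    field_simp
    ring
  have h3 := h1.add h2
  rw [add_zero] at h3
  refine h3.congr' ?_
  filter_upwards [self_mem_nhdsWithin] with ε (hε : 0 < ε)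
  have hc : IsTest (fun x : E d => cutoffComm d f ε ‖x‖) := isTest_cutoffComm hf hε
  have hi1 : Integrable (fun x : E d => cutoffComm d f ε ‖x‖ * ψ x) :=
    (hc.mul_right hψ.smooth).integrable
  have hi2 : Integrable (fun x : E d => cutoffComm d f ε ‖x‖ * ψ (-x)) :=
    (hc.mul_right hψ.comp_neg.smooth).integrable
  have hsym : ∫ x : E d, cutoffComm d f ε ‖x‖ * ψ (-x) = ∫ x : E d, cutoffComm d f ε ‖x‖ * ψ x := by
    rw [← integral_neg_eq_self]; simp
  have hsplit : ∀ x : E d, cutoffComm d f ε ‖x‖ * ((ψ x + ψ (-x)) / 2 - ψ 0)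
      = (1 / 2 : ℂ) * (cutoffComm d f ε ‖x‖ * ψ x + cutoffComm d f ε ‖x‖ * ψ (-x))
        - ψ 0 * cutoffComm d f ε ‖x‖ := fun x => by ring
  simp only [hsplit]
  have hi12 : Integrable (fun x : E d => (1 / 2 : ℂ) *
      (cutoffComm d f ε ‖x‖ * ψ x + cutoffComm d f ε ‖x‖ * ψ (-x))) := (hi1.add hi2).const_mul _
  rw [integral_sub hi12 (hc.integrable.const_mul _), integral_const_mul,
    integral_const_mul, integral_add hi1 hi2, hsym]
  ring

/-- A radial function with the singularity of the fundamental solution of the Laplacian at the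
origin and annihilated by `Δ + 1` near the origin is, up to a regular remainder, a fundamental
solution of `Δ + 1`. -/
theorem integral_radial_mul_lap_add (hd : 1 ≤ d) {f : ℝ → ℂ}
    (hf : ContDiffOn ℝ ∞ f (Set.Ioi 0))
    (hlim : Tendsto (fun r : ℝ => ((r ^ (d - 1) : ℝ) : ℂ) * deriv f r) (𝓝[>] 0)
      (𝓝 (sphereConst d : ℂ)))
    {δ : ℝ} (hδ : 0 < δ) (hq : ∀ r, 0 < r → r < δ → radOp d f r = 0)
    {ψ : E d → ℂ} (hψ : IsTest ψ) :
    ∫ x : E d, f ‖x‖ * (lap ψ x + ψ x) = ψ 0 + ∫ x : E d, radOp d f ‖x‖ * ψ x := by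
  obtain ⟨ρ, B, hρ, hB, hb⟩ := exists_bound_of_tendsto_deriv hf hlim
  have := nontrivial_E hd
  have hfl : LocallyIntegrable (fun x : E d => f ‖x‖) :=
    locallyIntegrable_radial hd hf.continuousOn hρ fun r h0 h1 => (hb r h0 h1).2
  have hql : LocallyIntegrable (fun x : E d => radOp d f ‖x‖) :=
    locallyIntegrable_radial (B := 0) hd (contDiffOn_radOp hf).continuousOn hδ fun r h0 h1 => by
      simp [hq r h0 h1]
  have hψ' : IsTest (fun x => lap ψ x + ψ x) := hψ.lap.add hψ
  have hne : ∀ᵐ x : E d, x ≠ 0 := by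
    simp [ae_iff, measure_singleton]
  have h1 : Tendsto (fun ε => ∫ x : E d, innerCutoff ε ‖x‖ * f ‖x‖ * (lap ψ x + ψ x)) (𝓝[>] 0)
      (𝓝 (∫ x : E d, f ‖x‖ * (lap ψ x + ψ x))) := by
    have hint := hfl.integrable_mul_test hψ'
    refine tendsto_integral_filter_of_dominated_convergence
      (fun x => ‖f ‖x‖ * (lap ψ x + ψ x)‖) (Eventually.of_forall fun ε => ?_)
      (Eventually.of_forall fun ε => Eventually.of_forall fun x => ?_) hint.norm ?_
    · have := (((contDiff_innerCutoff ε).continuous.comp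
        (continuous_norm (E := E d))).aestronglyMeasurable (μ := volume)).mul
          hint.aestronglyMeasurable
      refine this.congr (Eventually.of_forall fun x => ?_)
      simp [mul_assoc]
    · rw [mul_assoc, norm_mul]
      exact mul_le_of_le_one_left (norm_nonneg _) (norm_innerCutoff_le _ _)
    · filter_upwards [hne] with x hx
      refine tendsto_const_nhds.congr' ?_
      have hpos : 0 < ‖x‖ / 2 := by have := norm_pos_iff.2 hx; positivity
      filter_upwards [Ioo_mem_nhdsGT hpos] with ε hε
      rw [innerCutoff_eq_one hε.1 (by linarith [hε.2]), one_mul]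
  have h2 := (tendsto_integral_cutoffComm_mul hd hf hlim hψ).add_const
    (∫ x : E d, radOp d f ‖x‖ * ψ x)
  refine tendsto_nhds_unique h1 (h2.congr' ?_)
  filter_upwards [Ioo_mem_nhdsGT (show (0 : ℝ) < δ / 2 by positivity)] with ε hε
  have hε0 : 0 < ε := hε.1
  have hηs := (contDiff_innerCutoff ε).contDiffOn (s := Set.Ioi 0)
  -- Once the singularity is cut out the function is smooth on the whole space, and Green's identity
  -- against ψ is classical.
  have hF : ContDiff ℝ ∞ (fun x : E d => innerCutoff ε ‖x‖ * f ‖x‖) :=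
    contDiff_radial (f := fun r => innerCutoff ε r * f r) (c := 0) (hηs.mul hf) hε0 fun r hr => by
      simp [innerCutoff_eq_zero hε0 hr.le]
  have hc : IsTest (fun x : E d => cutoffComm d f ε ‖x‖) := isTest_cutoffComm hf hε0
  rw [← integral_add (hc.mul_right hψ.smooth).integrable (hql.integrable_mul_test hψ)]
  simp only [mul_add]
  rw [integral_add (hF.continuous.locallyIntegrable.integrable_mul_test hψ.lap)
    (hF.continuous.locallyIntegrable.integrable_mul_test hψ), integral_mul_lap hF hψ,
    ← integral_add (hF.lap.continuous.locallyIntegrable.integrable_mul_test hψ)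
    (hF.continuous.locallyIntegrable.integrable_mul_test hψ)]
  refine integral_congr_ae ?_
  filter_upwards [hne] with x hx
  have hpos := norm_pos_iff.2 hx
  have h3 := lap_radial (d := d) (hηs.mul hf) hx
  have h4 := radOp_mul (d := d) hηs hf hpos
  -- Since 2ε < δ, the cutoff differs from 1 only where `radOp d f` is zero.
  have h5 : innerCutoff ε ‖x‖ * radOp d f ‖x‖ = radOp d f ‖x‖ := by
    rcases lt_or_ge ‖x‖ (2 * ε) with h | h
    · rw [hq _ hpos (by linarith [hε.2]), mul_zero]
    · rw [innerCutoff_eq_one hε0 h, one_mul]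
  rw [← add_mul, ← add_mul, h3, h4, h5, cutoffComm]
  ring

end Delta

/-! ### The Laplace-type integral of the Hankel function: smoothness and differential equation -/

section LaplaceIntegral

lemma integrableOn_rpow_mul_pow_mul_exp {b c : ℝ} (hb : -1 < b) (hc : 0 < c) (N : ℕ) :
    IntegrableOn (fun s : ℝ => s ^ b * (1 + s) ^ N * Real.exp (-(c * s))) (Set.Ioi 0) := by
  induction N generalizing b with
  | zero =>
    have := integrableOn_rpow_mul_exp_neg_mul_rpow (p := 1) hb one_pos hc
    simpa using this
  | succ N ih =>
    refine ((ih hb).add (ih (b := b + 1) (by linarith))).congr_fun (fun s hs => ?_) measurableSet_Ioi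
    have hs' : (0 : ℝ) < s := hs
    simp only [Pi.add_apply, Real.rpow_add hs', Real.rpow_one]
    ring

lemma ofReal_mul_cpow {r : ℝ} (hr : 0 < r) {z : ℂ} (hz : z ≠ 0) (c : ℂ) :
    ((r : ℂ) * z) ^ c = (r : ℂ) ^ c * z ^ c := by
  have hr' : (r : ℂ) ≠ 0 := by exact_mod_cast hr.ne'
  rw [Complex.cpow_def_of_ne_zero (mul_ne_zero hr' hz), Complex.log_ofReal_mul hr hz,
    Complex.cpow_def_of_ne_zero hr', Complex.cpow_def_of_ne_zero hz, ← Complex.exp_add,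
    Complex.ofReal_log hr.le]
  ring_nf

/-- The weight `(s (1 + i s / 2)) ^ b` in the integral formula for the Hankel function. -/
noncomputable def hankelWeight (b s : ℝ) : ℂ :=
  ((s ^ b : ℝ) : ℂ) * (1 + Complex.I * ((s / 2 : ℝ) : ℂ)) ^ (b : ℂ)

/-- The `k`-th derivative of the Laplace-type integral for the Hankel function. -/
noncomputable def hankelLaplace (b : ℝ) (k : ℕ) (r : ℝ) : ℂ :=
  ∫ s in Set.Ioi (0 : ℝ), (Complex.I - s) ^ k * Complex.exp (r * (Complex.I - s)) * hankelWeight b s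

lemma one_le_norm_one_add (s : ℝ) : 1 ≤ ‖1 + Complex.I * ((s / 2 : ℝ) : ℂ)‖ := by
  have := Complex.abs_re_le_norm (1 + Complex.I * ((s / 2 : ℝ) : ℂ))
  simpa using this

lemma one_add_mem_slitPlane (s : ℝ) :
    1 + Complex.I * ((s / 2 : ℝ) : ℂ) ∈ Complex.slitPlane := by
  left; simp

lemma one_add_ne_zero (s : ℝ) : 1 + Complex.I * ((s / 2 : ℝ) : ℂ) ≠ 0 :=
  Complex.slitPlane_ne_zero (one_add_mem_slitPlane s)

lemma norm_one_add_cpow_le {b : ℝ} {m : ℕ} (hm : b ≤ m) {s : ℝ} (hs : 0 < s) :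
    ‖(1 + Complex.I * ((s / 2 : ℝ) : ℂ)) ^ (b : ℂ)‖ ≤ (1 + s) ^ m := by
  rw [Complex.norm_cpow_real]
  calc _ ≤ ‖1 + Complex.I * ((s / 2 : ℝ) : ℂ)‖ ^ (m : ℝ) :=
        Real.rpow_le_rpow_of_exponent_le (one_le_norm_one_add s) hm
    _ ≤ (1 + s) ^ m := by
        rw [Real.rpow_natCast]
        gcongr
        refine (norm_add_le _ _).trans ?_
        simp only [norm_one, norm_mul, Complex.norm_I, one_mul, Complex.norm_real, Real.norm_eq_abs]
        rw [abs_of_pos (by positivity)]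
        linarith

lemma norm_hankelWeight_le {b : ℝ} {m : ℕ} (hm : b ≤ m) {s : ℝ} (hs : 0 < s) :
    ‖hankelWeight b s‖ ≤ s ^ b * (1 + s) ^ m := by
  rw [hankelWeight, norm_mul, Complex.norm_real, Real.norm_of_nonneg (Real.rpow_nonneg hs.le _)]
  exact mul_le_mul_of_nonneg_left (norm_one_add_cpow_le hm hs) (Real.rpow_nonneg hs.le _)

lemma continuousOn_hankelWeight (b : ℝ) : ContinuousOn (hankelWeight b) (Set.Ioi 0) := by
  refine ContinuousOn.mul ?_ ?_
  · exact Complex.continuous_ofReal.comp_continuousOn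
      (continuousOn_id.rpow_const fun x hx => Or.inl (Set.mem_Ioi.1 hx).ne')
  · exact (Continuous.continuousOn (by fun_prop)).cpow_const fun s _ => one_add_mem_slitPlane s

lemma norm_I_sub_le {s : ℝ} (hs : 0 < s) : ‖Complex.I - s‖ ≤ 1 + s := by
  refine (norm_sub_le _ _).trans ?_
  simp [abs_of_pos hs]

lemma norm_exp_mul_I_sub (r s : ℝ) :
    ‖Complex.exp (r * (Complex.I - s))‖ = Real.exp (-(r * s)) := by
  rw [Complex.norm_exp]; simp

lemma aestronglyMeasurable_hankel_integrand (b : ℝ) (k : ℕ) (r : ℝ) :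
    AEStronglyMeasurable (fun s : ℝ => (Complex.I - s) ^ k * Complex.exp (r * (Complex.I - s))
      * hankelWeight b s) (volume.restrict (Set.Ioi 0)) :=
  ((Continuous.continuousOn (by fun_prop)).mul
    (continuousOn_hankelWeight b)).aestronglyMeasurable measurableSet_Ioi

lemma norm_hankel_integrand_le {b : ℝ} {m : ℕ} (hm : b ≤ m) (k : ℕ) {c r s : ℝ} (hcr : c ≤ r)
    (hs : 0 < s) :
    ‖(Complex.I - s) ^ k * Complex.exp (r * (Complex.I - s)) * hankelWeight b s‖
      ≤ s ^ b * (1 + s) ^ (k + m) * Real.exp (-(c * s)) := by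
  rw [norm_mul, norm_mul, norm_pow, norm_exp_mul_I_sub]
  calc _ ≤ (1 + s) ^ k * Real.exp (-(c * s)) * (s ^ b * (1 + s) ^ m) := by
        gcongr
        · exact norm_I_sub_le hs
        · exact norm_hankelWeight_le hm hs
    _ = _ := by ring

lemma integrableOn_hankel_integrand {b : ℝ} (hb : -1 < b) (k : ℕ) {r : ℝ} (hr : 0 < r) :
    IntegrableOn (fun s : ℝ => (Complex.I - s) ^ k * Complex.exp (r * (Complex.I - s))
      * hankelWeight b s) (Set.Ioi 0) := by
  obtain ⟨m, hm⟩ := exists_nat_ge b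
  refine (integrableOn_rpow_mul_pow_mul_exp hb hr (k + m)).mono'
    (aestronglyMeasurable_hankel_integrand b k r) ?_
  filter_upwards [ae_restrict_mem measurableSet_Ioi] with s hs
  exact norm_hankel_integrand_le hm k le_rfl hs

/-- Each derivative brings down a factor i - s. On the neighbourhood (r/2, ∞) of r the exponential
rate r/2 dominates uniformly. -/
lemma hasDerivAt_hankelLaplace {b : ℝ} (hb : -1 < b) (k : ℕ) {r : ℝ} (hr : 0 < r) :
    HasDerivAt (hankelLaplace b k) (hankelLaplace b (k + 1) r) r := by
  obtain ⟨m, hm⟩ := exists_nat_ge b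
  refine (hasDerivAt_integral_of_dominated_loc_of_deriv_le
    (F' := fun (r s : ℝ) => (Complex.I - s) ^ (k + 1) * Complex.exp (r * (Complex.I - s))
      * hankelWeight b s)
    (bound := fun s => s ^ b * (1 + s) ^ (k + 1 + m) * Real.exp (-(r / 2 * s)))
    (Ioi_mem_nhds (half_lt_self hr))
    (Eventually.of_forall fun x => aestronglyMeasurable_hankel_integrand b k x)
    (integrableOn_hankel_integrand hb k hr) (aestronglyMeasurable_hankel_integrand b (k + 1) r) ?_
    (integrableOn_rpow_mul_pow_mul_exp hb (half_pos hr) (k + 1 + m)) ?_).2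
  · filter_upwards [ae_restrict_mem measurableSet_Ioi] with s hs x hx
    exact norm_hankel_integrand_le hm (k + 1) (le_of_lt hx) hs
  · refine Eventually.of_forall fun s x _ => ?_
    have h1 : HasDerivAt (fun x : ℝ => Complex.exp (x * (Complex.I - s)))
        (Complex.exp (x * (Complex.I - s)) * (1 * (Complex.I - s))) x :=
      ((Complex.ofRealCLM.hasDerivAt (x := x)).mul_const (Complex.I - (s : ℂ))).cexp
    refine ((h1.const_mul ((Complex.I - (s : ℂ)) ^ k)).mul_const
      (hankelWeight b s)).congr_deriv ?_
    ring

lemma contDiffOn_hankelLaplace {b : ℝ} (hb : -1 < b) (k : ℕ) :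
    ContDiffOn ℝ ∞ (hankelLaplace b k) (Set.Ioi 0) := by
  rw [contDiffOn_infty]
  intro n
  induction n generalizing k with
  | zero =>
    rw [Nat.cast_zero, contDiffOn_zero]
    exact fun r hr => (hasDerivAt_hankelLaplace hb k hr).continuousAt.continuousWithinAt
  | succ n ih =>
    rw [Nat.cast_add, Nat.cast_one, contDiffOn_succ_iff_deriv_of_isOpen isOpen_Ioi]
    refine ⟨fun r hr => (hasDerivAt_hankelLaplace hb k hr).differentiableAt.differentiableWithinAt,
      by simp, (ih (k + 1)).congr fun r hr => (hasDerivAt_hankelLaplace hb k hr).deriv⟩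

/-- Put p = s(1 + is/2). Then (i - s)² + 1 = -2ip and p' = -i(i - s), so the combination is, up to
the factor -i/2, the integral of the derivative of Φ = e^(r(i-s)) p^(b+1). This Φ vanishes at 0,
because b + 1 > 0, and at infinity. -/
lemma hankelLaplace_ode {b : ℝ} (hb : -1 < b) {r : ℝ} (hr : 0 < r) :
    r * (hankelLaplace b 2 r + hankelLaplace b 0 r) + 2 * (b + 1) * hankelLaplace b 1 r = 0 := by
  obtain ⟨m, hm⟩ := exists_nat_ge b
  set Φ : ℝ → ℂ := fun s => Complex.exp (r * (Complex.I - s)) * (((s ^ (b + 1) : ℝ) : ℂ)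
    * (1 + Complex.I * ((s / 2 : ℝ) : ℂ)) ^ ((b + 1 : ℝ) : ℂ)) with hΦ
  set Φ' : ℝ → ℂ := fun s => (-Complex.I / 2) *
    (r * ((Complex.I - s) ^ 2 * Complex.exp (r * (Complex.I - s)) * hankelWeight b s
      + (Complex.I - s) ^ 0 * Complex.exp (r * (Complex.I - s)) * hankelWeight b s)
      + 2 * (b + 1) * ((Complex.I - s) ^ 1 * Complex.exp (r * (Complex.I - s))
        * hankelWeight b s)) with hΦ'
  have hderiv : ∀ s ∈ Set.Ioi (0 : ℝ), HasDerivAt Φ (Φ' s) s := by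
    intro s (hs : 0 < s)
    have h1 : HasDerivAt (fun s : ℝ => Complex.exp (r * (Complex.I - s)))
        (Complex.exp (r * (Complex.I - s)) * (r * (-1))) s :=
      (((Complex.ofRealCLM.hasDerivAt (x := s)).const_sub Complex.I).const_mul (r : ℂ)).cexp
    have h2 : HasDerivAt (fun s : ℝ => ((s ^ (b + 1) : ℝ) : ℂ))
        (((b + 1) * s ^ (b + 1 - 1) : ℝ) : ℂ) s :=
      (Real.hasDerivAt_rpow_const (Or.inl hs.ne')).ofReal_comp
    have h3 : HasDerivAt (fun z : ℂ => (1 + Complex.I * (z / 2)) ^ ((b + 1 : ℝ) : ℂ))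
        (((b + 1 : ℝ) : ℂ) * (1 + Complex.I * ((s : ℂ) / 2)) ^ (((b + 1 : ℝ) : ℂ) - 1)
          * (Complex.I * (1 / 2))) (s : ℂ) := by
      refine HasDerivAt.cpow_const (((hasDerivAt_id (s : ℂ)).div_const 2).const_mul Complex.I
        |>.const_add 1) ?_
      have := one_add_mem_slitPlane s
      push_cast at this
      exact this
    have h4 := h1.mul (h2.mul h3.comp_ofReal)
    have h5 := h4.congr_of_eventuallyEq (f₁ := Φ) (Eventually.of_forall fun x => by simp [hΦ])
    refine h5.congr_deriv ?_
    simp only [hΦ', hankelWeight, Pi.mul_apply]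
    have e1 : s ^ (b + 1) = s ^ b * s := by rw [Real.rpow_add hs, Real.rpow_one]
    have e2 : (1 + Complex.I * ((s / 2 : ℝ) : ℂ)) ^ ((b + 1 : ℝ) : ℂ)
        = (1 + Complex.I * ((s / 2 : ℝ) : ℂ)) ^ (b : ℂ) * (1 + Complex.I * ((s / 2 : ℝ) : ℂ)) := by
      rw [Complex.ofReal_add, Complex.ofReal_one, Complex.cpow_add _ _ (one_add_ne_zero s),
        Complex.cpow_one]
    have e3 : (1 + Complex.I * ((s : ℂ) / 2)) = 1 + Complex.I * ((s / 2 : ℝ) : ℂ) := by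
      push_cast; ring
    have e4 : ((b + 1 : ℝ) : ℂ) - 1 = (b : ℂ) := by push_cast; ring
    rw [add_sub_cancel_right, e3, e4, e2, e1]
    generalize (1 + Complex.I * ((s / 2 : ℝ) : ℂ)) ^ (b : ℂ) = Z
    generalize Complex.exp (r * (Complex.I - s)) = W
    push_cast
    have hI : Complex.I ^ 2 = -1 := Complex.I_sq
    ring_nf
    have hI3 : Complex.I ^ 3 = -Complex.I := by rw [pow_succ, hI]; ring
    simp only [hI, hI3]
    ring
  have hi := fun k => integrableOn_hankel_integrand hb k hr
  have hint' : IntegrableOn Φ' (Set.Ioi 0) :=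
    ((((hi 2).add (hi 0)).const_mul (r : ℂ)).add ((hi 1).const_mul (2 * ((b : ℂ) + 1)))).const_mul
      (-Complex.I / 2)
  have hint : IntegrableOn Φ (Set.Ioi 0) :=
    (integrableOn_hankel_integrand (b := b + 1) (by linarith) 0 hr).congr_fun
      (fun s _ => by simp [hΦ, hankelWeight]) measurableSet_Ioi
  have hlim : Tendsto Φ atTop (𝓝 0) :=
    tendsto_zero_of_hasDerivAt_of_integrableOn_Ioi hderiv hint' hint
  have hcont : ContinuousWithinAt Φ (Set.Ici 0) 0 := by
    refine ContinuousAt.continuousWithinAt (ContinuousAt.mul (by fun_prop) (ContinuousAt.mul ?_ ?_))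
    · exact Complex.continuous_ofReal.continuousAt.comp
        (Real.continuousAt_rpow_const _ _ (Or.inr (by linarith)))
    · exact ContinuousAt.cpow (by fun_prop) continuousAt_const (one_add_mem_slitPlane 0)
  have h := integral_Ioi_of_hasDerivAt_of_tendsto hcont hderiv hint' hlim
  have h0 : Φ 0 = 0 := by
    simp [hΦ, Real.zero_rpow (by linarith : b + 1 ≠ 0)]
  rw [h0, sub_zero] at h
  simp only [hΦ'] at h
  rw [integral_const_mul] at h
  have h2 := (mul_eq_zero.1 h).resolve_left (by simp)
  have hi20 : IntegrableOn (fun s : ℝ => (r : ℂ) *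
      ((Complex.I - s) ^ 2 * Complex.exp (r * (Complex.I - s)) * hankelWeight b s
      + (Complex.I - s) ^ 0 * Complex.exp (r * (Complex.I - s)) * hankelWeight b s)) (Set.Ioi 0) :=
    ((hi 2).add (hi 0)).const_mul (r : ℂ)
  rw [integral_add hi20 ((hi 1).const_mul _), integral_const_mul,
    integral_const_mul, integral_add (hi 2) (hi 0)] at h2
  exact h2

end LaplaceIntegral

/-! ### Behaviour of the Laplace-type integral at 0 and at infinity -/

section LaplaceIntegral

/-- The integrand of the rescaled first derivative of the Laplace-type integral. -/
noncomputable def hankelScaled (b r t : ℝ) : ℂ :=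
  (Complex.I * r - t) * ((Real.exp (-t) * t ^ b : ℝ) : ℂ)
    * ((r : ℂ) + Complex.I * ((t / 2 : ℝ) : ℂ)) ^ (b : ℂ)

/-- The substitution t = rs moves r out of the exponential, so that the integrand has a limit as r →
0. -/
lemma integral_hankelScaled {b r : ℝ} (hr : 0 < r) :
    ∫ t in Set.Ioi (0 : ℝ), hankelScaled b r t
      = ((r ^ (2 * b + 2) : ℝ) : ℂ) * Complex.exp (-(r * Complex.I)) * hankelLaplace b 1 r := by
  have h := integral_comp_mul_left_Ioi (hankelScaled b r) 0 hr
  rw [mul_zero] at h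
  have hr' : (r : ℂ) ≠ 0 := by exact_mod_cast hr.ne'
  have h2 : ∫ t in Set.Ioi (0 : ℝ), hankelScaled b r t
      = r * ∫ s in Set.Ioi (0 : ℝ), hankelScaled b r (r * s) := by
    rw [h, Complex.real_smul, Complex.ofReal_inv, mul_inv_cancel_left₀ hr']
  rw [h2, hankelLaplace, ← integral_const_mul, ← integral_const_mul]
  refine setIntegral_congr_fun measurableSet_Ioi fun s (hs : 0 < s) => ?_
  have e1 : (r : ℂ) + Complex.I * ((r * s / 2 : ℝ) : ℂ)
      = r * (1 + Complex.I * ((s / 2 : ℝ) : ℂ)) := by push_cast; ring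
  have e2 : r ^ (2 * b + 2) = r ^ b * r ^ b * r * r := by
    rw [show 2 * b + 2 = b + b + 1 + 1 by ring, Real.rpow_add hr, Real.rpow_add hr,
      Real.rpow_add hr, Real.rpow_one]
  have e3 : Complex.exp (r * (Complex.I - s))
      = Complex.exp (r * Complex.I) * ((Real.exp (-(r * s)) : ℝ) : ℂ) := by
    rw [Complex.ofReal_exp, ← Complex.exp_add]; congr 1; push_cast; ring
  have e4 : Complex.exp (-(r * Complex.I)) * Complex.exp (r * Complex.I) = 1 := by
    rw [← Complex.exp_add]; simp
  simp only [hankelScaled, hankelWeight]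
  rw [e1, ofReal_mul_cpow hr (one_add_ne_zero s), e2, e3, Real.mul_rpow hr.le hs.le,
    ← Complex.ofReal_cpow hr.le]
  push_cast
  linear_combination (-(((r ^ b : ℝ) : ℂ) ^ 2 * r ^ 2 * (Complex.I - s) *
    Complex.exp (-(r * s)) * ((s ^ b : ℝ) : ℂ) *
      (1 + Complex.I * (s / 2)) ^ (b : ℂ))) * e4

/-- For negative b the power |r + it/2|^b is not bounded as r and t approach 0. The prefactor is at
most 2|r + it/2|, which raises the exponent to b + 1 > 0 and makes the bound uniform in r. -/
lemma norm_hankelScaled_le {b : ℝ} (hb : -1 < b) {m : ℕ} (hm : b + 1 ≤ m) {r t : ℝ} (hr : 0 < r)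
    (hr1 : r < 1) (ht : 0 < t) :
    ‖hankelScaled b r t‖ ≤ 2 * (t ^ b * (1 + t) ^ m * Real.exp (-(1 * t))) := by
  set z : ℂ := (r : ℂ) + Complex.I * ((t / 2 : ℝ) : ℂ) with hz
  have hzne : 0 < ‖z‖ := by
    refine norm_pos_iff.2 fun h => ?_
    have := congrArg Complex.re h
    simp [hz] at this
    exact hr.ne' this
  have h1 : ‖Complex.I * r - t‖ ≤ 2 * ‖z‖ := by
    refine le_of_sq_le_sq ?_ (by positivity) |>.trans le_rfl
    rw [mul_pow, ← Complex.normSq_eq_norm_sq, ← Complex.normSq_eq_norm_sq, Complex.normSq_apply,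
      Complex.normSq_apply]
    simp [hz]
    nlinarith [sq_nonneg r, sq_nonneg t]
  have h2 : ‖z‖ ≤ 1 + t := by
    refine (norm_add_le _ _).trans ?_
    simp only [norm_mul, Complex.norm_I, one_mul, Complex.norm_real, Real.norm_eq_abs]
    rw [abs_of_pos hr, abs_of_pos (by positivity)]
    linarith
  have h3 : ‖z‖ ^ (b + 1) ≤ (1 + t) ^ m := by
    calc ‖z‖ ^ (b + 1) ≤ (1 + t) ^ (b + 1) := Real.rpow_le_rpow hzne.le h2 (by linarith)
      _ ≤ (1 + t) ^ (m : ℝ) := Real.rpow_le_rpow_of_exponent_le (by linarith) hm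
      _ = _ := Real.rpow_natCast _ _
  have h4 : 0 < Real.exp (-t) * t ^ b := mul_pos (Real.exp_pos _) (Real.rpow_pos_of_pos ht b)
  rw [hankelScaled, norm_mul, norm_mul, Complex.norm_real, Real.norm_of_nonneg h4.le,
    Complex.norm_cpow_real, one_mul]
  calc ‖Complex.I * r - t‖ * (Real.exp (-t) * t ^ b) * ‖z‖ ^ b
      ≤ 2 * ‖z‖ * (Real.exp (-t) * t ^ b) * ‖z‖ ^ b := by gcongr
    _ = 2 * (Real.exp (-t) * t ^ b) * ‖z‖ ^ (b + 1) := by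
        rw [Real.rpow_add hzne, Real.rpow_one]; ring
    _ ≤ 2 * (Real.exp (-t) * t ^ b) * (1 + t) ^ m := by gcongr
    _ = _ := by ring

/-- Dominated convergence. At r = 0 the integrand is -(i/2)^b e^(-t) t^(2b+1), whose integral is a
Gamma value. -/
lemma tendsto_integral_hankelScaled {b : ℝ} (hb : -1 < b) :
    Tendsto (fun r => ∫ t in Set.Ioi (0 : ℝ), hankelScaled b r t) (𝓝[>] 0)
      (𝓝 (-((Complex.I / 2) ^ (b : ℂ) * (Real.Gamma (2 * b + 2) : ℂ)))) := by
  obtain ⟨m, hm⟩ := exists_nat_ge (b + 1)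
  have hlim : ∫ t in Set.Ioi (0 : ℝ), hankelScaled b 0 t
      = -((Complex.I / 2) ^ (b : ℂ) * (Real.Gamma (2 * b + 2) : ℂ)) := by
    rw [Real.Gamma_eq_integral (by linarith : 0 < 2 * b + 2), ← integral_complex_ofReal,
      ← integral_const_mul, ← integral_neg]
    refine setIntegral_congr_fun measurableSet_Ioi fun t (ht : 0 < t) => ?_
    have e1 : ((0 : ℝ) : ℂ) + Complex.I * ((t / 2 : ℝ) : ℂ) = t * (Complex.I / 2) := by
      push_cast; ring
    have e2 : t ^ (2 * b + 2 - 1) = t ^ b * t ^ b * t := by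
      rw [show 2 * b + 2 - 1 = b + b + 1 by ring, Real.rpow_add ht, Real.rpow_add ht, Real.rpow_one]
    simp only [hankelScaled]
    rw [e1, ofReal_mul_cpow ht (by simp), e2, ← Complex.ofReal_cpow ht.le]
    push_cast
    ring
  rw [← hlim]
  refine tendsto_integral_filter_of_dominated_convergence
    (fun t => 2 * (t ^ b * (1 + t) ^ m * Real.exp (-(1 * t)))) ?_ ?_
    ((integrableOn_rpow_mul_pow_mul_exp hb one_pos m).const_mul 2) ?_
  · filter_upwards [self_mem_nhdsWithin] with r (hr : 0 < r)
    refine ContinuousOn.aestronglyMeasurable ?_ measurableSet_Ioi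
    refine ContinuousOn.mul (ContinuousOn.mul (by fun_prop) ?_) ?_
    · exact Complex.continuous_ofReal.comp_continuousOn ((by fun_prop : ContinuousOn (fun t : ℝ =>
        Real.exp (-t)) _).mul (continuousOn_id.rpow_const fun x hx => Or.inl (Set.mem_Ioi.1 hx).ne'))
    · refine (Continuous.continuousOn (by fun_prop)).cpow_const fun t _ => ?_
      left; simpa using hr
  · filter_upwards [Ioo_mem_nhdsGT one_pos] with r hr
    filter_upwards [ae_restrict_mem measurableSet_Ioi] with t ht
    exact norm_hankelScaled_le hb hm hr.1 hr.2 ht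
  · filter_upwards [ae_restrict_mem measurableSet_Ioi] with t (ht : 0 < t)
    have : ContinuousAt (fun r : ℝ => hankelScaled b r t) 0 := by
      refine ContinuousAt.mul (by fun_prop) (ContinuousAt.cpow (by fun_prop) continuousAt_const ?_)
      right; simpa using ht.ne'
    exact this.tendsto.mono_left nhdsWithin_le_nhds

lemma tendsto_pow_mul_hankelLaplace {b : ℝ} (hb : -1 < b) {N : ℕ} (hN : (N : ℝ) = 2 * b + 2) :
    Tendsto (fun r : ℝ => ((r ^ N : ℝ) : ℂ) * hankelLaplace b 1 r) (𝓝[>] 0)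
      (𝓝 (-((Complex.I / 2) ^ (b : ℂ) * (Real.Gamma (2 * b + 2) : ℂ)))) := by
  have h1 : Tendsto (fun r : ℝ => Complex.exp (r * Complex.I)) (𝓝[>] 0) (𝓝 1) := by
    have : Continuous fun r : ℝ => Complex.exp (r * Complex.I) := by fun_prop
    have := this.tendsto 0
    simp only [Complex.ofReal_zero, zero_mul, Complex.exp_zero] at this
    exact this.mono_left nhdsWithin_le_nhds
  have h2 := h1.mul (tendsto_integral_hankelScaled hb)
  rw [one_mul] at h2
  refine h2.congr' ?_
  filter_upwards [self_mem_nhdsWithin] with r (hr : 0 < r)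
  have e4 : Complex.exp (r * Complex.I) * Complex.exp (-(r * Complex.I)) = 1 := by
    rw [← Complex.exp_add]; simp
  rw [integral_hankelScaled hr, ← hN, Real.rpow_natCast]
  linear_combination ((r ^ N : ℝ) : ℂ) * hankelLaplace b 1 r * e4

/-- Rescaling s = t/r produces the power of r, and 1 + t/r ≤ 1 + t for r ≥ 1 makes the remaining
integral independent of r. -/
lemma integral_rpow_mul_pow_mul_exp_le {c : ℝ} (hc : -1 < c) (m : ℕ) {r : ℝ} (hr : 1 ≤ r) :
    ∫ s in Set.Ioi (0 : ℝ), s ^ c * (1 + s) ^ m * Real.exp (-(r * s))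
      ≤ (∫ s in Set.Ioi (0 : ℝ), s ^ c * (1 + s) ^ m * Real.exp (-(1 * s))) * r ^ (-(c + 1)) := by
  have hr0 : 0 < r := by linarith
  have h := integral_comp_mul_left_Ioi (fun t => t ^ c * (1 + t / r) ^ m * Real.exp (-(1 * t))) 0 hr0
  rw [mul_zero] at h
  have h2 : ∫ s in Set.Ioi (0 : ℝ), s ^ c * (1 + s) ^ m * Real.exp (-(r * s))
      = r ^ (-(c + 1)) * ∫ t in Set.Ioi (0 : ℝ), t ^ c * (1 + t / r) ^ m * Real.exp (-(1 * t)) := by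
    have h3 : ∫ s in Set.Ioi (0 : ℝ), s ^ c * (1 + s) ^ m * Real.exp (-(r * s))
        = r ^ (-c) * ∫ x in Set.Ioi (0 : ℝ), (r * x) ^ c * (1 + r * x / r) ^ m
          * Real.exp (-(1 * (r * x))) := by
      rw [← integral_const_mul]
      refine setIntegral_congr_fun measurableSet_Ioi fun s (hs : 0 < s) => ?_
      rw [Real.mul_rpow hr0.le hs.le, mul_div_cancel_left₀ _ hr0.ne', one_mul]
      have : r ^ (-c) * r ^ c = 1 := by rw [← Real.rpow_add hr0]; simp
      linear_combination (-(s ^ c * (1 + s) ^ m * Real.exp (-(r * s)))) * this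
    rw [h3, h, smul_eq_mul, ← mul_assoc, neg_add, Real.rpow_add hr0, Real.rpow_neg_one]
  rw [h2, mul_comm]
  refine mul_le_mul_of_nonneg_right ?_ (Real.rpow_nonneg hr0.le _)
  refine integral_mono_of_nonneg ?_ (integrableOn_rpow_mul_pow_mul_exp hc one_pos m) ?_
  · filter_upwards [ae_restrict_mem measurableSet_Ioi] with t (ht : 0 < t)
    have := Real.rpow_pos_of_pos ht c
    simp only [Pi.zero_apply]
    positivity
  · filter_upwards [ae_restrict_mem measurableSet_Ioi] with t (ht : 0 < t)
    have := Real.rpow_pos_of_pos ht c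
    have h5 : t / r ≤ t := div_le_self ht.le hr
    gcongr

/-- In the second estimate (i - s) - i = -s: the outgoing combination gains a factor s in the
integrand, hence a factor 1/r after integration. -/
lemma exists_norm_hankelLaplace_le {b : ℝ} (hb : -1 < b) :
    ∃ C : ℝ, ∀ r, 1 ≤ r → ‖hankelLaplace b 0 r‖ ≤ C * r ^ (-(b + 1)) ∧
      ‖hankelLaplace b 1 r - Complex.I * hankelLaplace b 0 r‖ ≤ C * r ^ (-(b + 2)) := by
  obtain ⟨m, hm⟩ := exists_nat_ge b
  set A := ∫ s in Set.Ioi (0 : ℝ), s ^ b * (1 + s) ^ m * Real.exp (-(1 * s))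
  set B := ∫ s in Set.Ioi (0 : ℝ), s ^ (b + 1) * (1 + s) ^ m * Real.exp (-(1 * s))
  refine ⟨max A B, fun r hr => ?_⟩
  have hr0 : 0 < r := by linarith
  constructor
  · refine le_trans ?_ ((integral_rpow_mul_pow_mul_exp_le hb m hr).trans
      (mul_le_mul_of_nonneg_right (le_max_left A B) (Real.rpow_nonneg hr0.le _)))
    refine norm_integral_le_of_norm_le (integrableOn_rpow_mul_pow_mul_exp hb hr0 m) ?_
    filter_upwards [ae_restrict_mem measurableSet_Ioi] with s hs
    simpa using norm_hankel_integrand_le hm 0 (le_refl r) hs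
  · have e : b + 2 = b + 1 + 1 := by ring
    rw [e]
    refine le_trans ?_ ((integral_rpow_mul_pow_mul_exp_le (by linarith : -1 < b + 1) m hr).trans
      (mul_le_mul_of_nonneg_right (le_max_right A B) (Real.rpow_nonneg hr0.le _)))
    rw [hankelLaplace, hankelLaplace, ← integral_const_mul, ← integral_sub
      (integrableOn_hankel_integrand hb 1 hr0) ((integrableOn_hankel_integrand hb 0 hr0).const_mul _)]
    refine norm_integral_le_of_norm_le
      (integrableOn_rpow_mul_pow_mul_exp (by linarith : -1 < b + 1) hr0 m) ?_
    filter_upwards [ae_restrict_mem measurableSet_Ioi] with s (hs : 0 < s)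
    have e2 : (Complex.I - s) ^ 1 * Complex.exp (r * (Complex.I - s)) * hankelWeight b s
        - Complex.I * ((Complex.I - s) ^ 0 * Complex.exp (r * (Complex.I - s)) * hankelWeight b s)
        = -(s * ((Complex.I - s) ^ 0 * Complex.exp (r * (Complex.I - s)) * hankelWeight b s)) := by
      ring
    rw [e2, norm_neg, norm_mul, Complex.norm_real, Real.norm_of_nonneg hs.le]
    have h := norm_hankel_integrand_le hm 0 (le_refl r) hs
    rw [zero_add] at h
    calc _ ≤ s * (s ^ b * (1 + s) ^ m * Real.exp (-(r * s))) := by gcongr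
      _ = _ := by rw [Real.rpow_add hs, Real.rpow_one]; ring

end LaplaceIntegral

/-! ### The Green function is an outgoing fundamental profile -/

section GreenRadial

/-- The radial profile of the free Green function. -/
noncomputable def greenRadial (d : ℕ) (r : ℝ) : ℂ :=
  -(Complex.I / 4) * (((2 * Real.pi * r) ^ (-(((d : ℝ) - 2) / 2)) : ℝ) : ℂ)
    * hankelOne (((d : ℝ) - 2) / 2) r

lemma freeGreen_eq {d : ℕ} (z : E d) : freeGreen d z = greenRadial d ‖z‖ := rfl

/-- The properties of a radial profile of an outgoing fundamental solution of `Δ + 1`. -/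
structure IsOutgoingProfile (d : ℕ) (g : ℝ → ℂ) : Prop where
  smooth : ContDiffOn ℝ ∞ g (Set.Ioi 0)
  ode : ∀ r, 0 < r → radOp d g r = 0
  flux : Tendsto (fun r : ℝ => ((r ^ (d - 1) : ℝ) : ℂ) * deriv g r) (𝓝[>] 0)
    (𝓝 (sphereConst d : ℂ))
  decay : ∃ C : ℝ, ∀ r, 1 ≤ r → ‖g r‖ ≤ C * r ^ (-(((d : ℝ) - 1) / 2)) ∧
    ‖deriv g r - Complex.I * g r‖ ≤ C * r ^ (-(((d : ℝ) + 1) / 2))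

lemma sphereConst_eq {d : ℕ} (hd : 1 ≤ d) :
    sphereConst d = Real.Gamma (d / 2) / (2 * Real.pi ^ ((d : ℝ) / 2)) := by
  have : Nonempty (Fin d) := ⟨⟨0, hd⟩⟩
  have hd0 : (0 : ℝ) < d := by exact_mod_cast hd
  have hG : 0 < Real.Gamma (d / 2) := Real.Gamma_pos_of_pos (by positivity)
  have hpi : √Real.pi ^ d = Real.pi ^ ((d : ℝ) / 2) := by
    rw [Real.sqrt_eq_rpow, ← Real.rpow_natCast, ← Real.rpow_mul Real.pi_pos.le]
    ring_nf
  rw [sphereConst, Measure.real, EuclideanSpace.volume_ball, Fintype.card_fin, ENNReal.ofReal_one,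
    one_pow, one_mul, ENNReal.toReal_ofReal (by positivity), Real.Gamma_add_one (by positivity), hpi]
  field_simp

lemma IsOutgoingProfile.congr {d : ℕ} {g f : ℝ → ℂ} (hg : IsOutgoingProfile d g)
    (h : ∀ r, 0 < r → f r = g r) : IsOutgoingProfile d f := by
  have h1 : ∀ r, 0 < r → f =ᶠ[𝓝 r] g := fun r hr => by
    filter_upwards [Ioi_mem_nhds hr] with s hs using h s hs
  obtain ⟨C, hC⟩ := hg.decay
  refine ⟨hg.smooth.congr fun r hr => h r hr, fun r hr => ?_, hg.flux.congr' ?_,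
    C, fun r hr => ?_⟩
  · rw [← hg.ode r hr, radOp, radOp, (h1 r hr).deriv_eq, (h1 r hr).deriv.deriv_eq, h r hr]
  · filter_upwards [self_mem_nhdsWithin] with r hr
    rw [(h1 r hr).deriv_eq]
  · have hr0 : 0 < r := by linarith
    rw [(h1 r hr0).deriv_eq, h r hr0]
    exact hC r hr

lemma isOutgoingProfile_exp :
    IsOutgoingProfile 1 (fun r : ℝ => -(Complex.I / 2) * Complex.exp (Complex.I * r)) := by
  have h1 : ∀ (c : ℂ) (r : ℝ), HasDerivAt (fun r : ℝ => c * Complex.exp (Complex.I * r))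
      (c * Complex.I * Complex.exp (Complex.I * r)) r := fun c r => by
    have := (((Complex.ofRealCLM.hasDerivAt (x := r)).const_mul Complex.I).cexp).const_mul c
    refine this.congr_deriv ?_
    simp; ring
  have hd1 : ∀ c : ℂ, deriv (fun r : ℝ => c * Complex.exp (Complex.I * r))
      = fun r : ℝ => c * Complex.I * Complex.exp (Complex.I * r) := fun c =>
    funext fun r => (h1 c r).deriv
  refine ⟨?_, fun r hr => ?_, ?_, 1, fun r hr => ?_⟩
  · exact (contDiff_const.mul (contDiff_const.mul Complex.ofRealCLM.contDiff).cexp).contDiffOn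
  · simp only [radOp, hd1]
    simp
    linear_combination (-(Complex.I / 2) * Complex.exp (Complex.I * r)) * Complex.I_mul_I
  · rw [hd1, sphereConst_eq le_rfl]
    have hc : Continuous fun r : ℝ => -(Complex.I / 2) * Complex.I * Complex.exp (Complex.I * r) := by
      fun_prop
    have h2 := (hc.tendsto 0).mono_left (nhdsWithin_le_nhds (s := Set.Ioi 0))
    have e : -(Complex.I / 2) * Complex.I * Complex.exp (Complex.I * (0 : ℝ))
        = ((Real.Gamma ((1 : ℕ) / 2) / (2 * Real.pi ^ (((1 : ℕ) : ℝ) / 2)) : ℝ) : ℂ) := by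
      rw [Nat.cast_one, Real.Gamma_one_half_eq, Real.sqrt_eq_rpow]
      have : Real.pi ^ ((1 : ℝ) / 2) ≠ 0 := (Real.rpow_pos_of_pos Real.pi_pos _).ne'
      rw [show Real.pi ^ ((1 : ℝ) / 2) / (2 * Real.pi ^ ((1 : ℝ) / 2)) = 1 / 2 by field_simp]
      simp
      linear_combination (-(1 : ℂ) / 2) * Complex.I_mul_I
    rw [← e]
    simpa using h2
  · have hn : ‖Complex.exp (Complex.I * r)‖ = 1 := by rw [Complex.norm_exp]; simp
    rw [hd1]
    constructor
    · rw [norm_mul, hn]; simp; norm_num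
    · have e : -(Complex.I / 2) * Complex.I * Complex.exp (Complex.I * r)
          - Complex.I * (-(Complex.I / 2) * Complex.exp (Complex.I * r)) = 0 := by ring
      simp only [e, norm_zero]
      positivity

lemma I_div_two_cpow (b : ℝ) : (Complex.I / 2) ^ (b : ℂ)
    = (((1 / 2 : ℝ) ^ b : ℝ) : ℂ) * Complex.exp (Complex.I * ((b * Real.pi / 2 : ℝ) : ℂ)) := by
  have h : Complex.I / 2 = ((1 / 2 : ℝ) : ℂ) * Complex.I := by push_cast; ring
  rw [h, ofReal_mul_cpow (by norm_num) Complex.I_ne_zero, Complex.ofReal_cpow (by norm_num),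
    Complex.cpow_def_of_ne_zero Complex.I_ne_zero, Complex.log_I]
  congr 2
  push_cast; ring

/-- The constant relating the Laplace-type integral to the Green function. -/
noncomputable def greenConst (ν : ℝ) : ℂ :=
  -(Complex.I / 4) * (((2 * Real.pi) ^ (-ν) * √(2 / Real.pi) / Real.Gamma (ν + 1 / 2) : ℝ) : ℂ)
    * Complex.exp (-(Complex.I * ((ν * Real.pi / 2 + Real.pi / 4 : ℝ) : ℂ)))

/-- The phases combine to -i and Legendre's duplication formula removes Γ(ν + 1/2). For ν + 1 = d/2
the result is the reciprocal sphere area, so the normalisation of the Green function gives unit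
mass. -/
lemma greenConst_mul {ν : ℝ} (hν : 0 ≤ ν) :
    greenConst ν * -((Complex.I / 2) ^ ((ν - 1 / 2 : ℝ) : ℂ)
        * (Real.Gamma (2 * (ν - 1 / 2) + 2) : ℂ))
      = ((Real.Gamma (ν + 1) / (2 * Real.pi ^ (ν + 1)) : ℝ) : ℂ) := by
  have hdup := Real.Gamma_mul_Gamma_add_half (ν + 1 / 2)
  rw [show ν + 1 / 2 + 1 / 2 = ν + 1 by ring, show 2 * (ν + 1 / 2) = 2 * ν + 1 by ring,
    show 1 - (2 * ν + 1) = -(2 * ν) by ring] at hdup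
  have hexp : Complex.exp (-(Complex.I * ((ν * Real.pi / 2 + Real.pi / 4 : ℝ) : ℂ)))
      * Complex.exp (Complex.I * (((ν - 1 / 2) * Real.pi / 2 : ℝ) : ℂ)) = -Complex.I := by
    rw [← Complex.exp_add, ← Complex.exp_neg_pi_div_two_mul_I]
    congr 1; push_cast; ring
  have hG : Real.Gamma (ν + 1 / 2) ≠ 0 := (Real.Gamma_pos_of_pos (by linarith)).ne'
  have hreal : (2 * Real.pi) ^ (-ν) * √(2 / Real.pi) / Real.Gamma (ν + 1 / 2)
      * ((1 / 2 : ℝ) ^ (ν - 1 / 2) * Real.Gamma (2 * ν + 1)) / 4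
      = Real.Gamma (ν + 1) / (2 * Real.pi ^ (ν + 1)) := by
    have hG1 : Real.Gamma (ν + 1) = Real.Gamma (2 * ν + 1) * 2 ^ (-(2 * ν)) * √Real.pi
        / Real.Gamma (ν + 1 / 2) := by
      rw [← hdup]; field_simp
    have h2 : (2 : ℝ) ^ (-(2 * ν)) = ((2 : ℝ) ^ ν)⁻¹ * ((2 : ℝ) ^ ν)⁻¹ := by
      rw [show -(2 * ν) = -ν + -ν by ring, Real.rpow_add two_pos, Real.rpow_neg two_pos.le]
    have h3 : (1 / 2 : ℝ) ^ (ν - 1 / 2) = ((2 : ℝ) ^ ν)⁻¹ * √2 := by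
      rw [show (1 / 2 : ℝ) ^ (ν - 1 / 2) = ((2 : ℝ)⁻¹) ^ (ν - 1 / 2) by norm_num,
        Real.inv_rpow two_pos.le, ← Real.rpow_neg two_pos.le,
        show -(ν - 1 / 2) = -ν + 1 / 2 by ring, Real.rpow_add two_pos, Real.rpow_neg two_pos.le,
        Real.sqrt_eq_rpow]
    have h4 : (2 * Real.pi) ^ (-ν) = ((2 : ℝ) ^ ν)⁻¹ * (Real.pi ^ ν)⁻¹ := by
      rw [Real.rpow_neg (by positivity), Real.mul_rpow two_pos.le Real.pi_pos.le, mul_inv]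
    have h5 : Real.pi ^ (ν + 1) = Real.pi ^ ν * Real.pi := by
      rw [Real.rpow_add Real.pi_pos, Real.rpow_one]
    have hp : Real.pi ^ ν ≠ 0 := (Real.rpow_pos_of_pos Real.pi_pos _).ne'
    have h2p : (2 : ℝ) ^ ν ≠ 0 := (Real.rpow_pos_of_pos two_pos _).ne'
    have hs2 : √2 * √2 = 2 := Real.mul_self_sqrt two_pos.le
    have hsp : √Real.pi * √Real.pi = Real.pi := Real.mul_self_sqrt Real.pi_pos.le
    have hsp0 : √Real.pi ≠ 0 := (Real.sqrt_pos.2 Real.pi_pos).ne'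
    rw [hG1, h2, h3, h4, h5, Real.sqrt_div two_pos.le]
    have hpi0 := Real.pi_pos.ne'
    field_simp
    rw [show √2 ^ 2 = 2 from Real.sq_sqrt two_pos.le, show √Real.pi ^ 2 = Real.pi from
      Real.sq_sqrt Real.pi_pos.le]
    ring
  rw [← hreal, greenConst, I_div_two_cpow, show 2 * (ν - 1 / 2) + 2 = 2 * ν + 1 by ring]
  generalize Complex.exp (-(Complex.I * ((ν * Real.pi / 2 + Real.pi / 4 : ℝ) : ℂ))) = X at hexp ⊢
  generalize Complex.exp (Complex.I * (((ν - 1 / 2) * Real.pi / 2 : ℝ) : ℂ)) = Y at hexp ⊢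
  generalize (2 * Real.pi) ^ (-ν) * √(2 / Real.pi) / Real.Gamma (ν + 1 / 2) = A
  push_cast
  generalize ((((1 / 2 : ℝ) ^ (ν - 1 / 2) : ℝ) : ℂ)) = B
  generalize (Real.Gamma (2 * ν + 1) : ℂ) = Z
  linear_combination (Complex.I / 4 * A * B * Z) * hexp - (A * B * Z / 4) * Complex.I_mul_I

/-- After the substitution t = rs the powers of r cancel: -ν from the prefactor, -1/2 from the
square root, ν + 1/2 from the integral. -/
lemma greenRadial_eq {d : ℕ} (hd : 2 ≤ d) {r : ℝ} (hr : 0 < r) :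
    greenRadial d r = greenConst (((d : ℝ) - 2) / 2)
      * hankelLaplace (((d : ℝ) - 2) / 2 - 1 / 2) 0 r := by
  have hd2 : (2 : ℝ) ≤ d := by exact_mod_cast hd
  set ν : ℝ := ((d : ℝ) - 2) / 2 with hν
  have hν0 : 0 ≤ ν := by rw [hν]; linarith
  have hr' : (r : ℂ) ≠ 0 := by exact_mod_cast hr.ne'
  set h : ℝ → ℂ := fun t => ((Real.exp (-t) * t ^ (ν - 1 / 2) : ℝ) : ℂ)
          * (1 + Complex.I * ((t / (2 * r) : ℝ) : ℂ)) ^ ((ν - 1 / 2 : ℝ) : ℂ) with hh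
  have hi := integral_comp_mul_left_Ioi h 0 hr
  rw [mul_zero] at hi
  have h2 : ∫ t in Set.Ioi (0 : ℝ), h t = r * ∫ s in Set.Ioi (0 : ℝ), h (r * s) := by
    rw [hi, Complex.real_smul, Complex.ofReal_inv, mul_inv_cancel_left₀ hr']
  have h3 : ∫ t in Set.Ioi (0 : ℝ), h t
      = ((r ^ (ν + 1 / 2) : ℝ) : ℂ) * Complex.exp (-(r * Complex.I))
        * hankelLaplace (ν - 1 / 2) 0 r := by
    rw [h2, hankelLaplace, ← integral_const_mul, ← integral_const_mul]
    refine setIntegral_congr_fun measurableSet_Ioi fun s (hs : 0 < s) => ?_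
    have e1 : (r * s / (2 * r)) = s / 2 := by field_simp
    have e2 : r ^ (ν + 1 / 2) = r ^ (ν - 1 / 2) * r := by
      rw [show ν + 1 / 2 = ν - 1 / 2 + 1 by ring, Real.rpow_add hr, Real.rpow_one]
    have e3 : Complex.exp (-(r * Complex.I)) * Complex.exp (r * (Complex.I - s))
        = ((Real.exp (-(r * s)) : ℝ) : ℂ) := by
      rw [Complex.ofReal_exp, ← Complex.exp_add]; congr 1; push_cast; ring
    simp only [hh, hankelWeight]
    rw [e1, e2, Real.mul_rpow hr.le hs.le, Complex.ofReal_mul, ← e3]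
    push_cast
    ring
  have e5 : Complex.exp (Complex.I * ((r - ν * Real.pi / 2 - Real.pi / 4 : ℝ) : ℂ))
      * Complex.exp (-(r * Complex.I))
      = Complex.exp (-(Complex.I * ((ν * Real.pi / 2 + Real.pi / 4 : ℝ) : ℂ))) := by
    rw [← Complex.exp_add]; congr 1; push_cast; ring
  have e6 : (2 * Real.pi * r) ^ (-ν) * √(2 / (Real.pi * r)) * r ^ (ν + 1 / 2)
      = (2 * Real.pi) ^ (-ν) * √(2 / Real.pi) := by
    have hs : √r ≠ 0 := (Real.sqrt_pos.2 hr).ne'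
    have hp : r ^ ν ≠ 0 := (Real.rpow_pos_of_pos hr _).ne'
    rw [Real.mul_rpow (by positivity) hr.le, Real.rpow_add hr, ← div_div, Real.sqrt_div (by positivity),
      Real.rpow_neg hr.le, ← Real.sqrt_eq_rpow]
    field_simp
  rw [greenRadial, hankelOne, ← hν, if_pos hν0, hankelNonneg, h3, greenConst, ← e5, ← e6]
  push_cast
  ring

/-- In dimension one the order is -1/2; reflection makes it 1/2, the integral reduces to that of
e^(-t), and the profile is -(i/2) e^(ir). For d ≥ 2 the Laplace-type integral applies with b = (d -
3)/2, that is 2(b + 1) = d - 1. -/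
theorem isOutgoingProfile_greenRadial {d : ℕ} (hd : 1 ≤ d) :
    IsOutgoingProfile d (greenRadial d) := by
  rcases hd.eq_or_lt with rfl | hd2
  · refine isOutgoingProfile_exp.congr fun r hr => ?_
    have h1 : ((((1 : ℕ) : ℝ) - 2) / 2) = -(1 / 2) := by norm_num
    have h2 : ∫ t in Set.Ioi (0 : ℝ), ((Real.exp (-t) : ℝ) : ℂ) = 1 := by
      rw [integral_complex_ofReal, integral_exp_neg_Ioi_zero, Complex.ofReal_one]
    have e6 : √(2 * Real.pi * r) * √(2 / (Real.pi * r)) = 2 := by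
      rw [← Real.sqrt_mul (by positivity), show 2 * Real.pi * r * (2 / (Real.pi * r)) = 2 ^ 2 by
        field_simp, Real.sqrt_sq two_pos.le]
    have e5 : Complex.exp (-Complex.I * ((-(1 / 2) * Real.pi : ℝ) : ℂ))
        * Complex.exp (Complex.I * ((r - 1 / 2 * Real.pi / 2 - Real.pi / 4 : ℝ) : ℂ))
        = Complex.exp (Complex.I * r) := by
      rw [← Complex.exp_add]; congr 1; push_cast; ring
    rw [greenRadial, h1, hankelOne, if_neg (by norm_num), neg_neg, hankelNonneg]
    norm_num only [sub_self, Real.rpow_zero]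
    simp only [Complex.ofReal_zero, Complex.cpow_zero, mul_one, h2, Real.Gamma_one,
      Complex.ofReal_one, div_one]
    rw [← e5, ← Real.sqrt_eq_rpow]
    have e7 : ((√(2 * Real.pi * r) : ℝ) : ℂ) * ((√(2 / (Real.pi * r)) : ℝ) : ℂ) = 2 := by
      exact_mod_cast e6
    linear_combination (-(Complex.I / 4)
        * Complex.exp (-Complex.I * ((-(1 / 2) * Real.pi : ℝ) : ℂ))
        * Complex.exp (Complex.I * ((r - 1 / 2 * Real.pi / 2 - Real.pi / 4 : ℝ) : ℂ))) * e7
  · have hd' : (2 : ℝ) ≤ d := by exact_mod_cast hd2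
    set ν : ℝ := ((d : ℝ) - 2) / 2 with hν
    set b : ℝ := ν - 1 / 2 with hbdef
    have hν0 : 0 ≤ ν := by rw [hν]; linarith
    have hb : -1 < b := by rw [hbdef]; linarith
    have hdb : (d : ℝ) - 1 = 2 * (b + 1) := by rw [hbdef, hν]; ring
    suffices h : IsOutgoingProfile d (fun r => greenConst ν * hankelLaplace b 0 r) from
      h.congr fun r hr => greenRadial_eq hd2 hr
    have hD : ∀ k r, 0 < r → deriv (fun r => greenConst ν * hankelLaplace b k r) r
        = greenConst ν * hankelLaplace b (k + 1) r := fun k r hr =>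
      ((hasDerivAt_hankelLaplace hb k hr).const_mul _).deriv
    refine ⟨contDiffOn_const.mul (contDiffOn_hankelLaplace hb 0), fun r hr => ?_, ?_, ?_⟩
    · have h2 : deriv (fun r => greenConst ν * hankelLaplace b 0 r) =ᶠ[𝓝 r]
          fun r => greenConst ν * hankelLaplace b 1 r := by
        filter_upwards [Ioi_mem_nhds hr] with s hs using hD 0 s hs
      have hr' : (r : ℂ) ≠ 0 := by exact_mod_cast hr.ne'
      rw [radOp, h2.deriv_eq, hD 1 r hr, hD 0 r hr, hdb]
      have := hankelLaplace_ode hb hr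
      push_cast
      field_simp
      linear_combination greenConst ν * this
    · have hN : ((d - 1 : ℕ) : ℝ) = 2 * b + 2 := by
        rw [Nat.cast_sub hd, Nat.cast_one]; linarith
      have h2 := (tendsto_pow_mul_hankelLaplace hb hN).const_mul (greenConst ν)
      rw [greenConst_mul hν0] at h2
      rw [sphereConst_eq hd, show (d : ℝ) / 2 = ν + 1 by rw [hν]; ring]
      refine h2.congr' ?_
      filter_upwards [self_mem_nhdsWithin] with r hr
      rw [hD 0 r hr]; ring
    · obtain ⟨C, hC⟩ := exists_norm_hankelLaplace_le hb
      refine ⟨‖greenConst ν‖ * C, fun r hr => ?_⟩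
      have hr0 : 0 < r := by linarith
      rw [hD 0 r hr0, show ((d : ℝ) - 1) / 2 = b + 1 by linarith,
        show ((d : ℝ) + 1) / 2 = b + 2 by linarith, norm_mul]
      constructor
      · rw [mul_assoc]
        exact mul_le_mul_of_nonneg_left (hC r hr).1 (norm_nonneg _)
      · rw [show greenConst ν * hankelLaplace b (0 + 1) r
            - Complex.I * (greenConst ν * hankelLaplace b 0 r)
            = greenConst ν * (hankelLaplace b 1 r - Complex.I * hankelLaplace b 0 r) by ring,
          norm_mul, mul_assoc]
        exact mul_le_mul_of_nonneg_left (hC r hr).2 (norm_nonneg _)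

end GreenRadial

/-! ### Convolution and Young's inequality on L² -/

section Young

variable {d : ℕ}

/-- The convolution `∫ k (x - y) h y dy`. -/
noncomputable def cv (k h : E d → ℂ) (x : E d) : ℂ := ∫ y, k (x - y) * h y

lemma cv_eq_convolution (k h : E d → ℂ) :
    cv k h = MeasureTheory.convolution k h (ContinuousLinearMap.mul ℝ ℂ) volume := by
  ext x
  rw [convolution_eq_swap]; rfl

lemma cv_comm (k h : E d → ℂ) : cv k h = cv h k := by
  rw [cv_eq_convolution]
  ext x
  rw [convolution_def]
  simp [cv, mul_comm]

lemma cv_congr_ae {k h h' : E d → ℂ} (hh : h =ᵐ[volume] h') : cv k h = cv k h' := by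
  ext x
  refine integral_congr_ae ?_
  filter_upwards [hh] with y hy
  rw [hy]

lemma aestronglyMeasurable_cv_integrand {k h : E d → ℂ} (hk : AEStronglyMeasurable k)
    (hh : AEStronglyMeasurable h) :
    AEStronglyMeasurable (fun p : E d × E d => k (p.1 - p.2) * h p.2)
      ((volume : Measure (E d)).prod volume) := by
  simpa [mul_comm] using hh.convolution_integrand (ContinuousLinearMap.mul ℝ ℂ) hk

lemma aestronglyMeasurable_cv {k h : E d → ℂ} (hk : AEStronglyMeasurable k)
    (hh : AEStronglyMeasurable h) : AEStronglyMeasurable (cv k h) :=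
  (aestronglyMeasurable_cv_integrand hk hh).integral_prod_right'

/-- Cauchy–Schwarz with |k| split into two square roots, then Tonelli. Keeping the absolute values
inside gives both the L² bound and absolute convergence almost everywhere. -/
lemma lintegral_sq_lintegral_le {k h : E d → ℂ} (hk : AEStronglyMeasurable k)
    (hh : AEStronglyMeasurable h) :
    ∫⁻ x, (∫⁻ y, ‖k (x - y)‖ₑ * ‖h y‖ₑ) ^ (2 : ℝ)
      ≤ (∫⁻ y, ‖k y‖ₑ) ^ (2 : ℝ) * ∫⁻ y, ‖h y‖ₑ ^ (2 : ℝ) := by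
  set A := ∫⁻ y, ‖k y‖ₑ
  have hhalf : ∀ a : ENNReal, (a ^ (1 / 2 : ℝ)) ^ (2 : ℝ) = a := fun a => by
    rw [← ENNReal.rpow_mul]; norm_num
  have hkx : ∀ x : E d, AEMeasurable (fun y => ‖k (x - y)‖ₑ) := fun x =>
    (hk.comp_quasiMeasurePreserving (quasiMeasurePreserving_sub_left volume x)).enorm
  have hAx : ∀ x : E d, ∫⁻ y, ‖k (x - y)‖ₑ = A := fun x =>
    lintegral_sub_left_eq_self (fun y => ‖k y‖ₑ) x
  have hpt : ∀ x : E d, (∫⁻ y, ‖k (x - y)‖ₑ * ‖h y‖ₑ) ^ (2 : ℝ)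
      ≤ A * ∫⁻ y, ‖k (x - y)‖ₑ * ‖h y‖ₑ ^ (2 : ℝ) := fun x => by
    have h1 := ENNReal.lintegral_mul_le_Lp_mul_Lq volume Real.HolderConjugate.two_two
      (f := fun y => ‖k (x - y)‖ₑ ^ (1 / 2 : ℝ)) (g := fun y => ‖k (x - y)‖ₑ ^ (1 / 2 : ℝ) * ‖h y‖ₑ)
      ((hkx x).pow_const _) (((hkx x).pow_const _).mul hh.enorm)
    have h2 : ∀ y, ((fun y => ‖k (x - y)‖ₑ ^ (1 / 2 : ℝ)) *
        (fun y => ‖k (x - y)‖ₑ ^ (1 / 2 : ℝ) * ‖h y‖ₑ)) y = ‖k (x - y)‖ₑ * ‖h y‖ₑ := fun y => by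
      simp only [Pi.mul_apply]
      rw [← mul_assoc, ← sq, ← ENNReal.rpow_two, hhalf]
    have h3 : ∀ y, (‖k (x - y)‖ₑ ^ (1 / 2 : ℝ) * ‖h y‖ₑ) ^ (2 : ℝ)
        = ‖k (x - y)‖ₑ * ‖h y‖ₑ ^ (2 : ℝ) := fun y => by
      rw [ENNReal.mul_rpow_of_nonneg _ _ two_pos.le, hhalf]
    simp only [h2, h3, hhalf, hAx] at h1
    calc _ ≤ (A ^ (1 / 2 : ℝ) * (∫⁻ y, ‖k (x - y)‖ₑ * ‖h y‖ₑ ^ (2 : ℝ)) ^ (1 / 2 : ℝ)) ^ (2 : ℝ) :=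
          ENNReal.rpow_le_rpow h1 two_pos.le
      _ = _ := by rw [ENNReal.mul_rpow_of_nonneg _ _ two_pos.le, hhalf, hhalf]
  have hmeas : AEMeasurable (fun p : E d × E d => ‖k (p.1 - p.2)‖ₑ * ‖h p.2‖ₑ ^ (2 : ℝ))
      ((volume : Measure (E d)).prod volume) := by
    refine AEMeasurable.mul ?_ ?_
    · exact (hk.comp_quasiMeasurePreserving
        (quasiMeasurePreserving_sub_of_right_invariant volume volume)).enorm
    · exact (hh.comp_quasiMeasurePreserving Measure.quasiMeasurePreserving_snd).enorm.pow_const _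
  have hmeas2 : AEMeasurable (fun x : E d => ∫⁻ y, ‖k (x - y)‖ₑ * ‖h y‖ₑ ^ (2 : ℝ)) :=
    hmeas.lintegral_prod_right'
  calc ∫⁻ x, (∫⁻ y, ‖k (x - y)‖ₑ * ‖h y‖ₑ) ^ (2 : ℝ)
      ≤ ∫⁻ x, A * ∫⁻ y, ‖k (x - y)‖ₑ * ‖h y‖ₑ ^ (2 : ℝ) := lintegral_mono hpt
    _ = A * ∫⁻ x, ∫⁻ y, ‖k (x - y)‖ₑ * ‖h y‖ₑ ^ (2 : ℝ) := lintegral_const_mul'' _ hmeas2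
    _ = A * ∫⁻ y, ∫⁻ x, ‖k (x - y)‖ₑ * ‖h y‖ₑ ^ (2 : ℝ) := by
        rw [lintegral_lintegral_swap hmeas]
    _ = A * ∫⁻ y, A * ‖h y‖ₑ ^ (2 : ℝ) := by
        congr 1
        refine lintegral_congr fun y => ?_
        have hky : AEMeasurable (fun x => ‖k (x - y)‖ₑ) :=
          (hk.comp_quasiMeasurePreserving
            (measurePreserving_sub_right volume y).quasiMeasurePreserving).enorm
        rw [lintegral_mul_const'' _ hky, lintegral_sub_right_eq_self (fun x => ‖k x‖ₑ)]
    _ = _ := by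
        rw [lintegral_const_mul'' _ (hh.enorm.pow_const _), ← mul_assoc, ENNReal.rpow_two, sq]

lemma eLpNorm_two_sq (h : E d → ℂ) : eLpNorm h 2 volume ^ (2 : ℝ) = ∫⁻ y, ‖h y‖ₑ ^ (2 : ℝ) := by
  rw [eLpNorm_eq_lintegral_rpow_enorm_toReal two_ne_zero ENNReal.ofNat_ne_top]
  rw [← ENNReal.rpow_mul]; norm_num

lemma eLpNorm_cv_le {k h : E d → ℂ} (hk : AEStronglyMeasurable k) (hh : AEStronglyMeasurable h) :
    eLpNorm (cv k h) 2 volume ≤ eLpNorm k 1 volume * eLpNorm h 2 volume := by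
  rw [← ENNReal.rpow_le_rpow_iff (two_pos (α := ℝ)), ENNReal.mul_rpow_of_nonneg _ _ two_pos.le,
    eLpNorm_two_sq, eLpNorm_two_sq, eLpNorm_one_eq_lintegral_enorm]
  refine le_trans (lintegral_mono fun x => ?_) (lintegral_sq_lintegral_le hk hh)
  refine ENNReal.rpow_le_rpow ?_ two_pos.le
  refine (enorm_integral_le_lintegral_enorm _).trans (le_of_eq ?_)
  simp only [enorm_mul]

lemma memLp_cv {k h : E d → ℂ} (hk : Integrable k) (hh : MemLp h 2) : MemLp (cv k h) 2 := by
  refine ⟨aestronglyMeasurable_cv hk.1 hh.1, (eLpNorm_cv_le hk.1 hh.1).trans_lt ?_⟩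
  exact ENNReal.mul_lt_top (memLp_one_iff_integrable.2 hk).eLpNorm_lt_top hh.eLpNorm_lt_top

lemma ae_integrable_cv_integrand {k h : E d → ℂ} (hk : Integrable k) (hh : MemLp h 2) :
    ∀ᵐ x, Integrable (fun y => k (x - y) * h y) := by
  have h1 := lintegral_sq_lintegral_le hk.1 hh.1
  have h2 : (∫⁻ y, ‖k y‖ₑ) ^ (2 : ℝ) * ∫⁻ y, ‖h y‖ₑ ^ (2 : ℝ) < ⊤ := by
    refine ENNReal.mul_lt_top (ENNReal.rpow_lt_top_of_nonneg two_pos.le hk.2.ne) ?_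
    rw [← eLpNorm_two_sq]
    exact ENNReal.rpow_lt_top_of_nonneg two_pos.le hh.eLpNorm_lt_top.ne
  have hm := (aestronglyMeasurable_cv_integrand hk.1 hh.1)
  have hm2 : AEMeasurable (fun x : E d => (∫⁻ y, ‖k (x - y)‖ₑ * ‖h y‖ₑ) ^ (2 : ℝ)) := by
    refine AEMeasurable.pow_const ?_ _
    have := hm.enorm.lintegral_prod_right'
    simpa only [enorm_mul] using this
  filter_upwards [ae_lt_top' hm2 (h1.trans_lt h2).ne, hm.prodMk_left] with x hx hmx
  refine ⟨hmx, ?_⟩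
  rw [HasFiniteIntegral]
  simp only [enorm_mul]
  exact (ENNReal.rpow_lt_top_iff_of_pos two_pos).1 hx

lemma ae_cv_add {k h h' : E d → ℂ} (hk : Integrable k) (hh : MemLp h 2) (hh' : MemLp h' 2) :
    ∀ᵐ x, cv k (fun y => h y + h' y) x = cv k h x + cv k h' x := by
  filter_upwards [ae_integrable_cv_integrand hk hh, ae_integrable_cv_integrand hk hh'] with x h1 h2
  simp only [cv, mul_add]
  exact integral_add h1 h2

lemma cv_const_mul (k h : E d → ℂ) (c : ℂ) (x : E d) :
    cv k (fun y => c * h y) x = c * cv k h x := by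
  simp only [cv]
  rw [← integral_const_mul]
  congr 1; ext y; ring

lemma ae_cv_sub_left {k k' h : E d → ℂ} (hk : Integrable k) (hk' : Integrable k')
    (hh : MemLp h 2) : ∀ᵐ x, cv (fun y => k y - k' y) h x = cv k h x - cv k' h x := by
  filter_upwards [ae_integrable_cv_integrand hk hh, ae_integrable_cv_integrand hk' hh] with x h1 h2
  simp only [cv, sub_mul]
  exact integral_sub h1 h2

/-- Convolution with an integrable kernel as a bounded operator on `L²(ℝᵈ)`. -/
noncomputable def youngCLM (k : E d → ℂ) (hk : Integrable k) :
    Lp ℂ 2 (volume : Measure (E d)) →L[ℂ] Lp ℂ 2 (volume : Measure (E d)) :=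
  LinearMap.mkContinuous
    { toFun := fun f => (memLp_cv hk (Lp.memLp f)).toLp
      map_add' := fun f g => by
        refine Lp.ext ?_
        have h1 : cv k (f + g : Lp ℂ 2 _) = cv k (fun y => f y + g y) :=
          cv_congr_ae (Lp.coeFn_add f g)
        filter_upwards [MemLp.coeFn_toLp (memLp_cv hk (Lp.memLp (f + g))),
          MemLp.coeFn_toLp (memLp_cv hk (Lp.memLp f)), MemLp.coeFn_toLp (memLp_cv hk (Lp.memLp g)),
          Lp.coeFn_add (memLp_cv hk (Lp.memLp f)).toLp (memLp_cv hk (Lp.memLp g)).toLp,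
          ae_cv_add hk (Lp.memLp f) (Lp.memLp g)] with x e1 e2 e3 e4 e5
        rw [e1, e4, Pi.add_apply, e2, e3, h1, e5]
      map_smul' := fun c f => by
        refine Lp.ext ?_
        have h1 : cv k (c • f : Lp ℂ 2 _) = cv k (fun y => c * f y) :=
          cv_congr_ae (Lp.coeFn_smul c f)
        filter_upwards [MemLp.coeFn_toLp (memLp_cv hk (Lp.memLp (c • f))),
          MemLp.coeFn_toLp (memLp_cv hk (Lp.memLp f)),
          Lp.coeFn_smul c (memLp_cv hk (Lp.memLp f)).toLp] with x e1 e2 e4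
        rw [e1, RingHom.id_apply, e4, Pi.smul_apply, e2, h1, cv_const_mul, smul_eq_mul] }
    (∫ y, ‖k y‖) (fun f => by
      have h1 := eLpNorm_cv_le hk.1 (Lp.memLp f).1
      have h2 : eLpNorm k 1 volume = ENNReal.ofReal (∫ y, ‖k y‖) := by
        rw [eLpNorm_one_eq_lintegral_enorm, ofReal_integral_norm_eq_lintegral_enorm hk]
      simp only [LinearMap.coe_mk, AddHom.coe_mk, Lp.norm_toLp]
      rw [Lp.norm_def]
      calc _ ≤ (eLpNorm k 1 volume * eLpNorm f 2 volume).toReal :=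
            ENNReal.toReal_mono (ENNReal.mul_ne_top (by simp [h2]) (Lp.eLpNorm_ne_top f)) h1
        _ = _ := by
            rw [ENNReal.toReal_mul, h2, ENNReal.toReal_ofReal (integral_nonneg fun _ => norm_nonneg _)])

lemma youngCLM_coeFn {k : E d → ℂ} (hk : Integrable k) (f : Lp ℂ 2 (volume : Measure (E d))) :
    youngCLM k hk f =ᵐ[volume] cv k f :=
  MemLp.coeFn_toLp (memLp_cv hk (Lp.memLp f))

lemma norm_youngCLM_le {k : E d → ℂ} (hk : Integrable k) : ‖youngCLM k hk‖ ≤ ∫ y, ‖k y‖ :=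
  LinearMap.mkContinuous_norm_le _ (integral_nonneg fun _ => norm_nonneg _) _

lemma youngCLM_sub {k k' : E d → ℂ} (hk : Integrable k) (hk' : Integrable k')
    (hs : Integrable fun y => k y - k' y) :
    youngCLM k hk - youngCLM k' hk' = youngCLM (fun y => k y - k' y) hs := by
  ext1 f
  refine Lp.ext ?_
  rw [sub_apply]
  filter_upwards [youngCLM_coeFn hk f, youngCLM_coeFn hk' f, youngCLM_coeFn hs f,
    Lp.coeFn_sub (youngCLM k hk f) (youngCLM k' hk' f), ae_cv_sub_left hk hk' (Lp.memLp f)]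
    with x e1 e2 e3 e4 e5
  rw [e3, e4, Pi.sub_apply, e1, e2, ← e5]

end Young

/-! ### Compactness and construction of the source operator -/

section SourceOperator

variable {d : ℕ}

lemma eLpNorm_one_le_of_support {h : E d → ℂ} {D : Set (E d)} (hD : MeasurableSet D)
    (hh : MemLp h 2) (hs : ∀ᵐ y, y ∉ D → h y = 0) :
    eLpNorm h 1 volume ≤ eLpNorm h 2 volume * volume D ^ (1 / 2 : ℝ) := by
  have h1 : h =ᵐ[volume] D.indicator h := by
    filter_upwards [hs] with y hy
    by_cases hyD : y ∈ D
    · simp [hyD]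
    · simp [hyD, hy hyD]
  rw [eLpNorm_congr_ae h1, eLpNorm_indicator_eq_eLpNorm_restrict hD]
  refine (eLpNorm_le_eLpNorm_mul_rpow_measure_univ (p := 1) (q := 2) (by norm_num)
    hh.1.restrict).trans ?_
  have he : (1 / (1 : ENNReal).toReal - 1 / (2 : ENNReal).toReal) = (1 / 2 : ℝ) := by
    rw [ENNReal.toReal_one, ENNReal.toReal_ofNat]; norm_num
  rw [Measure.restrict_apply_univ, he]
  exact mul_le_mul_left (eLpNorm_mono_measure h Measure.restrict_le_self) _

lemma integrable_of_memLp_two_of_support {h : E d → ℂ} {D : Set (E d)} (hD : MeasurableSet D)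
    (hDb : Bornology.IsBounded D) (hh : MemLp h 2) (hs : ∀ᵐ y, y ∉ D → h y = 0) :
    Integrable h := by
  refine memLp_one_iff_integrable.1 ⟨hh.1, (eLpNorm_one_le_of_support hD hh hs).trans_lt ?_⟩
  exact ENNReal.mul_lt_top hh.eLpNorm_lt_top
    (ENNReal.rpow_lt_top_of_nonneg (by norm_num) hDb.measure_lt_top.ne)

lemma integral_norm_le_of_support {D : Set (E d)} (hD : MeasurableSet D)
    (hDb : Bornology.IsBounded D) (f : Lp ℂ 2 (volume : Measure (E d)))
    (hs : ∀ᵐ y, y ∉ D → f y = 0) :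
    ∫ y, ‖f y‖ ≤ (volume D ^ (1 / 2 : ℝ)).toReal * ‖f‖ := by
  have hi := integrable_of_memLp_two_of_support hD hDb (Lp.memLp f) hs
  have h1 := eLpNorm_one_le_of_support hD (Lp.memLp f) hs
  have hfin : volume D ^ (1 / 2 : ℝ) ≠ ⊤ :=
    ENNReal.rpow_ne_top_of_nonneg (by norm_num) hDb.measure_lt_top.ne
  rw [integral_norm_eq_lintegral_enorm hi.1, ← eLpNorm_one_eq_lintegral_enorm, Lp.norm_def,
    ← ENNReal.toReal_mul, mul_comm]
  exact ENNReal.toReal_mono (ENNReal.mul_ne_top (Lp.eLpNorm_ne_top f) hfin) h1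

/-- Replacing x by π x leaves only finitely many evaluation points c. Each contributes the bounded
functional f ↦ ∫ k(c - y) (A f)(y) dy times the indicator of a fibre of π, so the operator has
finite rank. -/
lemma exists_compact_of_simpleFunc {X : Type*} [NormedAddCommGroup X] [NormedSpace ℂ X]
    {D : Set (E d)} [IsFiniteMeasure (volume.restrict D)]
    (A : X →L[ℂ] Lp ℂ 2 (volume : Measure (E d))) {k : E d → ℂ} (hkc : Continuous k)
    (hks : HasCompactSupport k) (π : SimpleFunc (E d) (E d)) :
    ∃ S : X →L[ℂ] Lp ℂ 2 (volume.restrict D), IsCompactOperator S ∧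
      ∀ f, S f =ᵐ[volume.restrict D] fun x => ∫ y, k (π x - y) * A f y := by
  have hg : ∀ c : E d, MemLp (fun y => (starRingEnd ℂ) (k (c - y))) 2 (volume : Measure (E d)) :=
    fun c => by
      refine Continuous.memLp_of_hasCompactSupport ?_ ?_
      · exact Complex.continuous_conj.comp (hkc.comp (continuous_const.sub continuous_id))
      · exact (hks.comp_homeomorph (Homeomorph.subLeft c)).comp_left (map_zero _)
  obtain ⟨φ, hφ⟩ : ∃ φ : E d → X →L[ℂ] ℂ, ∀ c, φ c = (innerSL ℂ (hg c).toLp).comp A :=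
    ⟨_, fun _ => rfl⟩
  have hφ_apply : ∀ c f, φ c f = ∫ y, k (c - y) * A f y := fun c f => by
    rw [hφ]; simp only [ContinuousLinearMap.comp_apply, innerSL_apply_apply, L2.inner_def]
    refine integral_congr_ae ?_
    filter_upwards [(hg c).coeFn_toLp] with y hy
    rw [hy]
    simp [mul_comm]
  obtain ⟨b, hb⟩ : ∃ b : E d → Lp ℂ 2 (volume.restrict D), ∀ c, b c =ᵐ[volume.restrict D]
      (π ⁻¹' {c}).indicator (fun _ => (1 : ℂ)) :=
    ⟨fun c => indicatorConstLp 2 (π.measurableSet_fiber c)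
      (measure_ne_top (volume.restrict D) _) (1 : ℂ), fun c => indicatorConstLp_coeFn⟩
  obtain ⟨S, hS⟩ : ∃ S : X →L[ℂ] Lp ℂ 2 (volume.restrict D), S = ∑ c ∈ π.range,
    (ContinuousLinearMap.toSpanSingleton ℂ (b c)).comp (φ c) := ⟨_, rfl⟩
  have hSc : IsCompactOperator S := by
    have : S ∈ compactOperator (RingHom.id ℂ) X (Lp ℂ 2 (volume.restrict D)) := by
      rw [hS]
      refine Submodule.sum_mem _ fun c _ => ?_
      have h1 : IsCompactOperator (φ c) := isCompactOperator_of_locallyCompactSpace_dom (φ c)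
      exact h1.clm_comp (ContinuousLinearMap.toSpanSingleton ℂ (b c))
    exact this
  refine ⟨S, hSc, fun f => ?_⟩
  have h1 : S f = ∑ c ∈ π.range, φ c f • b c := by
    simp [hS]
  have h2 : ∀ᵐ x ∂(volume.restrict D), ∀ c ∈ π.range,
      (φ c f • b c : Lp ℂ 2 (volume.restrict D)) x
        = φ c f * (π ⁻¹' {c}).indicator (fun _ => (1 : ℂ)) x := by
    refine (eventually_all_finset π.range).2 fun c _ => ?_
    filter_upwards [Lp.coeFn_smul (φ c f) (b c), hb c] with x e1 e2
    rw [e1, Pi.smul_apply, e2, smul_eq_mul]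
  rw [h1]
  filter_upwards [Lp.coeFn_finsetSum π.range (fun c => φ c f • b c), h2] with x e1 e2
  rw [e1, Finset.sum_apply, Finset.sum_congr rfl e2, Finset.sum_eq_single (π x)]
  · simp [hφ_apply]
  · intro c _ hc
    simp [Ne.symm hc]
  · intro h
    exact absurd (π.mem_range_self x) h

/-- Restricting the convolution with a compactly supported continuous kernel to a bounded set
gives a compact operator. -/
lemma isCompactOperator_restrict_youngCLM_of_continuous {X : Type*} [NormedAddCommGroup X]
    [NormedSpace ℂ X] {D : Set (E d)} (hD : MeasurableSet D) (hDb : Bornology.IsBounded D)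
    (A : X →L[ℂ] Lp ℂ 2 (volume : Measure (E d))) (hA : ∀ f, ∀ᵐ y, y ∉ D → A f y = 0)
    {k : E d → ℂ} (hk : Integrable k) (hkc : Continuous k) (hks : HasCompactSupport k) :
    IsCompactOperator (((LpToLpRestrictCLM (E d) ℂ ℂ volume 2 D).comp (youngCLM k hk)).comp A) := by
  set T := ((LpToLpRestrictCLM (E d) ℂ ℂ volume 2 D).comp (youngCLM k hk)).comp A with hT
  have hDfin : IsFiniteMeasure (volume.restrict D) :=
    ⟨by rw [Measure.restrict_apply_univ]; exact hDb.measure_lt_top⟩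
  set V : ℝ := (volume D ^ (1 / 2 : ℝ)).toReal with hV
  set W : ℝ := (measureUnivNNReal (volume.restrict D) : ℝ) ^ (2 : ENNReal).toReal⁻¹ with hW
  have hV0 : 0 ≤ V := ENNReal.toReal_nonneg
  have hW0 : 0 ≤ W := by positivity
  have hmem : T ∈ closure {S : X →L[ℂ] Lp ℂ 2 (volume.restrict D) | IsCompactOperator S} := by
    rw [Metric.mem_closure_iff]
    intro ε hε
    -- V passes from L² to L¹ norms of functions living on D, and W from a pointwise bound to the L²
    -- norm on D; with this modulus for k the error W V ‖A‖ τ is below ε.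
    set τ : ℝ := ε / (2 * (W * V * ‖A‖ + 1)) with hτ
    have hden : 0 < W * V * ‖A‖ + 1 := by positivity
    have hτ0 : 0 < τ := by positivity
    have huc := hks.uniformContinuous_of_continuous hkc
    obtain ⟨δ, hδ, hkδ⟩ := Metric.uniformContinuous_iff.1 huc τ hτ0
    -- a simple function approximating the identity on `D`
    have hdense : DenseRange (TopologicalSpace.denseSeq (E d)) :=
      TopologicalSpace.denseRange_denseSeq (E d)
    set e := TopologicalSpace.denseSeq (E d)
    obtain ⟨N, hN⟩ : ∃ N : ℕ, ∀ x ∈ D, ∃ j ≤ N, dist (e j) x < δ := by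
      have hcomp : IsCompact (closure D) := hDb.isCompact_closure
      obtain ⟨t, ht⟩ := hcomp.elim_finite_subcover (fun j => Metric.ball (e j) δ)
        (fun j => Metric.isOpen_ball) (fun x _ => by
          obtain ⟨j, hj⟩ := hdense.exists_dist_lt x hδ
          exact Set.mem_iUnion.2 ⟨j, hj⟩)
      refine ⟨t.sup id, fun x hx => ?_⟩
      obtain ⟨j, hj⟩ := Set.mem_iUnion.1 (ht (subset_closure hx))
      obtain ⟨hjt, hjx⟩ := Set.mem_iUnion.1 hj
      exact ⟨j, Finset.le_sup (f := id) hjt, by rw [dist_comm]; exact hjx⟩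
    set π := SimpleFunc.nearestPt e N with hπ
    have hπδ : ∀ x ∈ D, dist (π x) x < δ := fun x hx => by
      obtain ⟨j, hjN, hj⟩ := hN x hx
      have h1 := SimpleFunc.edist_nearestPt_le e x hjN
      rw [edist_dist, edist_dist, ENNReal.ofReal_le_ofReal_iff dist_nonneg] at h1
      exact h1.trans_lt hj
    obtain ⟨S, hSc, hS_apply⟩ := exists_compact_of_simpleFunc (D := D) A hkc hks π
    refine ⟨S, hSc, ?_⟩
    -- For x ∈ D the points x and π x are closer than δ, so the two kernels differ by at most τ
    -- uniformly in y.
    have hbound : ∀ f, ‖(T - S) f‖ ≤ W * (τ * (V * (‖A‖ * ‖f‖))) := fun f => by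
      refine Lp.norm_le_of_ae_bound (by positivity) ?_
      have hAi := integrable_of_memLp_two_of_support hD hDb (Lp.memLp (A f)) (hA f)
      have hAn : ∫ y, ‖A f y‖ ≤ V * (‖A‖ * ‖f‖) :=
        (integral_norm_le_of_support hD hDb (A f) (hA f)).trans
          (mul_le_mul_of_nonneg_left (A.le_opNorm f) hV0)
      have hki : ∀ x : E d, Integrable (fun y => k (x - y) * A f y) := fun x => by
        obtain ⟨M, hM⟩ := hks.exists_bound_of_continuous hkc
        exact hAi.bdd_mul (hkc.comp (continuous_const.sub continuous_id)).aestronglyMeasurable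
          (Eventually.of_forall fun y => hM _)
      rw [sub_apply]
      filter_upwards [Lp.coeFn_sub (T f) (S f), hS_apply f,
        LpToLpRestrictCLM_coeFn ℂ D (youngCLM k hk (A f)),
        ae_restrict_of_ae (youngCLM_coeFn hk (A f)), ae_restrict_mem hD] with x e1 e2 e3 e4 hxD
      have e5 : T f x = cv k (A f) x := by
        rw [← e4, ← e3]; rfl
      rw [e1, Pi.sub_apply, e2, e5, cv, ← integral_sub (hki x) (hki (π x))]
      calc ‖∫ y, (k (x - y) * A f y - k (π x - y) * A f y)‖
          ≤ ∫ y, τ * ‖A f y‖ := by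
            refine norm_integral_le_of_norm_le (hAi.norm.const_mul τ) (Eventually.of_forall fun y => ?_)
            rw [← sub_mul, norm_mul]
            refine mul_le_mul_of_nonneg_right ?_ (norm_nonneg _)
            rw [← dist_eq_norm]
            refine (hkδ ?_).le
            rw [dist_sub_right, dist_comm]
            exact hπδ x hxD
        _ ≤ τ * (V * (‖A‖ * ‖f‖)) := by
            rw [integral_const_mul]; gcongr
    rw [dist_eq_norm]
    have hle : ‖T - S‖ ≤ W * V * ‖A‖ * τ := by
      refine ContinuousLinearMap.opNorm_le_bound _ (by positivity) fun f => ?_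
      exact (hbound f).trans (le_of_eq (by ring))
    refine hle.trans_lt ?_
    have : W * V * ‖A‖ * τ ≤ (W * V * ‖A‖ + 1) * τ := by gcongr; linarith
    refine this.trans_lt ?_
    rw [hτ]
    field_simp
    linarith
  rwa [isClosed_setOfPred_isCompactOperator.closure_eq] at hmem

/-- Approximate the kernel in L¹ by continuous compactly supported ones. The operator norm of a
convolution is at most the L¹ norm of its kernel, and compact operators form a closed set. -/
lemma isCompactOperator_restrict_youngCLM {X : Type*} [NormedAddCommGroup X]
    [NormedSpace ℂ X] {D : Set (E d)} (hD : MeasurableSet D) (hDb : Bornology.IsBounded D)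
    (A : X →L[ℂ] Lp ℂ 2 (volume : Measure (E d))) (hA : ∀ f, ∀ᵐ y, y ∉ D → A f y = 0)
    {k : E d → ℂ} (hk : Integrable k) :
    IsCompactOperator (((LpToLpRestrictCLM (E d) ℂ ℂ volume 2 D).comp (youngCLM k hk)).comp A) := by
  set R := LpToLpRestrictCLM (E d) ℂ ℂ volume 2 D with hR
  have hmem : (R.comp (youngCLM k hk)).comp A ∈
      closure {S : X →L[ℂ] Lp ℂ 2 (volume.restrict D) | IsCompactOperator S} := by
    rw [Metric.mem_closure_iff]
    intro ε hε
    set τ : ℝ := ε / (2 * (‖R‖ * ‖A‖ + 1)) with hτ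
    have hτ0 : 0 < τ := by positivity
    obtain ⟨g, hgs, hgn, hgc, hgL⟩ := (memLp_one_iff_integrable.2 hk).exists_hasCompactSupport_eLpNorm_sub_le
      ENNReal.one_ne_top (ε := ENNReal.ofReal τ) (by simpa using hτ0)
    have hg : Integrable g := memLp_one_iff_integrable.1 hgL
    have hs : Integrable fun y => k y - g y := hk.sub hg
    refine ⟨(R.comp (youngCLM g hg)).comp A,
      isCompactOperator_restrict_youngCLM_of_continuous hD hDb A hA hg hgc hgs, ?_⟩
    have h1 : (R.comp (youngCLM k hk)).comp A - (R.comp (youngCLM g hg)).comp A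
        = (R.comp (youngCLM _ hs)).comp A := by
      rw [← youngCLM_sub hk hg hs, ContinuousLinearMap.comp_sub, ContinuousLinearMap.sub_comp]
    have h2 : ‖youngCLM _ hs‖ ≤ τ := by
      refine (norm_youngCLM_le hs).trans ?_
      rw [integral_norm_eq_lintegral_enorm hs.1, ← eLpNorm_one_eq_lintegral_enorm]
      exact ENNReal.toReal_le_of_le_ofReal hτ0.le hgn
    rw [dist_eq_norm, h1]
    have h3 : ‖(R.comp (youngCLM _ hs)).comp A‖ ≤ ‖R‖ * τ * ‖A‖ := by
      refine (ContinuousLinearMap.opNorm_comp_le _ _).trans ?_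
      gcongr
      exact (ContinuousLinearMap.opNorm_comp_le _ _).trans (by gcongr)
    refine h3.trans_lt ?_
    have : ‖R‖ * τ * ‖A‖ ≤ (‖R‖ * ‖A‖ + 1) * τ := by nlinarith
    refine this.trans_lt ?_
    rw [hτ]
    field_simp
    linarith
  rwa [isClosed_setOfPred_isCompactOperator.closure_eq] at hmem

/-- The source term `n f`, extended by zero outside `D`. -/
noncomputable def sourceTerm (D : Set (E d)) (n : E d → ℝ) (f : E d → ℂ) : E d → ℂ :=
  D.indicator fun y => (n y : ℂ) * f y

lemma memLp_sourceTerm {D : Set (E d)} (hD : MeasurableSet D) {n : E d → ℝ} {N : ℝ}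
    (hn : AEStronglyMeasurable n (volume.restrict D)) (hN : ∀ x ∈ D, |n x| ≤ N) {f : E d → ℂ}
    (hf : MemLp f 2 (volume.restrict D)) : MemLp (sourceTerm D n f) 2 ∧
      eLpNorm (sourceTerm D n f) 2 volume ≤ ENNReal.ofReal N * eLpNorm f 2 (volume.restrict D) := by
  have hb : ∀ᵐ y ∂(volume.restrict D), ‖(n y : ℂ) * f y‖ ≤ N * ‖f y‖ := by
    filter_upwards [ae_restrict_mem hD] with y hy
    rw [norm_mul, Complex.norm_real]
    exact mul_le_mul_of_nonneg_right (hN y hy) (norm_nonneg _)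
  have hm : AEStronglyMeasurable (fun y => (n y : ℂ) * f y) (volume.restrict D) :=
    (Complex.continuous_ofReal.comp_aestronglyMeasurable hn).mul hf.1
  constructor
  · rw [sourceTerm, memLp_indicator_iff_restrict hD]
    exact hf.of_le_mul hm hb
  · rw [sourceTerm, eLpNorm_indicator_eq_eLpNorm_restrict hD]
    exact eLpNorm_le_mul_eLpNorm_of_ae_le_mul hb 2

lemma sourceTerm_congr {D : Set (E d)} (hD : MeasurableSet D) (n : E d → ℝ) {f g : E d → ℂ}
    (h : f =ᵐ[volume.restrict D] g) : sourceTerm D n f =ᵐ[volume] sourceTerm D n g := by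
  filter_upwards [(ae_restrict_iff' hD).1 h] with y hy
  by_cases hyD : y ∈ D
  · simp [sourceTerm, hyD, hy hyD]
  · simp [sourceTerm, hyD]

/-- Multiplication by `n` followed by extension by zero as a bounded operator. -/
noncomputable def sourceCLM {D : Set (E d)} (hD : MeasurableSet D) {n : E d → ℝ} {N : ℝ}
    (hn : AEStronglyMeasurable n (volume.restrict D)) (hN : ∀ x ∈ D, |n x| ≤ N) (hN0 : 0 ≤ N) :
    Lp ℂ 2 (volume.restrict D) →L[ℂ] Lp ℂ 2 (volume : Measure (E d)) :=
  LinearMap.mkContinuous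
    { toFun := fun f => (memLp_sourceTerm hD hn hN (Lp.memLp f)).1.toLp
      map_add' := fun f g => by
        rw [← MemLp.toLp_add]
        refine MemLp.toLp_congr _ _ ((sourceTerm_congr hD n (Lp.coeFn_add f g)).trans
          (Eventually.of_forall fun y => ?_))
        by_cases hyD : y ∈ D <;> simp [sourceTerm, hyD, mul_add]
      map_smul' := fun c f => by
        rw [RingHom.id_apply, ← MemLp.toLp_const_smul]
        refine MemLp.toLp_congr _ _ ((sourceTerm_congr hD n (Lp.coeFn_smul c f)).trans
          (Eventually.of_forall fun y => ?_))
        by_cases hyD : y ∈ D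
        · simp only [sourceTerm, hyD, Set.indicator_of_mem, Pi.smul_apply, smul_eq_mul]; ring
        · simp [sourceTerm, hyD] }
    N (fun f => by
      simp only [LinearMap.coe_mk, AddHom.coe_mk, Lp.norm_toLp]
      rw [Lp.norm_def, ← ENNReal.toReal_ofReal hN0, ← ENNReal.toReal_mul]
      exact ENNReal.toReal_mono (ENNReal.mul_ne_top ENNReal.ofReal_ne_top (Lp.eLpNorm_ne_top f))
        (memLp_sourceTerm hD hn hN (Lp.memLp f)).2)

lemma sourceCLM_coeFn {D : Set (E d)} (hD : MeasurableSet D) {n : E d → ℝ} {N : ℝ}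
    (hn : AEStronglyMeasurable n (volume.restrict D)) (hN : ∀ x ∈ D, |n x| ≤ N) (hN0 : 0 ≤ N)
    (f : Lp ℂ 2 (volume.restrict D)) :
    sourceCLM hD hn hN hN0 f =ᵐ[volume] sourceTerm D n f :=
  MemLp.coeFn_toLp (memLp_sourceTerm hD hn hN (Lp.memLp f)).1

lemma potential_eq_cv {D : Set (E d)} (hD : MeasurableSet D) (n : E d → ℝ) (f : E d → ℂ) (x : E d) :
    potential D n f x = cv (freeGreen d) (sourceTerm D n f) x := by
  rw [potential, ← integral_indicator hD, cv]
  congr 1; ext y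
  by_cases hy : y ∈ D <;> simp [sourceTerm, hy, mul_assoc]

lemma locallyIntegrable_freeGreen (hd : 1 ≤ d) : LocallyIntegrable (freeGreen d) := by
  have hg := isOutgoingProfile_greenRadial hd
  obtain ⟨ρ, B, hρ, hB, hb⟩ := exists_bound_of_tendsto_deriv hg.smooth hg.flux
  exact locallyIntegrable_radial hd hg.smooth.continuousOn hρ fun r h0 h1 => (hb r h0 h1).2

theorem exists_compact_sourceOperator (hd : 1 ≤ d) {D : Set (E d)} (hD : MeasurableSet D)
    (hDb : Bornology.IsBounded D) {n : E d → ℝ} {N : ℝ}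
    (hn : AEStronglyMeasurable n (volume.restrict D)) (hN : ∀ x ∈ D, |n x| ≤ N) (hN0 : 0 ≤ N) :
    ∃ K : Lp ℂ 2 (volume.restrict D) →L[ℂ] Lp ℂ 2 (volume.restrict D),
      IsSourceOperator D n K ∧ IsCompactOperator K := by
  obtain ⟨R, hR⟩ := hDb.subset_closedBall 0
  -- Differences of points of D have norm at most 2R, so this truncation makes the kernel integrable
  -- without changing the operator on D.
  set F : E d → ℂ := (Metric.closedBall (0 : E d) (R + R)).indicator (freeGreen d) with hF
  have hFi : Integrable F := by
    rw [hF, integrable_indicator_iff Metric.isClosed_closedBall.measurableSet]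
    exact (locallyIntegrable_freeGreen hd).integrableOn_isCompact (isCompact_closedBall _ _)
  set A := sourceCLM hD hn hN hN0 with hA
  have hAs : ∀ f, ∀ᵐ y, y ∉ D → A f y = 0 := fun f => by
    filter_upwards [sourceCLM_coeFn hD hn hN hN0 f] with y hy hyD
    rw [hA, hy]; simp [sourceTerm, hyD]
  refine ⟨((LpToLpRestrictCLM (E d) ℂ ℂ volume 2 D).comp (youngCLM F hFi)).comp A, fun f => ?_,
    isCompactOperator_restrict_youngCLM hD hDb A hAs hFi⟩
  have hm := (memLp_sourceTerm hD hn hN (Lp.memLp f)).1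
  filter_upwards [LpToLpRestrictCLM_coeFn ℂ D (youngCLM F hFi (A f)),
    ae_restrict_of_ae (youngCLM_coeFn hFi (A f)), ae_restrict_mem hD,
    ae_restrict_of_ae (ae_integrable_cv_integrand hFi hm)] with x e1 e2 hxD hix
  have hFG : ∀ y, F (x - y) * sourceTerm D n f y = freeGreen d (x - y) * sourceTerm D n f y :=
    fun y => by
      by_cases hyD : y ∈ D
      · have : x - y ∈ Metric.closedBall (0 : E d) (R + R) := by
          have h1 := hR hxD
          have h2 := hR hyD
          rw [mem_closedBall_zero_iff] at h1 h2 ⊢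
          exact (norm_sub_le _ _).trans (add_le_add h1 h2)
        rw [hF, Set.indicator_of_mem this]
      · simp [sourceTerm, hyD]
  constructor
  · rw [← integrable_indicator_iff hD]
    refine hix.congr (Eventually.of_forall fun y => ?_)
    change F (x - y) * sourceTerm D n f y = _
    rw [hFG]
    by_cases hyD : y ∈ D <;> simp [sourceTerm, hyD, mul_assoc]
  · change (LpToLpRestrictCLM (E d) ℂ ℂ volume 2 D) (youngCLM F hFi (A f)) x = _
    rw [e1, e2, potential_eq_cv hD, cv_congr_ae (sourceCLM_coeFn hD hn hN hN0 f)]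
    simp only [cv, hFG]

end SourceOperator

/-! ### Derivatives of convolutions and Fubini against test functions -/

section ConvolutionCalculus

variable {d : ℕ}

lemma pd_comp_add_right (i : Fin d) (ψ : E d → ℂ) (a : E d) :
    pd i (fun y => ψ (y + a)) = fun y => pd i ψ (y + a) := by
  ext x; simp [pd, fderiv_comp_add_right]

lemma lap_comp_add_right (ψ : E d → ℂ) (a : E d) :
    lap (fun y => ψ (y + a)) = fun y => lap ψ (y + a) := by
  ext x; simp only [lap, pd_comp_add_right]

lemma IsTest.comp_add_right {ψ : E d → ℂ} (hψ : IsTest ψ) (a : E d) :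
    IsTest (fun y => ψ (y + a)) :=
  ⟨hψ.smooth.comp (contDiff_id.add contDiff_const),
    hψ.cpt.comp_homeomorph (Homeomorph.addRight a)⟩

lemma contDiff_cv {k h : E d → ℂ} (hk : LocallyIntegrable k) (hh : IsTest h) :
    ContDiff ℝ ∞ (cv k h) := by
  rw [cv_eq_convolution]
  exact hh.cpt.contDiff_convolution_right _ hk hh.smooth

lemma pd_cv {k h : E d → ℂ} (hk : LocallyIntegrable k) (hh : IsTest h) (i : Fin d) :
    pd i (cv k h) = cv k (pd i h) := by
  have h1 : ContDiff ℝ 1 h := hh.smooth.of_le (by simp)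
  ext x
  rw [cv_eq_convolution, cv_eq_convolution, pd,
    (hh.cpt.hasFDerivAt_convolution_right (ContinuousLinearMap.mul ℝ ℂ) hk h1 x).fderiv,
    convolution_precompR_apply _ hk (hh.cpt.fderiv ℝ) (h1.continuous_fderiv one_ne_zero)]
  rfl

lemma cv_sum {ι : Type*} (s : Finset ι) {k : E d → ℂ} {h : ι → E d → ℂ}
    (hk : LocallyIntegrable k) (hh : ∀ i, IsTest (h i)) (x : E d) :
    cv k (fun y => ∑ i ∈ s, h i y) x = ∑ i ∈ s, cv k (h i) x := by
  simp only [cv, Finset.mul_sum]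
  refine integral_finsetSum _ fun i _ => ?_
  have := (((hh i).cpt.convolutionExists_right (ContinuousLinearMap.mul ℝ ℂ) hk
    (hh i).smooth.continuous) x).integrable_swap
  exact this

lemma integrable_cv_test {k h : E d → ℂ} (hk : LocallyIntegrable k) (hh : IsTest h) (x : E d) :
    Integrable (fun y => k (x - y) * h y) :=
  ((hh.cpt.convolutionExists_right (ContinuousLinearMap.mul ℝ ℂ) hk
    hh.smooth.continuous) x).integrable_swap

lemma cv_add_test {k h h' : E d → ℂ} (hk : LocallyIntegrable k) (hh : IsTest h)
    (hh' : IsTest h') (x : E d) :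
    cv k (fun y => h y + h' y) x = cv k h x + cv k h' x := by
  simp only [cv, mul_add]
  exact integral_add (integrable_cv_test hk hh x) (integrable_cv_test hk hh' x)

lemma lap_cv {k h : E d → ℂ} (hk : LocallyIntegrable k) (hh : IsTest h) :
    lap (cv k h) = cv k (lap h) := by
  ext x
  have h1 : lap h = fun y => ∑ i, pd i (pd i h) y := rfl
  rw [h1, cv_sum _ hk fun i => (hh.pd i).pd i]
  simp only [lap, pd_cv hk hh, pd_cv hk (hh.pd _)]

lemma isTest_cv {k h : E d → ℂ} (hk : LocallyIntegrable k) (hks : HasCompactSupport k)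
    (hh : IsTest h) : IsTest (cv k h) := by
  refine ⟨contDiff_cv hk hh, ?_⟩
  rw [cv_eq_convolution]
  exact hks.convolution _ hh.cpt

/-- The integrand of the double integral of `(k * h) ψ` is integrable if its support is bounded. -/
lemma integrable_prod_cv_mul {k h ψ : E d → ℂ} (hk : LocallyIntegrable k)
    (hh : LocallyIntegrable h) (hψ : IsTest ψ) {R : ℝ}
    (hR : ∀ x y, ψ x ≠ 0 → k (x - y) * h y ≠ 0 → ‖y‖ ≤ R) :
    Integrable (fun p : E d × E d => k (p.1 - p.2) * h p.2 * ψ p.1)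
      ((volume : Measure (E d)).prod volume) := by
  obtain ⟨R', hR'⟩ := hψ.cpt.isCompact.isBounded.subset_closedBall (0 : E d)
  obtain ⟨M, hM⟩ := hψ.cpt.exists_bound_of_continuous hψ.smooth.continuous
  have hind : ∀ (f : E d → ℂ) (r : ℝ), LocallyIntegrable f →
      Integrable ((Metric.closedBall (0 : E d) r).indicator f) := fun f r hf =>
    (integrable_indicator_iff Metric.isClosed_closedBall.measurableSet).2
      (hf.integrableOn_isCompact (isCompact_closedBall _ _))
  have h1 := (hind h R hh).convolution_integrand (ContinuousLinearMap.mul ℝ ℂ)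
    (hind k (R' + R) hk)
  have h2 : Integrable (fun p : E d × E d => ψ p.1 *
      ((Metric.closedBall (0 : E d) (R' + R)).indicator k (p.1 - p.2)
        * (Metric.closedBall (0 : E d) R).indicator h p.2))
      ((volume : Measure (E d)).prod volume) := by
    refine Integrable.bdd_mul (c := M) ?_ ?_ ?_
    · simpa [mul_comm] using h1
    · exact (hψ.smooth.continuous.comp continuous_fst).aestronglyMeasurable
    · exact Eventually.of_forall fun p => hM _
  refine h2.congr (Eventually.of_forall fun p => ?_)
  change _ = k (p.1 - p.2) * h p.2 * ψ p.1
  by_cases hψ0 : ψ p.1 = 0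
  · simp [hψ0]
  have hx : ‖p.1‖ ≤ R' := by
    simpa using hR' (subset_tsupport _ hψ0)
  by_cases h0 : k (p.1 - p.2) * h p.2 = 0
  · rw [h0, zero_mul]
    by_cases h3 : p.1 - p.2 ∈ Metric.closedBall (0 : E d) (R' + R) <;>
      by_cases h4 : p.2 ∈ Metric.closedBall (0 : E d) R <;> simp only [h3, h4,
        Set.indicator_of_mem, Set.indicator_of_notMem, not_false_eq_true, h0, mul_zero, zero_mul]
  · have hy := hR _ _ hψ0 h0
    have h3 : p.2 ∈ Metric.closedBall (0 : E d) R := mem_closedBall_zero_iff.2 hy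
    have h4 : p.1 - p.2 ∈ Metric.closedBall (0 : E d) (R' + R) :=
      mem_closedBall_zero_iff.2 ((norm_sub_le _ _).trans (add_le_add hx hy))
    simp only [h3, h4, Set.indicator_of_mem]
    ring

/-- Fubini: an even kernel is its own transpose, so the convolution moves onto the test function. -/
lemma integral_cv_mul {k h ψ : E d → ℂ} (hk : LocallyIntegrable k)
    (hh : LocallyIntegrable h) (hψ : IsTest ψ) {R : ℝ}
    (hR : ∀ x y, ψ x ≠ 0 → k (x - y) * h y ≠ 0 → ‖y‖ ≤ R) (hev : ∀ z, k (-z) = k z) :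
    ∫ x, cv k h x * ψ x = ∫ y, h y * cv k ψ y := by
  have h1 := integral_integral_swap (f := fun x y => k (x - y) * h y * ψ x)
    (integrable_prod_cv_mul hk hh hψ hR)
  simp only [integral_mul_const] at h1
  rw [show (∫ x, cv k h x * ψ x) = ∫ x, (∫ y, k (x - y) * h y) * ψ x from rfl, h1]
  refine integral_congr_ae (Eventually.of_forall fun y => ?_)
  change _ = h y * ∫ x, k (y - x) * ψ x
  rw [← integral_const_mul]
  refine integral_congr_ae (Eventually.of_forall fun x => ?_)
  change k (x - y) * h y * ψ x = h y * (k (y - x) * ψ x)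
  rw [← neg_sub y x, hev]; ring

end ConvolutionCalculus

/-! ### Fundamental solution and compactly supported parametrix -/

section Parametrix

variable {d : ℕ}

lemma cv_radial_lap_add (hd : 1 ≤ d) {f : ℝ → ℂ} (hf : ContDiffOn ℝ ∞ f (Set.Ioi 0))
    (hlim : Tendsto (fun r : ℝ => ((r ^ (d - 1) : ℝ) : ℂ) * deriv f r) (𝓝[>] 0)
      (𝓝 (sphereConst d : ℂ)))
    {δ : ℝ} (hδ : 0 < δ) (hq : ∀ r, 0 < r → r < δ → radOp d f r = 0)
    {φ : E d → ℂ} (hφ : IsTest φ) (x : E d) :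
    cv (fun z => f ‖z‖) (fun y => lap φ y + φ y) x
      = φ x + cv (fun z => radOp d f ‖z‖) φ x := by
  have h1 : ∀ (k : ℝ → ℂ) (h : E d → ℂ),
      cv (fun z => k ‖z‖) h x = ∫ y, k ‖y‖ * h (y + x) := fun k h => by
    rw [cv, ← integral_add_right_eq_self _ x]
    simp
  have h2 := integral_radial_mul_lap_add hd hf hlim hδ hq (hφ.comp_add_right x)
  rw [lap_comp_add_right] at h2
  rw [h1, h1, h2, zero_add]

/-- `F` is a compactly supported fundamental solution of `Δ + 1` up to the smooth error `ρ`. -/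
structure IsParametrix (F ρ : E d → ℂ) : Prop where
  integrable : Integrable F
  cpt : HasCompactSupport F
  error : IsTest ρ
  error_even : ∀ z, ρ (-z) = ρ z
  cv_eq : ∀ φ, IsTest φ → ∀ x, cv F (fun y => lap φ y + φ y) x = φ x + cv ρ φ x

lemma cv_freeGreen_lap_add (hd : 1 ≤ d) {φ : E d → ℂ} (hφ : IsTest φ) (x : E d) :
    cv (freeGreen d) (fun y => lap φ y + φ y) x = φ x := by
  have hg := isOutgoingProfile_greenRadial hd
  have h1 := cv_radial_lap_add hd hg.smooth hg.flux one_pos (fun r hr _ => hg.ode r hr) hφ x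
  have h2 : cv (fun z : E d => radOp d (greenRadial d) ‖z‖) φ x = 0 := by
    have := nontrivial_E hd
    rw [cv]
    refine integral_eq_zero_of_ae ?_
    have : ∀ᵐ y : E d, y ≠ x := by simp [ae_iff, measure_singleton]
    filter_upwards [this] with y hy
    rw [hg.ode _ (norm_pos_iff.2 (sub_ne_zero.2 (Ne.symm hy)))]; simp
  rw [h2, add_zero] at h1
  exact h1

lemma freeGreen_neg (z : E d) : freeGreen d (-z) = freeGreen d z := by
  rw [freeGreen_eq, freeGreen_eq, norm_neg]

/-- The part of the Green function away from the singularity. -/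
noncomputable def regularGreen (d : ℕ) (z : E d) : ℂ := innerCutoff 1 ‖z‖ * freeGreen d z

/-- The singular part of the Green function. -/
noncomputable def singularGreen (d : ℕ) (z : E d) : ℂ := (1 - innerCutoff 1 ‖z‖) * freeGreen d z

lemma freeGreen_eq_add (z : E d) : freeGreen d z = singularGreen d z + regularGreen d z := by
  rw [singularGreen, regularGreen]; ring

lemma regularGreen_eq {z : E d} (hz : 2 ≤ ‖z‖) : regularGreen d z = freeGreen d z := by
  rw [regularGreen, innerCutoff_eq_one one_pos (by linarith), one_mul]

lemma contDiff_regularGreen (hd : 1 ≤ d) : ContDiff ℝ ∞ (regularGreen d) := by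
  have hg := isOutgoingProfile_greenRadial hd
  refine contDiff_radial (f := fun r => innerCutoff 1 r * greenRadial d r) (c := 0)
    ((contDiff_innerCutoff 1).contDiffOn.mul hg.smooth) one_pos fun r hr => ?_
  rw [innerCutoff_eq_zero one_pos hr.le, zero_mul]

/-- The truncated profile agrees with the Green function near 0 and so keeps the flux. Away from 0
the operator Δ + 1 leaves only the commutator with 1 - η, which is minus that with η and lives on
the shell 1 ≤ |z| ≤ 2. -/
lemma isParametrix_singularGreen (hd : 1 ≤ d) : IsParametrix (singularGreen d)
    (fun z => -cutoffComm d (greenRadial d) 1 ‖z‖) := by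
  have hg := isOutgoingProfile_greenRadial hd
  have hcut : ContDiffOn ℝ ∞ (fun r => 1 - innerCutoff 1 r) (Set.Ioi 0) :=
    contDiffOn_const.sub (contDiff_innerCutoff 1).contDiffOn
  have hd1 : deriv (fun r => 1 - innerCutoff 1 r) = fun r => -deriv (innerCutoff 1) r := by
    ext r; exact deriv_const_sub _
  have hd2 : deriv (fun r => -deriv (innerCutoff 1) r)
      = fun r => -deriv (deriv (innerCutoff 1)) r := by
    ext r; exact deriv.fun_neg
  have hrad : ∀ r, 0 < r → radOp d (fun r => (1 - innerCutoff 1 r) * greenRadial d r) r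
      = -cutoffComm d (greenRadial d) 1 r := fun r hr => by
    rw [radOp_mul hcut hg.smooth hr, hg.ode r hr, hd1, hd2, cutoffComm]
    ring
  have hfl : Tendsto (fun r : ℝ => ((r ^ (d - 1) : ℝ) : ℂ)
      * deriv (fun r => (1 - innerCutoff 1 r) * greenRadial d r) r) (𝓝[>] 0)
      (𝓝 (sphereConst d : ℂ)) := by
    refine hg.flux.congr' ?_
    filter_upwards [Ioo_mem_nhdsGT one_pos] with r hr
    have : (fun r => (1 - innerCutoff 1 r) * greenRadial d r) =ᶠ[𝓝 r] greenRadial d := by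
      filter_upwards [Iio_mem_nhds hr.2] with s hs
      rw [innerCutoff_eq_zero one_pos (le_of_lt hs)]; ring
    rw [this.deriv_eq]
  have hsupp : ∀ z : E d, 2 < ‖z‖ → singularGreen d z = 0 := fun z hz => by
    rw [singularGreen, innerCutoff_eq_one one_pos (by linarith)]; ring
  refine ⟨?_, ?_, ?_, fun z => by simp, fun φ hφ x => ?_⟩
  · have h1 : LocallyIntegrable (singularGreen d) := by
      obtain ⟨ρ, B, hρ, hB, hb⟩ := exists_bound_of_tendsto_deriv (hcut.mul hg.smooth) hfl
      exact locallyIntegrable_radial hd (hcut.mul hg.smooth).continuousOn hρ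
        fun r h0 h1 => (hb r h0 h1).2
    rw [← integrableOn_iff_integrable_of_support_subset (s := Metric.closedBall 0 2)]
    · exact h1.integrableOn_isCompact (isCompact_closedBall _ _)
    · intro z hz
      by_contra h
      exact hz (hsupp z (by simpa using h))
  · refine HasCompactSupport.of_support_subset_isCompact (isCompact_closedBall 0 2) fun z hz => ?_
    by_contra h
    exact hz (hsupp z (by simpa using h))
  · have := isTest_cutoffComm (d := d) hg.smooth one_pos
    exact ⟨this.smooth.neg, this.cpt.comp_left (g := fun z => -z) neg_zero⟩
  · have h1 := cv_radial_lap_add hd (hcut.mul hg.smooth) hfl one_pos (fun r hr hr1 => by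
      rw [hrad r hr, cutoffComm]
      have := deriv_innerCutoff_eq_zero one_pos (Or.inl hr1)
      simp [this.1, this.2]) hφ x
    have h2 : cv (fun z : E d => radOp d (fun r => (1 - innerCutoff 1 r) * greenRadial d r) ‖z‖) φ x
        = cv (fun z => -cutoffComm d (greenRadial d) 1 ‖z‖) φ x := by
      have := nontrivial_E hd
      refine integral_congr_ae ?_
      have : ∀ᵐ y : E d, y ≠ x := by simp [ae_iff, measure_singleton]
      filter_upwards [this] with y hy
      rw [hrad _ (norm_pos_iff.2 (sub_ne_zero.2 (Ne.symm hy)))]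
    rw [← h2, ← h1]
    rfl

end Parametrix

/-! ### Weak Laplacians and Weyl's lemma -/

section WeakFormulation

variable {d : ℕ}

lemma pd_const_mul (i : Fin d) (c : ℂ) {f : E d → ℂ} {x : E d} (hf : DifferentiableAt ℝ f x) :
    pd i (fun y => c * f y) x = c * pd i f x := by
  simp [pd, fderiv_const_mul hf]

lemma lap_add_const_mul {f g : E d → ℂ} (hf : ContDiff ℝ ∞ f) (hg : ContDiff ℝ ∞ g) (c : ℂ)
    (x : E d) : lap (fun y => f y + c * g y) x = lap f x + c * lap g x := by
  have h : ∀ i : Fin d, pd i (pd i fun y => f y + c * g y) x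
      = pd i (pd i f) x + c * pd i (pd i g) x := fun i => by
    have h1 : pd i (fun y => f y + c * g y) = fun y => pd i f y + c * pd i g y := by
      ext y
      rw [pd_add i (hf.diffAt y) ((hg.diffAt y).const_mul c), pd_const_mul i c (hg.diffAt y)]
    rw [h1, pd_add i ((hf.pd i).diffAt x) (((hg.pd i).diffAt x).const_mul c),
      pd_const_mul i c ((hg.pd i).diffAt x)]
  simp only [lap, h, Finset.sum_add_distrib, Finset.mul_sum]

lemma HasWeakLaplacian.integral_mul_lap {u w ψ : E d → ℂ} (h : HasWeakLaplacian u w)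
    (hψ : IsTest ψ) : ∫ x, u x * lap ψ x = ∫ x, w x * ψ x := by
  have h1 : IsTestFunction (fun x => (ψ x).re) :=
    ⟨Complex.reCLM.contDiff.comp hψ.smooth, hψ.cpt.comp_left Complex.zero_re⟩
  have h2 : IsTestFunction (fun x => (ψ x).im) :=
    ⟨Complex.imCLM.contDiff.comp hψ.smooth, hψ.cpt.comp_left Complex.zero_im⟩
  have key : ∀ {φ : E d → ℝ}, IsTestFunction φ →
      ∫ x, u x * lap (fun y => (φ y : ℂ)) x = ∫ x, w x * (φ x : ℂ) := fun {φ} hφ => by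
    have := h.2.2 φ hφ
    simp only [Complex.real_smul, ofReal_laplacian hφ.1] at this
    simpa only [mul_comm] using this
  have hdec : ψ = fun x => ((ψ x).re : ℂ) + Complex.I * ((ψ x).im : ℂ) := by
    ext x; rw [mul_comm]; exact (Complex.re_add_im _).symm
  have hl : ∀ x, lap ψ x = lap (fun y => ((ψ y).re : ℂ)) x
      + Complex.I * lap (fun y => ((ψ y).im : ℂ)) x := fun x => by
    conv_lhs => rw [hdec]
    exact lap_add_const_mul h1.isTest.smooth h2.isTest.smooth _ x
  have e1 : ∫ x, u x * lap ψ x = ∫ x, (u x * lap (fun y => ((ψ y).re : ℂ)) x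
      + Complex.I * (u x * lap (fun y => ((ψ y).im : ℂ)) x)) := by
    refine integral_congr_ae (Eventually.of_forall fun x => ?_)
    change u x * lap ψ x = _
    rw [hl]; ring
  have e2 : ∫ x, w x * ψ x = ∫ x, (w x * ((ψ x).re : ℂ) + Complex.I * (w x * ((ψ x).im : ℂ))) := by
    refine integral_congr_ae (Eventually.of_forall fun x => ?_)
    change w x * ψ x = _
    conv_lhs => rw [hdec]
    ring
  rw [e1, e2, integral_add (h.1.integrable_mul_test h1.isTest.lap)
    ((h.1.integrable_mul_test h2.isTest.lap).const_mul _),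
    integral_add (h.2.1.integrable_mul_test h1.isTest)
    ((h.2.1.integrable_mul_test h2.isTest).const_mul _), integral_const_mul, integral_const_mul,
    key h1, key h2]

lemma hasWeakLaplacian_of_forall {u w : E d → ℂ} (hu : LocallyIntegrable u)
    (hw : LocallyIntegrable w)
    (h : ∀ ψ, IsTest ψ → ∫ x, u x * lap ψ x = ∫ x, w x * ψ x) : HasWeakLaplacian u w := by
  refine ⟨hu, hw, fun φ hφ => ?_⟩
  have := h _ hφ.isTest
  simp only [Complex.real_smul, ofReal_laplacian hφ.1]
  simpa only [mul_comm] using this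

lemma locallyIntegrable_congr {f g : E d → ℂ} (hf : LocallyIntegrable f) (h : f =ᵐ[volume] g) :
    LocallyIntegrable g := fun x => by
  obtain ⟨s, hs, hi⟩ := hf x
  exact ⟨s, hs, hi.congr (ae_restrict_of_ae h)⟩

lemma HasWeakLaplacian.congr_right {u w w' : E d → ℂ} (h : HasWeakLaplacian u w)
    (hw : w =ᵐ[volume] w') : HasWeakLaplacian u w' := by
  refine ⟨h.1, locallyIntegrable_congr h.2.1 hw, fun φ hφ => (h.2.2 φ hφ).trans (integral_congr_ae ?_)⟩
  filter_upwards [hw] with x hx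
  rw [hx]

lemma HasWeakLaplacian.sub {u w u' w' : E d → ℂ} (h : HasWeakLaplacian u w)
    (h' : HasWeakLaplacian u' w') :
    HasWeakLaplacian (fun x => u x - u' x) (fun x => w x - w' x) := by
  refine hasWeakLaplacian_of_forall (h.1.sub h'.1) (h.2.1.sub h'.2.1) fun ψ hψ => ?_
  simp only [sub_mul]
  rw [integral_sub (h.1.integrable_mul_test hψ.lap) (h'.1.integrable_mul_test hψ.lap),
    integral_sub (h.2.1.integrable_mul_test hψ) (h'.2.1.integrable_mul_test hψ),
    h.integral_mul_lap hψ, h'.integral_mul_lap hψ]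

lemma ae_eq_of_forall_integral_mul_test {f g : E d → ℂ} (hf : LocallyIntegrable f)
    (hg : LocallyIntegrable g) (h : ∀ ψ, IsTest ψ → ∫ x, f x * ψ x = ∫ x, g x * ψ x) :
    f =ᵐ[volume] g := by
  refine ae_eq_of_integral_contDiff_smul_eq hf hg fun φ h1 h2 => ?_
  have := h _ (IsTestFunction.isTest ⟨h1, h2⟩)
  simp only [Complex.real_smul]
  simpa only [mul_comm] using this

/-- Weak solutions of the Helmholtz equation are smooth. -/
theorem exists_smooth_of_hasWeakLaplacian (hd : 1 ≤ d) {z : E d → ℂ}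
    (hz : HasWeakLaplacian z fun x => -z x) :
    ∃ W : E d → ℂ, ContDiff ℝ ∞ W ∧ z =ᵐ[volume] W ∧ ∀ x, lap W x + W x = 0 := by
  have hP := isParametrix_singularGreen hd
  set F := singularGreen d
  set ρ : E d → ℂ := fun z => -cutoffComm d (greenRadial d) 1 ‖z‖
  have hF : LocallyIntegrable F := hP.integrable.locallyIntegrable
  have hρ : LocallyIntegrable ρ := hP.error.integrable.locallyIntegrable
  have hsm : ContDiff ℝ ∞ (cv ρ z) := by
    rw [cv_comm]; exact contDiff_cv hz.1 hP.error
  -- Testing the equation for z with F * φ gives ∫ z (φ + ρ * φ) = 0. Since ρ is even, moving the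
  -- convolution back onto z yields z = -ρ * z, which is smooth.
  have hzW : z =ᵐ[volume] fun x => -cv ρ z x := by
    refine ae_eq_of_forall_integral_mul_test hz.1 hsm.neg.continuous.locallyIntegrable
      fun φ hφ => ?_
    have hA : IsTest (cv F φ) := isTest_cv hF hP.cpt hφ
    have hB : IsTest (cv ρ φ) := isTest_cv hρ hP.error.cpt hφ
    have e1 := hz.integral_mul_lap hA
    have e2 : ∀ x, lap (cv F φ) x + cv F φ x = φ x + cv ρ φ x := fun x => by
      rw [← hP.cv_eq φ hφ x, lap_cv hF hφ, cv_add_test hF hφ.lap hφ]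
    have e3 : ∫ x, z x * (φ x + cv ρ φ x) = 0 := by
      simp only [← e2, mul_add]
      rw [integral_add (hz.1.integrable_mul_test hA.lap) (hz.1.integrable_mul_test hA), e1]
      simp only [neg_mul]
      rw [integral_neg, neg_add_cancel]
    simp only [mul_add] at e3
    rw [integral_add (hz.1.integrable_mul_test hφ) (hz.1.integrable_mul_test hB)] at e3
    obtain ⟨R, hR⟩ := hφ.cpt.isCompact.isBounded.subset_closedBall (0 : E d)
    obtain ⟨R', hR'⟩ := hP.error.cpt.isCompact.isBounded.subset_closedBall (0 : E d)
    have e4 := integral_cv_mul hρ hz.1 hφ (R := R + R') (fun x y hx hy => by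
      have h1 : ‖x‖ ≤ R := by simpa using hR (subset_tsupport _ hx)
      have h2 : ‖x - y‖ ≤ R' := by
        simpa using hR' (subset_tsupport _ (left_ne_zero_of_mul hy))
      have h3 : y = x - (x - y) := by abel
      rw [h3]
      exact (norm_sub_le _ _).trans (add_le_add h1 h2)) hP.error_even
    simp only [neg_mul]
    rw [integral_neg, e4]
    linear_combination e3
  refine ⟨fun x => -cv ρ z x, hsm.neg, hzW, ?_⟩
  set W : E d → ℂ := fun x => -cv ρ z x
  have hW : ContDiff ℝ ∞ W := hsm.neg
  -- The smooth representative inherits the weak equation; integrating by parts makes it classical.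
  have hlap : lap W =ᵐ[volume] fun x => -W x := by
    refine ae_eq_of_forall_integral_mul_test hW.lap.continuous.locallyIntegrable
      hW.neg.continuous.locallyIntegrable fun φ hφ => ?_
    rw [← integral_mul_lap hW hφ]
    calc ∫ x, W x * lap φ x = ∫ x, z x * lap φ x := integral_congr_ae (by
          filter_upwards [hzW] with x hx; rw [hx])
      _ = ∫ x, -z x * φ x := hz.integral_mul_lap hφ
      _ = ∫ x, -W x * φ x := integral_congr_ae (by
          filter_upwards [hzW] with x hx; rw [hx])
  have := (hW.lap.continuous.ae_eq_iff_eq volume hW.neg.continuous).1 hlap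
  intro x
  rw [this]; simp

end WeakFormulation

/-! ### Convolution of a smooth kernel with a function of bounded support -/

section SmoothKernel

variable {d : ℕ}

lemma isTest_outerCutoff {r : ℝ} (hr : 0 < r) :
    IsTest (fun z : E d => 1 - innerCutoff r ‖z‖) := by
  refine ⟨contDiff_radial (f := fun s => 1 - innerCutoff r s) (c := 1)
    (contDiffOn_const.sub (contDiff_innerCutoff r).contDiffOn) hr fun s hs => ?_, ?_⟩
  · rw [innerCutoff_eq_zero hr hs.le, sub_zero]
  · refine HasCompactSupport.of_support_subset_isCompact (isCompact_closedBall 0 (2 * r))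
      fun z hz => ?_
    by_contra h
    apply hz
    simp only
    rw [innerCutoff_eq_one hr (le_of_lt (by simpa using h)), sub_self]

/-- On a bounded set, a smooth kernel may be replaced by a smooth compactly supported one. -/
lemma exists_isTest_eq {S : E d → ℂ} (hS : ContDiff ℝ ∞ S) (r : ℝ) :
    ∃ k : E d → ℂ, IsTest k ∧ ∀ z, ‖z‖ < r → k =ᶠ[𝓝 z] S := by
  have hr : 0 < max r 1 := lt_max_of_lt_right one_pos
  refine ⟨fun z => (1 - innerCutoff (max r 1) ‖z‖) * S z, (isTest_outerCutoff hr).mul_right hS,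
    fun z hz => ?_⟩
  filter_upwards [(continuous_norm.isOpen_preimage _ isOpen_Iio).mem_nhds
    (lt_max_of_lt_left hz : ‖z‖ < max r 1)] with y hy
  rw [innerCutoff_eq_zero hr (le_of_lt hy)]; ring

variable {S h : E d → ℂ} {R : ℝ}

lemma integrable_cv_smooth (hS : ContDiff ℝ ∞ S) (hh : Integrable h)
    (hR : ∀ y, R < ‖y‖ → h y = 0) (x : E d) : Integrable fun y => S (x - y) * h y := by
  obtain ⟨k, hk, hkS⟩ := exists_isTest_eq hS (‖x‖ + R + 1)
  obtain ⟨M, hM⟩ := hk.cpt.exists_bound_of_continuous hk.smooth.continuous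
  have h1 : Integrable fun y => k (x - y) * h y :=
    hh.bdd_mul (hk.smooth.continuous.comp (continuous_const.sub continuous_id)).aestronglyMeasurable
      (Eventually.of_forall fun y => hM _)
  refine h1.congr (Eventually.of_forall fun y => ?_)
  by_cases hy : R < ‖y‖
  · simp [hR y hy]
  · have : ‖x - y‖ < ‖x‖ + R + 1 := by
      have := norm_sub_le x y
      linarith [not_lt.1 hy]
    simp only [(hkS _ this).self_of_nhds]

/-- For x' near x only values of S on a bounded set enter the integral, so S may be exchanged for a
test function k, to which the calculus of test convolutions applies. -/
lemma exists_eventuallyEq_cv (hS : ContDiff ℝ ∞ S)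
    (hR : ∀ y, R < ‖y‖ → h y = 0) (x : E d) : ∃ k : E d → ℂ, IsTest k ∧
      cv S h =ᶠ[𝓝 x] cv h k ∧ ∀ i, cv h (pd i k) x = cv (pd i S) h x := by
  obtain ⟨k, hk, hkS⟩ := exists_isTest_eq hS (‖x‖ + R + 1)
  have key : ∀ x', ‖x'‖ < ‖x‖ + 1 → ∀ y, h y ≠ 0 → ‖x' - y‖ < ‖x‖ + R + 1 := fun x' hx' y hy => by
    have h1 : ‖y‖ ≤ R := by
      by_contra h2
      exact hy (hR y (not_le.1 h2))
    have := norm_sub_le x' y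
    linarith
  refine ⟨k, hk, ?_, fun i => ?_⟩
  · rw [cv_comm h k]
    have : ∀ᶠ x' in 𝓝 x, ‖x'‖ < ‖x‖ + 1 :=
      (continuous_norm.isOpen_preimage _ isOpen_Iio).mem_nhds
        (show ‖x‖ < ‖x‖ + 1 by linarith)
    filter_upwards [this] with x' hx'
    refine integral_congr_ae (Eventually.of_forall fun y => ?_)
    by_cases hy : h y = 0
    · simp [hy]
    · simp only [(hkS _ (key x' hx' y hy)).self_of_nhds]
  · rw [cv_comm h]
    refine integral_congr_ae (Eventually.of_forall fun y => ?_)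
    by_cases hy : h y = 0
    · simp [hy]
    · simp only [pd_congr i (hkS _ (key x (by linarith) y hy))]

lemma contDiff_cv_smooth (hS : ContDiff ℝ ∞ S) (hh : Integrable h)
    (hR : ∀ y, R < ‖y‖ → h y = 0) : ContDiff ℝ ∞ (cv S h) := by
  rw [contDiff_iff_contDiffAt]
  intro x
  obtain ⟨k, hk, h1, -⟩ := exists_eventuallyEq_cv hS hR x
  exact (contDiff_cv hh.locallyIntegrable hk).contDiffAt.congr_of_eventuallyEq h1

lemma pd_cv_smooth (hS : ContDiff ℝ ∞ S) (hh : Integrable h)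
    (hR : ∀ y, R < ‖y‖ → h y = 0) (i : Fin d) (x : E d) :
    pd i (cv S h) x = cv (pd i S) h x := by
  obtain ⟨k, hk, h1, h2⟩ := exists_eventuallyEq_cv hS hR x
  rw [pd_congr i h1, pd_cv hh.locallyIntegrable hk, h2]

end SmoothKernel

/-! ### The volume potential solves the inhomogeneous equation -/

section Potential

variable {d : ℕ} {h : E d → ℂ} {R : ℝ}

lemma integrable_of_memLp_two_of_norm (hh : MemLp h 2) (hR : ∀ y, R < ‖y‖ → h y = 0) :
    Integrable h :=
  integrable_of_memLp_two_of_support Metric.isClosed_closedBall.measurableSet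
    (Metric.isBounded_closedBall (x := (0 : E d)) (r := R)) hh
    (Eventually.of_forall fun y hy => hR y (by simpa using hy))

lemma cv_freeGreen_ae_eq (hd : 1 ≤ d) (hh : MemLp h 2) (hR : ∀ y, R < ‖y‖ → h y = 0) :
    cv (freeGreen d) h =ᵐ[volume] fun x => cv (singularGreen d) h x + cv (regularGreen d) h x := by
  filter_upwards [ae_integrable_cv_integrand (isParametrix_singularGreen hd).integrable hh]
    with x hx
  simp only [cv, freeGreen_eq_add, add_mul]
  exact integral_add hx (integrable_cv_smooth (contDiff_regularGreen hd)
    (integrable_of_memLp_two_of_norm hh hR) hR x)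

lemma locallyIntegrable_cv_freeGreen (hd : 1 ≤ d) (hh : MemLp h 2)
    (hR : ∀ y, R < ‖y‖ → h y = 0) : LocallyIntegrable (cv (freeGreen d) h) := by
  refine locallyIntegrable_congr (LocallyIntegrable.add ?_ ?_) (cv_freeGreen_ae_eq hd hh hR).symm
  · exact (memLp_cv (isParametrix_singularGreen hd).integrable hh).locallyIntegrable (by norm_num)
  · exact (contDiff_cv_smooth (contDiff_regularGreen hd)
      (integrable_of_memLp_two_of_norm hh hR) hR).continuous.locallyIntegrable

/-- Moving the even kernel onto the test function turns ∫ (G * h)(Δψ + ψ) into ∫ h · G * (Δψ + ψ),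
and G * (Δψ + ψ) = ψ. -/
theorem hasWeakLaplacian_cv_freeGreen (hd : 1 ≤ d) (hh : MemLp h 2)
    (hR : ∀ y, R < ‖y‖ → h y = 0) :
    HasWeakLaplacian (cv (freeGreen d) h) fun x => h x - cv (freeGreen d) h x := by
  have hv := locallyIntegrable_cv_freeGreen hd hh hR
  have hhi := (integrable_of_memLp_two_of_norm hh hR).locallyIntegrable
  refine hasWeakLaplacian_of_forall hv (hhi.sub hv) fun ψ hψ => ?_
  have h1 := integral_cv_mul (locallyIntegrable_freeGreen hd) hhi (hψ.lap.add hψ) (R := R)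
    (fun x y _ hy => by
      by_contra h2
      exact right_ne_zero_of_mul hy (hR y (not_le.1 h2))) freeGreen_neg
  simp only [cv_freeGreen_lap_add hd hψ, mul_add] at h1
  rw [integral_add (hv.integrable_mul_test hψ.lap) (hv.integrable_mul_test hψ)] at h1
  simp only [sub_mul]
  rw [integral_sub (hhi.integrable_mul_test hψ) (hv.integrable_mul_test hψ), ← h1]
  ring

end Potential

/-! ### H² regularity of the potential -/

section SecondOrder

variable {d : ℕ}

/-- A test function as an element of `L²`. -/
noncomputable def IsTest.toL2 {ψ : E d → ℂ} (hψ : IsTest ψ) : Lp ℂ 2 (volume : Measure (E d)) :=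
  (hψ.memLp 2).toLp

lemma IsTest.coeFn_toL2 {ψ : E d → ℂ} (hψ : IsTest ψ) : hψ.toL2 =ᵐ[volume] ψ :=
  MemLp.coeFn_toLp _

lemma IsTest.inner_toL2 {ψ : E d → ℂ} (hψ : IsTest ψ) (f : Lp ℂ 2 (volume : Measure (E d))) :
    inner ℂ hψ.toL2 f = ∫ x, f x * (starRingEnd ℂ) (ψ x) := by
  rw [L2.inner_def]
  refine integral_congr_ae ?_
  filter_upwards [hψ.coeFn_toL2] with x hx
  rw [hx]; simp

lemma IsTest.norm_toL2_sq {ψ : E d → ℂ} (hψ : IsTest ψ) :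
    ((‖hψ.toL2‖ ^ 2 : ℝ) : ℂ) = ∫ x, ψ x * (starRingEnd ℂ) (ψ x) := by
  have h := inner_self_eq_norm_sq_to_K (𝕜 := ℂ) hψ.toL2
  rw [hψ.inner_toL2] at h
  push_cast
  refine h.symm.trans (integral_congr_ae ?_)
  filter_upwards [hψ.coeFn_toL2] with x hx
  rw [hx]

lemma IsTest.sub {ψ φ : E d → ℂ} (hψ : IsTest ψ) (hφ : IsTest φ) :
    IsTest (fun x => ψ x - φ x) :=
  ⟨hψ.smooth.sub hφ.smooth, hψ.cpt.sub hφ.cpt⟩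

lemma IsTest.toL2_sub {ψ φ : E d → ℂ} (hψ : IsTest ψ) (hφ : IsTest φ) :
    (hψ.sub hφ).toL2 = hψ.toL2 - hφ.toL2 :=
  (MemLp.toLp_sub (hψ.memLp 2) (hφ.memLp 2))

lemma conj_pd_test {ψ : E d → ℂ} (hψ : IsTest ψ) (i : Fin d) :
    pd i (fun y => (starRingEnd ℂ) (ψ y)) = fun y => (starRingEnd ℂ) (pd i ψ y) :=
  funext fun x => pd_conj i (hψ.smooth.diffAt x)

lemma conj_lap_test {ψ : E d → ℂ} (hψ : IsTest ψ) :
    lap (fun y => (starRingEnd ℂ) (ψ y)) = fun y => (starRingEnd ℂ) (lap ψ y) := by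
  ext x
  simp only [lap, map_sum, conj_pd_test hψ, conj_pd_test (hψ.pd _)]

/-- Integration by parts turns the sum into -⟨Δψ, ψ⟩; then Cauchy–Schwarz. -/
lemma sum_norm_pd_sq {ψ : E d → ℂ} (hψ : IsTest ψ) :
    ∑ i, ‖(hψ.pd i).toL2‖ ^ 2 ≤ ‖hψ.toL2‖ * ‖hψ.lap.toL2‖ := by
  have h1 : ((∑ i, ‖(hψ.pd i).toL2‖ ^ 2 : ℝ) : ℂ) = -inner ℂ hψ.lap.toL2 hψ.toL2 := by
    rw [hψ.lap.inner_toL2]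
    have e1 : ∫ x, hψ.toL2 x * (starRingEnd ℂ) (lap ψ x)
        = ∫ x, ψ x * lap (fun y => (starRingEnd ℂ) (ψ y)) x := by
      refine integral_congr_ae ?_
      filter_upwards [hψ.coeFn_toL2] with x hx
      rw [hx, conj_lap_test hψ]
    rw [e1, integral_mul_lap_eq_neg_sum hψ.smooth hψ.conj, neg_neg]
    push_cast
    refine Finset.sum_congr rfl fun i _ => ?_
    have := (hψ.pd i).norm_toL2_sq
    push_cast at this
    rw [this, conj_pd_test hψ]
  have h2 : ‖((∑ i, ‖(hψ.pd i).toL2‖ ^ 2 : ℝ) : ℂ)‖ ≤ ‖hψ.lap.toL2‖ * ‖hψ.toL2‖ := by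
    rw [h1, norm_neg]; exact norm_inner_le_norm _ _
  rw [Complex.norm_real, Real.norm_of_nonneg (by positivity)] at h2
  rwa [mul_comm]

lemma norm_pd_le {ψ : E d → ℂ} (hψ : IsTest ψ) (i : Fin d) :
    ‖(hψ.pd i).toL2‖ ≤ ‖hψ.toL2‖ + ‖hψ.lap.toL2‖ := by
  have h1 : ‖(hψ.pd i).toL2‖ ^ 2 ≤ ∑ i, ‖(hψ.pd i).toL2‖ ^ 2 :=
    Finset.single_le_sum (f := fun i => ‖(hψ.pd i).toL2‖ ^ 2) (fun i _ => by positivity)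
      (Finset.mem_univ i)
  have h2 := sum_norm_pd_sq hψ
  refine abs_le_of_sq_le_sq' ?_ (by positivity) |>.2
  nlinarith [norm_nonneg hψ.toL2, norm_nonneg hψ.lap.toL2]

/-- Two integrations by parts exchange a mixed square for the product of the pure second derivatives
∂ᵢ²ψ and the conjugate of ∂ⱼ²ψ; their double sum is |Δψ|². Thus the Laplacian alone controls every
second derivative in L². -/
lemma sum_norm_pd_pd_sq {ψ : E d → ℂ} (hψ : IsTest ψ) :
    ∑ j, ∑ i, ‖((hψ.pd i).pd j).toL2‖ ^ 2 = ‖hψ.lap.toL2‖ ^ 2 := by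
  have hB := hψ.conj
  have e : ∀ i j, ((‖((hψ.pd i).pd j).toL2‖ ^ 2 : ℝ) : ℂ)
      = ∫ x, pd i (pd i ψ) x * pd j (pd j fun y => (starRingEnd ℂ) (ψ y)) x := fun i j => by
    rw [IsTest.norm_toL2_sq]
    have h1 : ∀ x, (starRingEnd ℂ) (pd j (pd i ψ) x)
        = pd i (pd j fun y => (starRingEnd ℂ) (ψ y)) x := fun x => by
      rw [pd_comm hB.smooth, conj_pd_test hψ, conj_pd_test (hψ.pd i)]
    simp only [h1]
    rw [integral_mul_pd ((hψ.pd i).pd j).smooth (hB.pd j),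
      pd_comm (hψ.pd i).smooth i j, integral_mul_pd ((hψ.pd i).pd i).smooth (hB.pd j)]
  have : ((∑ j, ∑ i, ‖((hψ.pd i).pd j).toL2‖ ^ 2 : ℝ) : ℂ) = ((‖hψ.lap.toL2‖ ^ 2 : ℝ) : ℂ) := by
    rw [Complex.ofReal_sum, hψ.lap.norm_toL2_sq]
    simp only [Complex.ofReal_sum, e]
    have h2 : ∀ x, lap ψ x * (starRingEnd ℂ) (lap ψ x) = ∑ j, ∑ i, pd i (pd i ψ) x
        * pd j (pd j fun y => (starRingEnd ℂ) (ψ y)) x := fun x => by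
      have := congrFun (conj_lap_test hψ) x
      rw [← this]
      simp only [lap, Finset.sum_mul_sum]
      exact Finset.sum_comm
    have hi : ∀ i j, Integrable fun x => pd i (pd i ψ) x
        * pd j (pd j fun y => (starRingEnd ℂ) (ψ y)) x := fun i j =>
      (((hψ.pd i).pd i).mul_right ((hB.pd j).pd j).smooth).integrable
    simp only [h2]
    rw [integral_finsetSum _ fun j _ => integrable_finsetSum _ fun i _ => hi i j]
    refine Finset.sum_congr rfl fun j _ => ?_
    rw [integral_finsetSum _ fun i _ => hi i j]
  exact_mod_cast this

lemma norm_pd_pd_le {ψ : E d → ℂ} (hψ : IsTest ψ) (i j : Fin d) :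
    ‖((hψ.pd i).pd j).toL2‖ ≤ ‖hψ.lap.toL2‖ := by
  have h1 : ‖((hψ.pd i).pd j).toL2‖ ^ 2 ≤ ∑ i, ‖((hψ.pd i).pd j).toL2‖ ^ 2 :=
    Finset.single_le_sum (f := fun i => ‖((hψ.pd i).pd j).toL2‖ ^ 2) (fun i _ => by positivity)
      (Finset.mem_univ i)
  have h2 : ∑ i, ‖((hψ.pd i).pd j).toL2‖ ^ 2 ≤ ∑ j, ∑ i, ‖((hψ.pd i).pd j).toL2‖ ^ 2 :=
    Finset.single_le_sum (f := fun j => ∑ i, ‖((hψ.pd i).pd j).toL2‖ ^ 2)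
      (fun i _ => by positivity) (Finset.mem_univ j)
  rw [sum_norm_pd_pd_sq hψ] at h2
  exact abs_le_of_sq_le_sq' (h1.trans h2) (norm_nonneg _) |>.2

lemma exists_seq_isTest (h : Lp ℂ 2 (volume : Measure (E d))) :
    ∃ (η : ℕ → E d → ℂ) (hη : ∀ k, IsTest (η k)),
      Tendsto (fun k => (hη k).toL2) atTop (𝓝 h) := by
  obtain ⟨b, hb, hlim⟩ := mem_closure_iff_seq_limit.1
    (Lp.dense_hasCompactSupport_contDiff (F := ℂ) (μ := (volume : Measure (E d))) (p := 2)
      ENNReal.ofNat_ne_top h)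
  choose η h1 h2 h3 using hb
  refine ⟨η, fun k => ⟨h3 k, h2 k⟩, hlim.congr fun k => ?_⟩
  exact Lp.ext ((h1 k).trans (IsTest.coeFn_toL2 ⟨h3 k, h2 k⟩).symm)

/-- A difference-bounded map on test functions sends convergent sequences to convergent ones. -/
lemma exists_tendsto_toL2 {η A : ℕ → E d → ℂ} (hη : ∀ k, IsTest (η k)) (hA : ∀ k, IsTest (A k))
    {h : Lp ℂ 2 (volume : Measure (E d))} (hlim : Tendsto (fun k => (hη k).toL2) atTop (𝓝 h))
    {C : ℝ} (hC : ∀ k l, ‖(hA k).toL2 - (hA l).toL2‖ ≤ C * ‖(hη k).toL2 - (hη l).toL2‖) :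
    ∃ a, Tendsto (fun k => (hA k).toL2) atTop (𝓝 a) := by
  refine cauchySeq_tendsto_of_complete (Metric.cauchySeq_iff.2 fun ε hε => ?_)
  obtain ⟨N, hN⟩ := Metric.cauchySeq_iff.1 hlim.cauchySeq (ε / (|C| + 1)) (by positivity)
  refine ⟨N, fun m hm n hn => ?_⟩
  have h1 := hN m hm n hn
  rw [dist_eq_norm] at h1 ⊢
  rw [lt_div_iff₀ (by positivity)] at h1
  have h2 := hC m n
  have h3 : C * ‖(hη m).toL2 - (hη n).toL2‖ ≤ |C| * ‖(hη m).toL2 - (hη n).toL2‖ := by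
    gcongr; exact le_abs_self C
  nlinarith [norm_nonneg ((hη m).toL2 - (hη n).toL2)]

lemma tendsto_integral_mul_test {A : ℕ → E d → ℂ} (hA : ∀ k, IsTest (A k))
    {a : Lp ℂ 2 (volume : Measure (E d))} (hlim : Tendsto (fun k => (hA k).toL2) atTop (𝓝 a))
    {ψ : E d → ℂ} (hψ : IsTest ψ) :
    Tendsto (fun k => ∫ x, A k x * ψ x) atTop (𝓝 (∫ x, a x * ψ x)) := by
  have h1 := (tendsto_const_nhds (x := hψ.conj.toL2)).inner (𝕜 := ℂ) hlim
  simp only [IsTest.inner_toL2, Complex.conj_conj] at h1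
  refine h1.congr fun k => integral_congr_ae ?_
  filter_upwards [(hA k).coeFn_toL2] with x hx
  rw [hx]

lemma hasWeakPartial_of_forall {i : Fin d} {u v : E d → ℂ} (hu : LocallyIntegrable u)
    (hv : LocallyIntegrable v)
    (h : ∀ ψ, IsTest ψ → ∫ x, u x * pd i ψ x = -∫ x, v x * ψ x) : HasWeakPartial i u v := by
  refine ⟨hu, hv, fun φ hφ => ?_⟩
  have := h _ hφ.isTest
  have h1 : ∀ x, pd i (fun y => (φ y : ℂ)) x = (fderiv ℝ φ x (EuclideanSpace.single i 1) : ℂ) :=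
    fun x => pd_ofReal i ((hφ.1.differentiable (by simp)) x)
  simp only [h1] at this
  simp only [Complex.real_smul]
  simpa only [mul_comm] using this

lemma hasWeakPartial_of_tendsto {i : Fin d} {A : ℕ → E d → ℂ} (hA : ∀ k, IsTest (A k))
    {a g : Lp ℂ 2 (volume : Measure (E d))} (hlim : Tendsto (fun k => (hA k).toL2) atTop (𝓝 a))
    (hlim' : Tendsto (fun k => ((hA k).pd i).toL2) atTop (𝓝 g)) : HasWeakPartial i a g := by
  refine hasWeakPartial_of_forall ((Lp.memLp a).locallyIntegrable (by norm_num))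
    ((Lp.memLp g).locallyIntegrable (by norm_num)) fun ψ hψ => ?_
  refine tendsto_nhds_unique (tendsto_integral_mul_test hA hlim (hψ.pd i)) ?_
  refine (tendsto_integral_mul_test (fun k => (hA k).pd i) hlim' hψ).neg.congr fun k => ?_
  rw [integral_mul_pd (hA k).smooth hψ]

lemma hasWeakPartial_of_contDiff {W : E d → ℂ} (hW : ContDiff ℝ ∞ W) (i : Fin d) :
    HasWeakPartial i W (pd i W) :=
  hasWeakPartial_of_forall hW.continuous.locallyIntegrable
    (hW.pd i).continuous.locallyIntegrable fun _ hψ => integral_mul_pd hW hψ i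

lemma HasWeakPartial.add {i : Fin d} {u v u' v' : E d → ℂ} (h : HasWeakPartial i u v)
    (h' : HasWeakPartial i u' v') :
    HasWeakPartial i (fun x => u x + u' x) (fun x => v x + v' x) := by
  have hi : ∀ {f : E d → ℂ} {φ : E d → ℝ}, LocallyIntegrable f → Continuous φ →
      HasCompactSupport φ → Integrable fun x => φ x • f x := fun {f φ} hf h1 h2 =>
    hf.integrable_smul_left_of_hasCompactSupport h1 h2
  refine ⟨h.1.add h'.1, h.2.1.add h'.2.1, fun φ hφ => ?_⟩
  have c1 : Continuous fun x => fderiv ℝ φ x (EuclideanSpace.single i 1) :=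
    (hφ.1.continuous_fderiv (by simp)).clm_apply continuous_const
  have c2 : HasCompactSupport fun x => fderiv ℝ φ x (EuclideanSpace.single i 1) :=
    hφ.2.fderiv_apply (𝕜 := ℝ) _
  simp only [smul_add]
  rw [integral_add (hi h.1 c1 c2) (hi h'.1 c1 c2), integral_add (hi h.2.1 hφ.1.continuous hφ.2)
    (hi h'.2.1 hφ.1.continuous hφ.2), h.2.2 φ hφ, h'.2.2 φ hφ, neg_add]

lemma HasWeakPartial.congr_left {i : Fin d} {u u' v : E d → ℂ} (h : HasWeakPartial i u v)
    (hu : u =ᵐ[volume] u') : HasWeakPartial i u' v := by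
  refine ⟨locallyIntegrable_congr h.1 hu, h.2.1, fun φ hφ => ?_⟩
  rw [← h.2.2 φ hφ]
  refine integral_congr_ae ?_
  filter_upwards [hu] with x hx
  rw [hx]

lemma memL2Loc_of_memLp {u : E d → ℂ} (hu : MemLp u 2) : MemL2Loc u := fun _ _ => hu.restrict _

lemma memL2Loc_of_continuous {u : E d → ℂ} (hu : Continuous u) : MemL2Loc u := fun C hC => by
  have : IsFiniteMeasure (volume.restrict C) :=
    ⟨by rw [Measure.restrict_apply_univ]; exact hC.measure_lt_top⟩
  obtain ⟨M, hM⟩ := hC.exists_bound_of_continuousOn hu.continuousOn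
  exact MemLp.of_bound hu.aestronglyMeasurable M
    ((ae_restrict_iff' hC.measurableSet).2 (Eventually.of_forall hM))

lemma MemL2Loc.add {u v : E d → ℂ} (hu : MemL2Loc u) (hv : MemL2Loc v) :
    MemL2Loc fun x => u x + v x := fun C hC => (hu C hC).add (hv C hC)

lemma MemL2Loc.congr {u v : E d → ℂ} (hu : MemL2Loc u) (h : u =ᵐ[volume] v) : MemL2Loc v :=
  fun C hC => (memLp_congr_ae (ae_restrict_of_ae h)).1 (hu C hC)

lemma memH2Loc_of_contDiff {W : E d → ℂ} (hW : ContDiff ℝ ∞ W) : MemH2Loc W :=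
  ⟨memL2Loc_of_continuous hW.continuous, fun i => pd i W, fun i j => pd j (pd i W),
    fun i => ⟨memL2Loc_of_continuous (hW.pd i).continuous, hasWeakPartial_of_contDiff hW i⟩,
    fun i j => ⟨memL2Loc_of_continuous ((hW.pd i).pd j).continuous,
      hasWeakPartial_of_contDiff (hW.pd i) j⟩⟩

lemma MemH2Loc.add {u v : E d → ℂ} (hu : MemH2Loc u) (hv : MemH2Loc v) :
    MemH2Loc fun x => u x + v x := by
  obtain ⟨h0, g, h, hg, hh⟩ := hu
  obtain ⟨h0', g', h', hg', hh'⟩ := hv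
  exact ⟨h0.add h0', fun i x => g i x + g' i x, fun i j x => h i j x + h' i j x,
    fun i => ⟨(hg i).1.add (hg' i).1, (hg i).2.add (hg' i).2⟩,
    fun i j => ⟨(hh i j).1.add (hh' i j).1, (hh i j).2.add (hh' i j).2⟩⟩

lemma MemH2Loc.congr {u v : E d → ℂ} (hu : MemH2Loc u) (huv : u =ᵐ[volume] v) : MemH2Loc v := by
  obtain ⟨h0, g, h, hg, hh⟩ := hu
  exact ⟨h0.congr huv, g, h, fun i => ⟨(hg i).1, (hg i).2.congr_left huv⟩, hh⟩

lemma youngCLM_toL2 {k : E d → ℂ} (hk : Integrable k) {ψ : E d → ℂ} (hψ : IsTest ψ)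
    (hc : IsTest (cv k ψ)) : youngCLM k hk hψ.toL2 = hc.toL2 := by
  refine Lp.ext ((youngCLM_coeFn hk _).trans ?_)
  rw [cv_congr_ae hψ.coeFn_toL2]
  exact hc.coeFn_toL2.symm

/-- Convolution of a compactly supported parametrix with an `L²` function is in `H²`. -/
lemma memH2Loc_cv_parametrix {F ρ : E d → ℂ} (hP : IsParametrix F ρ) {h : E d → ℂ}
    (hh : MemLp h 2) : MemH2Loc (cv F h) := by
  obtain ⟨η, hη, hlim⟩ := exists_seq_isTest hh.toLp
  have hF := hP.integrable.locallyIntegrable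
  have hρ := hP.error.integrable
  set Y := youngCLM F hP.integrable
  set Z := youngCLM ρ hρ
  have hA : ∀ {ψ : E d → ℂ}, IsTest ψ → IsTest (cv F ψ) := fun hψ => isTest_cv hF hP.cpt hψ
  -- The parametrix property reads Δ(F * ψ) = ψ + ρ * ψ - F * ψ. Every term on the right is bounded
  -- in L² by Young's inequality, hence so are the first and second derivatives of F * ψ.
  have hlapA : ∀ {ψ : E d → ℂ} (hψ : IsTest ψ),
      (hA hψ).lap.toL2 = hψ.toL2 + Z hψ.toL2 - Y hψ.toL2 := fun {ψ} hψ => by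
    have hB := isTest_cv hρ.locallyIntegrable hP.error.cpt hψ
    rw [youngCLM_toL2 hP.integrable hψ (hA hψ), youngCLM_toL2 hρ hψ hB]
    refine Lp.ext ?_
    filter_upwards [(hA hψ).lap.coeFn_toL2, Lp.coeFn_sub (hψ.toL2 + hB.toL2) (hA hψ).toL2,
      Lp.coeFn_add hψ.toL2 hB.toL2, hψ.coeFn_toL2, hB.coeFn_toL2, (hA hψ).coeFn_toL2]
      with x e1 e2 e3 e4 e5 e6
    rw [e1, e2, Pi.sub_apply, e3, Pi.add_apply, e4, e5, e6, ← hP.cv_eq ψ hψ x,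
      cv_add_test hF hψ.lap hψ, lap_cv hF hψ]
    ring
  have hsub : ∀ {ψ φ : E d → ℂ}, IsTest ψ → IsTest φ →
      cv F (fun x => ψ x - φ x) = fun x => cv F ψ x - cv F φ x := fun {ψ φ} hψ hφ => by
    ext x
    simp only [cv, mul_sub]
    exact integral_sub (integrable_cv_test hF hψ x) (integrable_cv_test hF hφ x)
  set C : ℝ := 1 + ‖Z‖ + ‖Y‖
  have hl : ∀ {ψ : E d → ℂ} (hψ : IsTest ψ), ‖(hA hψ).lap.toL2‖ ≤ C * ‖hψ.toL2‖ := fun hψ => by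
    rw [hlapA hψ]
    have h1 := norm_sub_le (hψ.toL2 + Z hψ.toL2) (Y hψ.toL2)
    have h2 := norm_add_le hψ.toL2 (Z hψ.toL2)
    have h3 := Z.le_opNorm hψ.toL2
    have h4 := Y.le_opNorm hψ.toL2
    simp only [C]
    linarith
  have hl0 : ∀ {ψ : E d → ℂ} (hψ : IsTest ψ), ‖(hA hψ).toL2‖ ≤ ‖Y‖ * ‖hψ.toL2‖ := fun hψ => by
    rw [← youngCLM_toL2 hP.integrable hψ (hA hψ)]
    exact Y.le_opNorm _
  have hlim0 : Tendsto (fun k => (hA (hη k)).toL2) atTop (𝓝 (Y hh.toLp)) := by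
    refine ((Y.continuous.tendsto _).comp hlim).congr fun k => ?_
    exact youngCLM_toL2 hP.integrable (hη k) (hA (hη k))
  -- By linearity the bounds apply to η k - η l, so the derivatives of F * η k are Cauchy in L²
  -- along with η k.
  have hex1 : ∀ i, ∃ a, Tendsto (fun k => ((hA (hη k)).pd i).toL2) atTop (𝓝 a) := fun i => by
    refine exists_tendsto_toL2 hη (fun k => (hA (hη k)).pd i) hlim (C := ‖Y‖ + C) fun k l => ?_
    have h1 := norm_pd_le (hA ((hη k).sub (hη l))) i
    have h2 : ((hA ((hη k).sub (hη l))).pd i).toL2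
        = ((hA (hη k)).pd i).toL2 - ((hA (hη l)).pd i).toL2 := by
      rw [← IsTest.toL2_sub]
      congr 1
      rw [hsub (hη k) (hη l)]
      ext x
      exact pd_sub i ((hA (hη k)).smooth.diffAt x) ((hA (hη l)).smooth.diffAt x)
    rw [h2] at h1
    rw [← IsTest.toL2_sub (hη k) (hη l)]
    have h3 := hl ((hη k).sub (hη l))
    have h4 := hl0 ((hη k).sub (hη l))
    linarith
  have hex2 : ∀ i j, ∃ a, Tendsto (fun k => (((hA (hη k)).pd i).pd j).toL2) atTop (𝓝 a) :=
      fun i j => by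
    refine exists_tendsto_toL2 hη (fun k => ((hA (hη k)).pd i).pd j) hlim (C := C) fun k l => ?_
    have h1 := norm_pd_pd_le (hA ((hη k).sub (hη l))) i j
    have h2 : (((hA ((hη k).sub (hη l))).pd i).pd j).toL2
        = (((hA (hη k)).pd i).pd j).toL2 - (((hA (hη l)).pd i).pd j).toL2 := by
      rw [← IsTest.toL2_sub]
      congr 1
      rw [hsub (hη k) (hη l)]
      have h3 : pd i (fun x => cv F (η k) x - cv F (η l) x)
          = fun x => pd i (cv F (η k)) x - pd i (cv F (η l)) x := funext fun x =>
        pd_sub i ((hA (hη k)).smooth.diffAt x) ((hA (hη l)).smooth.diffAt x)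
      rw [h3]
      ext x
      exact pd_sub j (((hA (hη k)).pd i).smooth.diffAt x) (((hA (hη l)).pd i).smooth.diffAt x)
    rw [h2] at h1
    rw [← IsTest.toL2_sub (hη k) (hη l)]
    exact h1.trans (hl ((hη k).sub (hη l)))
  choose g hg using hex1
  choose g' hg' using hex2
  have hY : (Y hh.toLp : E d → ℂ) =ᵐ[volume] cv F h := by
    refine (youngCLM_coeFn hP.integrable _).trans ?_
    rw [cv_congr_ae hh.coeFn_toLp]
  refine MemH2Loc.congr (u := Y hh.toLp) ⟨memL2Loc_of_memLp (Lp.memLp _), fun i => g i,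
    fun i j => g' i j, fun i => ⟨memL2Loc_of_memLp (Lp.memLp _), ?_⟩,
    fun i j => ⟨memL2Loc_of_memLp (Lp.memLp _), ?_⟩⟩ hY
  · exact hasWeakPartial_of_tendsto (fun k => hA (hη k)) hlim0 (hg i)
  · exact hasWeakPartial_of_tendsto (fun k => (hA (hη k)).pd i) (hg i) (hg' i j)

theorem memH2Loc_cv_freeGreen (hd : 1 ≤ d) {h : E d → ℂ} {R : ℝ} (hh : MemLp h 2)
    (hR : ∀ y, R < ‖y‖ → h y = 0) : MemH2Loc (cv (freeGreen d) h) :=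
  ((memH2Loc_cv_parametrix (isParametrix_singularGreen hd) hh).add
    (memH2Loc_of_contDiff (contDiff_cv_smooth (contDiff_regularGreen hd)
      (integrable_of_memLp_two_of_norm hh hR) hR))).congr (cv_freeGreen_ae_eq hd hh hR).symm

end SecondOrder

/-! ### The potential satisfies the radiation condition -/

section Radiation

variable {d : ℕ}

lemma fderiv_apply_eq_sum (f : E d → ℂ) (x v : E d) :
    fderiv ℝ f x v = ∑ i, (v i : ℂ) * pd i f x := by
  have h1 : v = ∑ i, v i • EuclideanSpace.single i (1 : ℝ) := by
    have := (EuclideanSpace.basisFun (Fin d) ℝ).sum_repr v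
    simpa using this.symm
  conv_lhs => rw [h1]
  rw [map_sum]
  refine Finset.sum_congr rfl fun i _ => ?_
  rw [map_smul, Complex.real_smul, pd]

lemma pd_regularGreen (hd : 1 ≤ d) {z : E d} (hz : 2 < ‖z‖) (i : Fin d) :
    pd i (regularGreen d) z = deriv (greenRadial d) ‖z‖ * ((z i / ‖z‖ : ℝ) : ℂ) := by
  have hz0 : 0 < ‖z‖ := by linarith
  rw [← pd_radial (norm_pos_iff.1 hz0)
    ((isOutgoingProfile_greenRadial hd).smooth.hasDerivAt_Ioi hz0) i]
  refine pd_congr i ?_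
  filter_upwards [(continuous_norm.isOpen_preimage _ isOpen_Ioi).mem_nhds (show z ∈ _ from hz)]
    with y hy
  rw [regularGreen_eq (le_of_lt hy), freeGreen_eq]

/-- With z = x - y, the law of cosines reads |y|² = (|x| - |z|)² + 2(|x||z| - ⟨x, z⟩), which bounds
1 - cos by |y|² / (2|x||z|). -/
lemma abs_cos_sub_one_le {x y : E d} (hx : x ≠ 0) (hz : x - y ≠ 0) :
    |inner ℝ x (x - y) / (‖x‖ * ‖x - y‖)| ≤ 1 ∧
      |inner ℝ x (x - y) / (‖x‖ * ‖x - y‖) - 1| ≤ ‖y‖ ^ 2 / (2 * (‖x‖ * ‖x - y‖)) := by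
  have h1 : 0 < ‖x‖ * ‖x - y‖ := mul_pos (norm_pos_iff.2 hx) (norm_pos_iff.2 hz)
  refine ⟨abs_real_inner_div_norm_mul_norm_le_one _ _, ?_⟩
  have h2 := norm_sub_sq_real x (x - y)
  rw [sub_sub_cancel] at h2
  have h3 := real_inner_le_norm x (x - y)
  rw [div_sub_one h1.ne', abs_div, abs_of_pos h1, abs_of_nonpos (by linarith),
    div_le_div_iff₀ h1 (by positivity)]
  nlinarith [sq_nonneg (‖x‖ - ‖x - y‖)]

/-- With g the radial profile and c the cosine between x and z = x - y, the quantity is c(g' - ig) +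
i(c - 1)g at |z|. The first term is small by the outgoing decay of g, the second because x and z
become parallel. -/
lemma exists_outgoing_bound (hd : 1 ≤ d) {R : ℝ} (hR : 0 ≤ R) :
    ∃ K : ℝ, 0 ≤ K ∧ ∀ x y : E d, 2 * R + 4 < ‖x‖ → ‖y‖ ≤ R →
      ‖x‖ ^ (((d : ℝ) - 1) / 2) * ‖∑ i, ((‖x‖⁻¹ • x) i : ℂ) * pd i (regularGreen d) (x - y)
        - Complex.I * regularGreen d (x - y)‖ ≤ K / ‖x‖ := by
  obtain ⟨C, hC⟩ := (isOutgoingProfile_greenRadial hd).decay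
  have hC0 : 0 ≤ C := by
    have := (hC 1 le_rfl).1
    rw [Real.one_rpow, mul_one] at this
    exact (norm_nonneg _).trans this
  set p : ℝ := ((d : ℝ) - 1) / 2 with hp
  have hp0 : 0 ≤ p := by
    have : (1 : ℝ) ≤ d := by exact_mod_cast hd
    rw [hp]; linarith
  have hp1 : ((d : ℝ) + 1) / 2 = p + 1 := by rw [hp]; ring
  -- The factor 2^p comes from |z| ≥ |x|/2, the 2 from 1/|z| ≤ 2/|x|, and R² from |c - 1| ≤ R²/|x|.
  refine ⟨C * 2 ^ p * (2 + R ^ 2), by positivity, fun x y hx hy => ?_⟩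
  set z := x - y with hz
  have hx0 : 0 < ‖x‖ := by linarith
  have hzx : ‖x‖ / 2 ≤ ‖z‖ := by
    have := norm_sub_norm_le x y
    rw [← hz] at this
    linarith
  have hz2 : 2 < ‖z‖ := by linarith
  have hz0 : 0 < ‖z‖ := by linarith
  obtain ⟨h1, h2⟩ := abs_cos_sub_one_le (norm_pos_iff.1 hx0) (y := y) (norm_pos_iff.1 hz0)
  rw [← hz] at h1 h2
  set c : ℝ := inner ℝ x z / (‖x‖ * ‖z‖) with hc
  have e1 : ∑ i, ((‖x‖⁻¹ • x) i : ℂ) * pd i (regularGreen d) z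
      = deriv (greenRadial d) ‖z‖ * (c : ℂ) := by
    simp only [pd_regularGreen hd hz2]
    have : c = ∑ i, (‖x‖⁻¹ • x) i * (z i / ‖z‖) := by
      rw [hc, PiLp.inner_apply, Finset.sum_div]
      refine Finset.sum_congr rfl fun i _ => ?_
      simp
      field_simp
    rw [this]
    push_cast
    rw [Finset.mul_sum]
    exact Finset.sum_congr rfl fun i _ => by ring
  have e2 : deriv (greenRadial d) ‖z‖ * (c : ℂ) - Complex.I * greenRadial d ‖z‖
      = (c : ℂ) * (deriv (greenRadial d) ‖z‖ - Complex.I * greenRadial d ‖z‖)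
        + Complex.I * (((c - 1 : ℝ) : ℂ) * greenRadial d ‖z‖) := by
    push_cast; ring
  rw [e1, regularGreen_eq hz2.le, freeGreen_eq, e2]
  obtain ⟨b1, b2⟩ := hC ‖z‖ (by linarith)
  rw [hp1, ← hp] at *
  have hzp : ‖z‖ ^ (-p) ≤ 2 ^ p * ‖x‖ ^ (-p) := by
    calc ‖z‖ ^ (-p) ≤ (‖x‖ / 2) ^ (-p) :=
          Real.rpow_le_rpow_of_nonpos (by positivity) hzx (by linarith)
      _ = 2 ^ p * ‖x‖ ^ (-p) := by
          rw [Real.div_rpow hx0.le two_pos.le, Real.rpow_neg two_pos.le,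
            div_inv_eq_mul, mul_comm]
  have hzp1 : ‖z‖ ^ (-(p + 1)) ≤ 2 ^ p * ‖x‖ ^ (-p) * (2 / ‖x‖) := by
    rw [neg_add, Real.rpow_add hz0, Real.rpow_neg_one]
    refine mul_le_mul hzp ?_ (by positivity) (by positivity)
    rw [inv_eq_one_div, div_le_div_iff₀ hz0 hx0]
    linarith
  have hcb : |c - 1| ≤ R ^ 2 / ‖x‖ := by
    refine h2.trans ?_
    rw [div_le_div_iff₀ (by positivity) hx0]
    have : ‖y‖ ^ 2 ≤ R ^ 2 := by gcongr
    have h4 : ‖x‖ ≤ 2 * (‖x‖ * ‖z‖) := by nlinarith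
    exact mul_le_mul this h4 hx0.le (by positivity)
  have b3 : ‖(c : ℂ) * (deriv (greenRadial d) ‖z‖ - Complex.I * greenRadial d ‖z‖)
        + Complex.I * (((c - 1 : ℝ) : ℂ) * greenRadial d ‖z‖)‖
      ≤ C * (2 ^ p * ‖x‖ ^ (-p) * (2 / ‖x‖)) + R ^ 2 / ‖x‖ * (C * (2 ^ p * ‖x‖ ^ (-p))) := by
    refine (norm_add_le _ _).trans (add_le_add ?_ ?_)
    · rw [norm_mul, Complex.norm_real, Real.norm_eq_abs]
      refine (mul_le_of_le_one_left (norm_nonneg _) h1).trans (b2.trans ?_)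
      gcongr
    · rw [norm_mul, Complex.norm_I, one_mul, norm_mul, Complex.norm_real, Real.norm_eq_abs]
      refine mul_le_mul hcb (b1.trans ?_) (norm_nonneg _) (by positivity)
      gcongr
  have hxp : ‖x‖ ^ p * ‖x‖ ^ (-p) = 1 := by
    rw [← Real.rpow_add hx0, add_neg_cancel, Real.rpow_zero]
  calc _ ≤ ‖x‖ ^ p * (C * (2 ^ p * ‖x‖ ^ (-p) * (2 / ‖x‖))
        + R ^ 2 / ‖x‖ * (C * (2 ^ p * ‖x‖ ^ (-p)))) := by gcongr
    _ = (‖x‖ ^ p * ‖x‖ ^ (-p)) * (C * 2 ^ p * (2 + R ^ 2) / ‖x‖) := by ring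
    _ = _ := by rw [hxp, one_mul]

lemma tendsto_norm_cobounded : Tendsto (fun x : E d => ‖x‖) (Bornology.cobounded (E d)) atTop :=
  tendsto_norm_cobounded_atTop

lemma cv_freeGreen_eq_regular {h : E d → ℂ} {R : ℝ} (hR : ∀ y, R < ‖y‖ → h y = 0) {x : E d}
    (hx : R + 2 < ‖x‖) : cv (freeGreen d) h x = cv (regularGreen d) h x := by
  refine integral_congr_ae (Eventually.of_forall fun y => ?_)
  by_cases hy : R < ‖y‖
  · simp [hR y hy]
  · have : 2 ≤ ‖x - y‖ := by
      have := norm_sub_norm_le x y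
      linarith [not_lt.1 hy]
    simp only [regularGreen_eq this]

lemma cv_freeGreen_eventuallyEq_regular {h : E d → ℂ} {R : ℝ} (hR : ∀ y, R < ‖y‖ → h y = 0)
    {x : E d} (hx : R + 2 < ‖x‖) : cv (freeGreen d) h =ᶠ[𝓝 x] cv (regularGreen d) h := by
  filter_upwards [(continuous_norm.isOpen_preimage _ isOpen_Ioi).mem_nhds (show x ∈ _ from hx)]
    with y hy using cv_freeGreen_eq_regular hR hy

theorem sommerfeldRadiation_cv_freeGreen (hd : 1 ≤ d) {h : E d → ℂ} {R : ℝ} (hR0 : 0 ≤ R)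
    (hh : Integrable h) (hR : ∀ y, R < ‖y‖ → h y = 0) :
    SommerfeldRadiation (cv (freeGreen d) h) := by
  have hS := contDiff_regularGreen hd
  obtain ⟨K, hK0, hK⟩ := exists_outgoing_bound hd hR0
  have hev : ∀ᶠ x in Bornology.cobounded (E d), 2 * R + 4 < ‖x‖ :=
    tendsto_norm_cobounded.eventually (eventually_gt_atTop _)
  constructor
  · filter_upwards [hev] with x hx
    exact ((contDiff_cv_smooth hS hh hR).diffAt x).congr_of_eventuallyEq
      (cv_freeGreen_eventuallyEq_regular hR (by linarith))
  · refine squeeze_zero_norm' (a := fun x => (K * ∫ y, ‖h y‖) / ‖x‖) ?_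
      (tendsto_const_nhds.div_atTop tendsto_norm_cobounded)
    filter_upwards [hev] with x hx
    have hx2 : R + 2 < ‖x‖ := by linarith
    rw [(cv_freeGreen_eventuallyEq_regular hR hx2).fderiv_eq, cv_freeGreen_eq_regular hR hx2,
      fderiv_apply_eq_sum]
    simp only [pd_cv_smooth hS hh hR]
    have hi := integrable_cv_smooth hS hh hR x
    have hi' := fun i => integrable_cv_smooth (hS.pd i) hh hR x
    have e1 : ∑ i, ((‖x‖⁻¹ • x) i : ℂ) * cv (pd i (regularGreen d)) h x
        - Complex.I * cv (regularGreen d) h x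
        = ∫ y, (∑ i, ((‖x‖⁻¹ • x) i : ℂ) * pd i (regularGreen d) (x - y)
          - Complex.I * regularGreen d (x - y)) * h y := by
      simp only [cv, ← integral_const_mul]
      rw [← integral_finsetSum _ fun i _ => (hi' i).const_mul _,
        ← integral_sub (integrable_finsetSum _ fun i _ => (hi' i).const_mul _) (hi.const_mul _)]
      refine integral_congr_ae (Eventually.of_forall fun y => ?_)
      simp only [sub_mul, Finset.sum_mul, mul_assoc]
    rw [e1, norm_mul, Complex.norm_real, Real.norm_of_nonneg (by positivity)]
    have e2 : ‖∫ y, (∑ i, ((‖x‖⁻¹ • x) i : ℂ) * pd i (regularGreen d) (x - y)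
          - Complex.I * regularGreen d (x - y)) * h y‖
        ≤ ∫ y, (K / ‖x‖ * (‖x‖ ^ (((d : ℝ) - 1) / 2))⁻¹) * ‖h y‖ := by
      refine norm_integral_le_of_norm_le (hh.norm.const_mul _) (Eventually.of_forall fun y => ?_)
      by_cases hy : h y = 0
      · simp [hy]
      · have hy' : ‖y‖ ≤ R := by
          by_contra hlt
          exact hy (hR y (not_le.1 hlt))
        rw [norm_mul]
        refine mul_le_mul_of_nonneg_right ?_ (norm_nonneg _)
        rw [← div_eq_mul_inv, le_div_iff₀ (Real.rpow_pos_of_pos (by linarith) _), mul_comm]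
        exact hK x y hx hy'
    rw [integral_const_mul] at e2
    have hpos : 0 < ‖x‖ ^ (((d : ℝ) - 1) / 2) := Real.rpow_pos_of_pos (by linarith) _
    calc _ ≤ ‖x‖ ^ (((d : ℝ) - 1) / 2) * _ := mul_le_mul_of_nonneg_left e2 hpos.le
      _ = _ := by field_simp

end Radiation

/-! ### Shell cutoffs and the energy identity -/

/-- A radial cutoff `θ`, equal to `κ` on `[0, 1]` and to `0` on `[2, ∞)`, with `θ' = -β²`. -/
structure IsShellCutoff (β θ : ℝ → ℝ) (κ M : ℝ) : Prop where
  smooth_bump : ContDiff ℝ ∞ β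
  smooth : ContDiff ℝ ∞ θ
  deriv_eq : ∀ r, HasDerivAt θ (-β r ^ 2) r
  bump_eq_zero : ∀ r, r ≤ 1 ∨ 2 ≤ r → β r = 0
  bump_le : ∀ r, |β r| ≤ 1
  deriv_bump_le : ∀ r, |deriv β r| ≤ M
  pos : 0 < κ
  eq_const : ∀ r, r ≤ 1 → θ r = κ
  eq_zero : ∀ r, 2 ≤ r → θ r = 0

/-- Take a bump β on (1, 2) and θ(r) = ∫ᵣ² β². Since θ' = -β² and θ'' = -2ββ' both contain β, the
commutator of Δ with θ is bounded by |β| and can be paired by Cauchy–Schwarz with an energy of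
weight β². -/
lemma exists_isShellCutoff : ∃ β θ κ M, IsShellCutoff β θ κ M := by
  let b : ContDiffBump (3 / 2 : ℝ) := ⟨1 / 4, 1 / 2, by norm_num, by norm_num⟩
  have hb : ContDiff ℝ ∞ b := b.contDiff
  have hc : Continuous fun s => b s ^ 2 := hb.continuous.pow 2
  have hb0 : ∀ r, r ≤ 1 ∨ 2 ≤ r → b r = 0 := fun r hr => by
    refine b.zero_of_le_dist ?_
    change (1 / 2 : ℝ) ≤ _
    rw [Real.dist_eq, le_abs]
    rcases hr with h | h
    · right; linarith
    · left; linarith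
  obtain ⟨M, hM⟩ := (b.hasCompactSupport.deriv).exists_bound_of_continuous
    (hb.continuous_deriv (by simp))
  have hder : ∀ r, HasDerivAt (fun r => ∫ s in r..2, b s ^ 2) (-b r ^ 2) r := fun r =>
    intervalIntegral.integral_hasDerivAt_left (hc.intervalIntegrable _ _)
      (hc.stronglyMeasurableAtFilter _ _) hc.continuousAt
  refine ⟨b, fun r => ∫ s in r..2, b s ^ 2, ∫ s in (1 : ℝ)..2, b s ^ 2, M, hb, ?_, hder, hb0,
    fun r => ?_, hM, ?_, fun r hr => ?_, fun r hr => ?_⟩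
  · refine contDiff_infty_iff_deriv.2 ⟨fun r => (hder r).differentiableAt, ?_⟩
    rw [show deriv (fun r => ∫ s in r..2, b s ^ 2) = fun r => -b r ^ 2 from
      funext fun r => (hder r).deriv]
    exact (hb.pow 2).neg
  · rw [abs_of_nonneg b.nonneg]; exact b.le_one
  · refine intervalIntegral.intervalIntegral_pos_of_pos_on (hc.intervalIntegrable _ _)
      (fun x hx => ?_) (by norm_num)
    have : 0 < b x := b.pos_of_mem_ball (by
      rw [Metric.mem_ball, Real.dist_eq, abs_lt]
      change -(1 / 2 : ℝ) < _ ∧ _ < (1 / 2 : ℝ)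
      constructor <;> linarith [hx.1, hx.2])
    positivity
  · rw [← intervalIntegral.integral_add_adjacent_intervals (hc.intervalIntegrable r 1)
      (hc.intervalIntegrable 1 2)]
    rw [intervalIntegral.integral_congr (g := fun _ => (0 : ℝ)) fun s hs => ?_]
    · simp
    · rw [Set.uIcc_of_le hr] at hs
      simp [hb0 s (Or.inl hs.2)]
  · rw [intervalIntegral.integral_congr (g := fun _ => (0 : ℝ)) fun s hs => ?_]
    · simp
    · rw [Set.uIcc_of_ge hr] at hs
      simp [hb0 s (Or.inr hs.1)]

section Shell

variable {d : ℕ} {β θ : ℝ → ℝ} {κ M R : ℝ} {W : E d → ℂ}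

/-- The radial derivative. -/
noncomputable def radialDeriv (W : E d → ℂ) (x : E d) : ℂ := fderiv ℝ W x (‖x‖⁻¹ • x)

lemma radialDeriv_eq_sum (W : E d → ℂ) (x : E d) :
    radialDeriv W x = ∑ i, ((x i / ‖x‖ : ℝ) : ℂ) * pd i W x := by
  rw [radialDeriv, fderiv_apply_eq_sum]
  refine Finset.sum_congr rfl fun i _ => ?_
  simp [div_eq_inv_mul]

lemma measurable_radialDeriv (hW : ContDiff ℝ ∞ W) : Measurable (radialDeriv W) := by
  rw [show radialDeriv W = fun x => _ from funext (radialDeriv_eq_sum W)]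
  refine Finset.measurable_fun_sum _ fun i _ => ?_
  refine Measurable.mul ?_ (hW.pd i).continuous.measurable
  exact Complex.measurable_ofReal.comp
    (((EuclideanSpace.proj i : E d →L[ℝ] ℝ).continuous.measurable).div measurable_norm)

lemma norm_radialDeriv_le (W : E d → ℂ) (x : E d) : ‖radialDeriv W x‖ ≤ ∑ i, ‖pd i W x‖ := by
  rw [radialDeriv_eq_sum]
  refine norm_sum_le_of_le _ fun i _ => ?_
  rw [norm_mul, Complex.norm_real, norm_div, norm_norm]
  exact mul_le_of_le_one_left (norm_nonneg _)
    (div_le_one_of_le₀ (PiLp.norm_apply_le x i) (norm_nonneg _))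

namespace IsShellCutoff

lemma contDiff_scaled (hβ : IsShellCutoff β θ κ M) (R : ℝ) :
    ContDiff ℝ ∞ fun r : ℝ => (θ (r / R) : ℂ) :=
  Complex.ofRealCLM.contDiff.comp (hβ.smooth.comp (contDiff_id.div_const R))

lemma isTest (hβ : IsShellCutoff β θ κ M) (hR : 0 < R) :
    IsTest fun x : E d => (θ (‖x‖ / R) : ℂ) := by
  refine ⟨contDiff_radial (f := fun r => (θ (r / R) : ℂ)) (c := κ)
    (hβ.contDiff_scaled R).contDiffOn hR fun r hr => ?_, ?_⟩
  · rw [hβ.eq_const _ ((div_le_one hR).2 hr.le)]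
  · refine HasCompactSupport.of_support_subset_isCompact (isCompact_closedBall 0 (2 * R))
      fun z hz => ?_
    by_contra h
    apply hz
    have h1 : 2 * R < ‖z‖ := by simpa using h
    simp only
    rw [hβ.eq_zero _ ((le_div_iff₀ hR).2 h1.le), Complex.ofReal_zero]

lemma hasDerivAt_scaled (hβ : IsShellCutoff β θ κ M) (R r : ℝ) :
    HasDerivAt (fun r : ℝ => (θ (r / R) : ℂ)) ((-(β (r / R) ^ 2 / R) : ℝ) : ℂ) r := by
  have h1 : HasDerivAt (fun r : ℝ => θ (r / R)) (-β (r / R) ^ 2 * (1 / R)) r :=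
    (hβ.deriv_eq (r / R)).comp r ((hasDerivAt_id r).div_const R)
  refine h1.ofReal_comp.congr_deriv ?_
  congr 1; ring

lemma hasDerivAt_scaled_two (hβ : IsShellCutoff β θ κ M) (R r : ℝ) :
    HasDerivAt (deriv fun r : ℝ => (θ (r / R) : ℂ))
      ((-(2 * β (r / R) * deriv β (r / R) / R ^ 2) : ℝ) : ℂ) r := by
  rw [show deriv (fun r : ℝ => (θ (r / R) : ℂ)) = fun r => ((-(β (r / R) ^ 2 / R) : ℝ) : ℂ) from
    funext fun r => (hβ.hasDerivAt_scaled R r).deriv]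
  have h1 : HasDerivAt (fun r : ℝ => β (r / R)) (deriv β (r / R) * (1 / R)) r :=
    ((hβ.smooth_bump.differentiable (by simp)) (r / R)).hasDerivAt.comp r
      ((hasDerivAt_id r).div_const R)
  refine (((h1.pow 2).div_const R).neg).ofReal_comp.congr_deriv ?_
  congr 1
  simp
  ring

lemma pd_eq (hβ : IsShellCutoff β θ κ M) {x : E d} (hx : x ≠ 0) (i : Fin d) :
    pd i (fun x : E d => (θ (‖x‖ / R) : ℂ)) x
      = -((β (‖x‖ / R) ^ 2 / R : ℝ) : ℂ) * ((x i / ‖x‖ : ℝ) : ℂ) := by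
  rw [pd_radial (f := fun r => (θ (r / R) : ℂ)) hx (hβ.hasDerivAt_scaled R ‖x‖) i,
    Complex.ofReal_neg]

lemma sum_pd_mul_pd (hβ : IsShellCutoff β θ κ M) {x : E d} (hx : x ≠ 0) (W : E d → ℂ) :
    ∑ i, pd i (fun x : E d => (θ (‖x‖ / R) : ℂ)) x * pd i W x
      = -((β (‖x‖ / R) ^ 2 / R : ℝ) : ℂ) * radialDeriv W x := by
  simp only [hβ.pd_eq hx, radialDeriv_eq_sum, Finset.mul_sum, mul_assoc]

lemma lap_eq (hβ : IsShellCutoff β θ κ M) {x : E d} (hx : x ≠ 0) :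
    lap (fun x : E d => (θ (‖x‖ / R) : ℂ)) x
      = ((-(2 * β (‖x‖ / R) * deriv β (‖x‖ / R) / R ^ 2)
        - ((d : ℝ) - 1) / ‖x‖ * (β (‖x‖ / R) ^ 2 / R) : ℝ) : ℂ) := by
  have h := lap_radial (d := d) (f := fun r => (θ (r / R) : ℂ))
    (hβ.contDiff_scaled R).contDiffOn hx
  rw [radOp, (hβ.hasDerivAt_scaled_two R ‖x‖).deriv, (hβ.hasDerivAt_scaled R ‖x‖).deriv] at h
  have h2 := add_right_cancel h
  rw [h2]
  push_cast
  ring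

lemma support_le (hβ : IsShellCutoff β θ κ M) (hR : 0 < R) {r : ℝ} (h : β (r / R) ≠ 0) :
    R ≤ r ∧ r ≤ 2 * R := by
  constructor
  · by_contra hlt
    exact h (hβ.bump_eq_zero _ (Or.inl ((div_le_one hR).2 (not_le.1 hlt).le)))
  · by_contra hlt
    exact h (hβ.bump_eq_zero _ (Or.inr ((le_div_iff₀ hR).2 (not_le.1 hlt).le)))

lemma bump_sq_le (hβ : IsShellCutoff β θ κ M) (r : ℝ) : β r ^ 2 ≤ 1 := by
  have := hβ.bump_le r
  rw [← sq_abs]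
  exact pow_le_one₀ (abs_nonneg _) this

/-- The weight `β(|x| / R)² / R`, as a function of `x`, times a function bounded by a continuous
function is integrable. -/
lemma integrable_weight_mul (hβ : IsShellCutoff β θ κ M) (hR : 0 < R) {f g : E d → ℝ}
    (hf : Measurable f) (hg : Continuous g) (hfg : ∀ x, |f x| ≤ g x) :
    Integrable fun x : E d => β (‖x‖ / R) ^ 2 / R * f x := by
  have hc : Continuous fun x : E d => β (‖x‖ / R) ^ 2 / R :=
    ((hβ.smooth_bump.continuous.comp (continuous_norm.div_const R)).pow 2).div_const R
  have hs : HasCompactSupport fun x : E d => β (‖x‖ / R) ^ 2 / R := by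
    refine HasCompactSupport.of_support_subset_isCompact (isCompact_closedBall 0 (2 * R))
      fun z hz => ?_
    by_contra h
    apply hz
    have h1 : 2 * R < ‖z‖ := by simpa using h
    simp only
    rw [hβ.bump_eq_zero _ (Or.inr ((le_div_iff₀ hR).2 h1.le))]
    simp
  have h1 : Integrable fun x : E d => β (‖x‖ / R) ^ 2 / R * g x :=
    (hc.mul hg).integrable_of_hasCompactSupport hs.mul_right
  refine h1.mono' ((hc.measurable.mul hf).aestronglyMeasurable) (Eventually.of_forall fun x => ?_)
  have h2 : 0 ≤ β (‖x‖ / R) ^ 2 / R := by positivity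
  rw [norm_mul, Real.norm_of_nonneg h2, Real.norm_eq_abs]
  exact mul_le_mul_of_nonneg_left (hfg x) h2

end IsShellCutoff

/-- The flux of a solution of the Helmholtz equation through spheres is real. -/
lemma im_integral_flux (hW : ContDiff ℝ ∞ W) (hH : ∀ x, lap W x + W x = 0) {φ : E d → ℝ}
    (hφ : IsTest fun x => (φ x : ℂ)) :
    (∫ x, (∑ i, pd i (fun x => (φ x : ℂ)) x * pd i W x) * (starRingEnd ℂ) (W x)).im = 0 := by
  set Θ : E d → ℂ := fun x => (φ x : ℂ) with hΘ
  have hWc : ContDiff ℝ ∞ fun x => (starRingEnd ℂ) (W x) := Complex.conjCLE.contDiff.comp hW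
  -- Testing the equation with φ times the conjugate of W leaves, besides the flux, only integrals
  -- of φ|∇W|² and φ|W|², which are real.
  have hψ : IsTest fun x => Θ x * (starRingEnd ℂ) (W x) := hφ.mul_right hWc
  have h1 := integral_mul_lap_eq_neg_sum hW hψ
  rw [integral_mul_lap hW hψ] at h1
  have h2 : ∀ x, lap W x * (Θ x * (starRingEnd ℂ) (W x)) = ((-(φ x * ‖W x‖ ^ 2) : ℝ) : ℂ) := by
    intro x
    rw [eq_neg_of_add_eq_zero_left (hH x)]
    have := Complex.mul_conj' (W x)
    push_cast
    rw [← this]; ring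
  have h3 : ∀ i x, pd i W x * pd i (fun x => Θ x * (starRingEnd ℂ) (W x)) x
      = ((φ x * ‖pd i W x‖ ^ 2 : ℝ) : ℂ) + pd i Θ x * pd i W x * (starRingEnd ℂ) (W x) := by
    intro i x
    rw [pd_mul i (hφ.smooth.diffAt x) (hWc.diffAt x), pd_conj i (hW.diffAt x)]
    have := Complex.mul_conj' (pd i W x)
    push_cast
    rw [← this]; ring
  have hi1 : ∀ i, Integrable fun x => ((φ x * ‖pd i W x‖ ^ 2 : ℝ) : ℂ) := fun i => by
    have : Integrable fun x => ((pd i W x) * (starRingEnd ℂ) (pd i W x)) * Θ x :=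
      ((hW.pd i).mul (Complex.conjCLE.contDiff.comp (hW.pd i))).continuous.locallyIntegrable
        |>.integrable_mul_test hφ
    refine this.congr (Eventually.of_forall fun x => ?_)
    simp only [hΘ, Complex.mul_conj']
    push_cast; ring
  have hi2 : ∀ i, Integrable fun x => pd i Θ x * pd i W x * (starRingEnd ℂ) (W x) := fun i =>
    (((hφ.pd i).mul_right (hW.pd i)).mul_right hWc).integrable
  simp only [h2, h3] at h1
  have h4 : ∀ i, ∫ x, (((φ x * ‖pd i W x‖ ^ 2 : ℝ) : ℂ)
      + pd i Θ x * pd i W x * (starRingEnd ℂ) (W x))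
      = ((∫ x, φ x * ‖pd i W x‖ ^ 2 : ℝ) : ℂ)
        + ∫ x, pd i Θ x * pd i W x * (starRingEnd ℂ) (W x) := fun i => by
    rw [integral_add (hi1 i) (hi2 i), integral_complex_ofReal]
  simp only [h4, Finset.sum_add_distrib] at h1
  rw [integral_complex_ofReal, ← integral_finsetSum _ fun i _ => hi2 i] at h1
  simp only [← Finset.sum_mul] at h1
  have h5 := congrArg Complex.im h1
  rw [Complex.ofReal_im, Complex.neg_im, Complex.add_im, ← Complex.ofReal_sum,
    Complex.ofReal_im, zero_add] at h5
  linarith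

/-- Expanding, |∂ᵣW - iW|² = |∂ᵣW|² + |W|² - 2 Im(∂ᵣW · W̄), and the weighted integral of the last
term is the imaginary part of a flux, hence 0. This lets the radiation condition control W and ∂ᵣW
separately. -/
lemma energy_identity (hd : 1 ≤ d) (hβ : IsShellCutoff β θ κ M) (hR : 0 < R)
    (hW : ContDiff ℝ ∞ W) (hH : ∀ x, lap W x + W x = 0) :
    ∫ x : E d, β (‖x‖ / R) ^ 2 / R * (‖radialDeriv W x‖ ^ 2 + ‖W x‖ ^ 2)
      = ∫ x : E d, β (‖x‖ / R) ^ 2 / R * ‖radialDeriv W x - Complex.I * W x‖ ^ 2 := by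
  have := nontrivial_E hd
  have hne : ∀ᵐ x : E d, x ≠ 0 := by simp [ae_iff, measure_singleton]
  have hPm := measurable_radialDeriv hW
  have hWm := hW.continuous.measurable
  have hgc : Continuous fun x => (∑ i, ‖pd i W x‖) :=
    continuous_finsetSum _ fun i _ => (hW.pd i).continuous.norm
  have hi1 : Integrable fun x : E d => β (‖x‖ / R) ^ 2 / R * (‖radialDeriv W x‖ ^ 2 + ‖W x‖ ^ 2) := by
    refine hβ.integrable_weight_mul hR (g := fun x => (∑ i, ‖pd i W x‖) ^ 2 + ‖W x‖ ^ 2)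
      ((hPm.norm.pow_const 2).add (hWm.norm.pow_const 2))
      ((hgc.pow 2).add (hW.continuous.norm.pow 2)) fun x => ?_
    rw [abs_of_nonneg (by positivity)]
    gcongr
    exact norm_radialDeriv_le W x
  have hi2 : Integrable fun x : E d => β (‖x‖ / R) ^ 2 / R *
      (radialDeriv W x * (starRingEnd ℂ) (W x)).im := by
    refine hβ.integrable_weight_mul hR (g := fun x => (∑ i, ‖pd i W x‖) * ‖W x‖)
      (Complex.measurable_im.comp (hPm.mul (Complex.continuous_conj.measurable.comp hWm)))
      (hgc.mul hW.continuous.norm) fun x => ?_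
    refine (Complex.abs_im_le_norm _).trans ?_
    rw [norm_mul, RCLike.norm_conj]
    gcongr
    exact norm_radialDeriv_le W x
  have hflux : ∫ x : E d, β (‖x‖ / R) ^ 2 / R * (radialDeriv W x * (starRingEnd ℂ) (W x)).im = 0 := by
    have h1 := im_integral_flux hW hH (φ := fun x => θ (‖x‖ / R)) (hβ.isTest hR)
    have hWc : ContDiff ℝ ∞ fun x => (starRingEnd ℂ) (W x) := Complex.conjCLE.contDiff.comp hW
    have hi3 : Integrable fun x => (∑ i, pd i (fun x : E d => (θ (‖x‖ / R) : ℂ)) x * pd i W x)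
        * (starRingEnd ℂ) (W x) := by
      simp only [Finset.sum_mul]
      exact integrable_finsetSum _ fun i _ =>
        ((((hβ.isTest hR).pd i).mul_right (hW.pd i)).mul_right hWc).integrable
    have h2 := integral_im hi3
    change ∫ x, Complex.im _ = Complex.im _ at h2
    rw [h1] at h2
    rw [← neg_eq_zero, ← integral_neg, ← h2]
    refine integral_congr_ae ?_
    filter_upwards [hne] with x hx
    rw [hβ.sum_pd_mul_pd hx, mul_assoc, ← Complex.ofReal_neg, Complex.im_ofReal_mul, neg_mul]
  have hpt : ∀ x : E d, β (‖x‖ / R) ^ 2 / R * ‖radialDeriv W x - Complex.I * W x‖ ^ 2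
      = β (‖x‖ / R) ^ 2 / R * (‖radialDeriv W x‖ ^ 2 + ‖W x‖ ^ 2)
        - 2 * (β (‖x‖ / R) ^ 2 / R * (radialDeriv W x * (starRingEnd ℂ) (W x)).im) := fun x => by
    have : ‖radialDeriv W x - Complex.I * W x‖ ^ 2 = ‖radialDeriv W x‖ ^ 2 + ‖W x‖ ^ 2
        - 2 * (radialDeriv W x * (starRingEnd ℂ) (W x)).im := by
      simp only [← Complex.normSq_eq_norm_sq, Complex.normSq_apply]
      simp
      ring
    rw [this]; ring
  simp only [hpt]
  rw [integral_sub hi1 (hi2.const_mul 2), integral_const_mul, hflux, mul_zero, sub_zero]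

end Shell

/-! ### Uniqueness of radiating entire solutions -/

section Uniqueness

variable {d : ℕ} {β θ : ℝ → ℝ} {κ M R : ℝ} {W : E d → ℂ}

lemma integrable_indicator_closedBall (r c : ℝ) :
    Integrable ((Metric.closedBall (0 : E d) r).indicator fun _ => c) :=
  (integrable_indicator_iff Metric.isClosed_closedBall.measurableSet).2
    (integrableOn_const measure_closedBall_lt_top.ne)

lemma integral_indicator_closedBall {r : ℝ} (hr : 0 ≤ r) (c : ℝ) :
    ∫ x : E d, (Metric.closedBall (0 : E d) r).indicator (fun _ => c) x
      = r ^ d * volume.real (Metric.ball (0 : E d) 1) * c := by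
  rw [integral_indicator_const _ Metric.isClosed_closedBall.measurableSet, smul_eq_mul,
    Measure.addHaar_real_closedBall _ _ hr]
  simp

/-- The power counting for shells: amplitude squared R^(-(d-1)), weight 1/R and volume of order R^d
balance exactly. -/
lemma rpow_half_sq_mul (hR : 0 < R) :
    (R ^ (-(((d : ℝ) - 1) / 2))) ^ 2 / R * R ^ d = 1 := by
  have h1 : (R ^ (-(((d : ℝ) - 1) / 2))) ^ 2 = R ^ (-((d : ℝ) - 1)) := by
    rw [← Real.rpow_natCast, ← Real.rpow_mul hR.le]
    congr 1; push_cast; ring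
  rw [h1, ← Real.rpow_natCast, div_eq_mul_inv, ← Real.rpow_neg_one R, ← Real.rpow_add hR,
    ← Real.rpow_add hR]
  ring_nf
  exact Real.rpow_zero R

lemma half_dim_nonneg (hd : 1 ≤ d) : 0 ≤ ((d : ℝ) - 1) / 2 := by
  have : (1 : ℝ) ≤ d := by exact_mod_cast hd
  linarith

lemma exists_energy_le (hd : 1 ≤ d) (hβ : IsShellCutoff β θ κ M)
    (hW : ContDiff ℝ ∞ W) (hH : ∀ x, lap W x + W x = 0) (hrad : SommerfeldRadiation W)
    {ε : ℝ} (hε : 0 < ε) : ∃ R₀ : ℝ, ∀ R, R₀ ≤ R →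
      ∫ x : E d, β (‖x‖ / R) ^ 2 / R * (‖radialDeriv W x‖ ^ 2 + ‖W x‖ ^ 2) ≤ ε := by
  set p : ℝ := ((d : ℝ) - 1) / 2 with hp
  have hp0 : 0 ≤ p := half_dim_nonneg hd
  set V : ℝ := volume.real (Metric.ball (0 : E d) 1) with hV
  have hV0 : 0 ≤ V := measureReal_nonneg
  -- A bound √η on the radiation defect gives at most 2^d V η for the integral over the ball of
  -- radius 2R.
  set η : ℝ := ε / (2 ^ d * V + 1) with hη
  have hη0 : 0 < η := by positivity
  obtain ⟨r₀, -, hr₀⟩ := (hasBasis_cobounded_norm.eventually_iff).1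
    (hrad.2.eventually (Metric.ball_mem_nhds 0 (Real.sqrt_pos.2 hη0)))
  refine ⟨max r₀ 1, fun R hR => ?_⟩
  have hR1 : 1 ≤ R := (le_max_right _ _).trans hR
  have hR0 : 0 < R := by linarith
  rw [energy_identity hd hβ hR0 hW hH]
  have hpt : ∀ x : E d, β (‖x‖ / R) ^ 2 / R * ‖radialDeriv W x - Complex.I * W x‖ ^ 2
      ≤ (Metric.closedBall (0 : E d) (2 * R)).indicator (fun _ => η * ((R ^ (-p)) ^ 2 / R)) x := by
    intro x
    by_cases h0 : β (‖x‖ / R) = 0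
    · rw [h0]
      simp only [ne_eq, OfNat.ofNat_ne_zero, not_false_eq_true, zero_pow, zero_div, zero_mul]
      exact Set.indicator_nonneg (fun _ _ => by positivity) _
    · obtain ⟨h1, h2⟩ := hβ.support_le hR0 h0
      rw [Set.indicator_of_mem (by simpa using h2)]
      have hx0 : 0 < ‖x‖ := by linarith
      have h3 : ‖x‖ ^ p * ‖radialDeriv W x - Complex.I * W x‖ < Real.sqrt η := by
        have := hr₀ (show x ∈ {x : E d | r₀ ≤ ‖x‖} from ((le_max_left _ _).trans hR).trans h1)
        rw [dist_zero_right, norm_mul, Complex.norm_real,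
          Real.norm_of_nonneg (by positivity)] at this
        exact this
      have h4 : ‖radialDeriv W x - Complex.I * W x‖ ≤ Real.sqrt η * R ^ (-p) := by
        have h5 : R ^ p ≤ ‖x‖ ^ p := Real.rpow_le_rpow hR0.le h1 hp0
        have h6 : R ^ p * ‖radialDeriv W x - Complex.I * W x‖ ≤ Real.sqrt η :=
          (mul_le_mul_of_nonneg_right h5 (norm_nonneg _)).trans h3.le
        rw [Real.rpow_neg hR0.le, ← div_eq_mul_inv, le_div_iff₀ (by positivity), mul_comm]
        exact h6
      calc β (‖x‖ / R) ^ 2 / R * ‖radialDeriv W x - Complex.I * W x‖ ^ 2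
          ≤ 1 / R * (Real.sqrt η * R ^ (-p)) ^ 2 := by
            gcongr
            exact hβ.bump_sq_le _
        _ = η * ((R ^ (-p)) ^ 2 / R) := by
            rw [mul_pow, Real.sq_sqrt hη0.le]; ring
  refine (integral_mono_of_nonneg (Eventually.of_forall fun x => by positivity)
    (integrable_indicator_closedBall _ _) (Eventually.of_forall hpt)).trans ?_
  rw [integral_indicator_closedBall (by positivity), ← hV]
  have h7 := rpow_half_sq_mul (d := d) hR0
  rw [← hp] at h7
  calc (2 * R) ^ d * V * (η * ((R ^ (-p)) ^ 2 / R))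
      = (2 ^ d * V) * η * ((R ^ (-p)) ^ 2 / R * R ^ d) := by rw [mul_pow]; ring
    _ = (2 ^ d * V) * η := by rw [h7, mul_one]
    _ ≤ (2 ^ d * V + 1) * η := by gcongr; linarith
    _ = ε := by rw [hη]; field_simp

/-- A radiating entire solution of the Helmholtz equation is estimated by its energy on a shell. -/
lemma exists_norm_le_energy (hd : 1 ≤ d) (hβ : IsShellCutoff β θ κ M)
    (hW : ContDiff ℝ ∞ W) (hH : ∀ x, lap W x + W x = 0) (x₀ : E d) :
    ∃ C R₁ : ℝ, 0 ≤ C ∧ ∀ R, R₁ ≤ R → ∀ t, 0 < t → κ * ‖W x₀‖ ≤ C * (t + t⁻¹ *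
      ∫ x : E d, β (‖x‖ / R) ^ 2 / R * (‖radialDeriv W x‖ ^ 2 + ‖W x‖ ^ 2)) := by
  have := nontrivial_E hd
  have hne : ∀ᵐ x : E d, x ≠ 0 := by simp [ae_iff, measure_singleton]
  obtain ⟨C, hC⟩ := (isOutgoingProfile_greenRadial hd).decay
  have hC0 : 0 ≤ C := by
    have := (hC 1 le_rfl).1
    rw [Real.one_rpow, mul_one] at this
    exact (norm_nonneg _).trans this
  have hM0 : 0 ≤ M := (abs_nonneg _).trans (hβ.deriv_bump_le 0)
  have hd1 : (1 : ℝ) ≤ d := by exact_mod_cast hd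
  set p : ℝ := ((d : ℝ) - 1) / 2 with hp
  have hp0 : 0 ≤ p := half_dim_nonneg hd
  set V : ℝ := volume.real (Metric.ball (0 : E d) 1) with hV
  have hV0 : 0 ≤ V := measureReal_nonneg
  -- The commutator of Δ with the cutoff contributes 2 from 2∇Θ·∇W, 2M from the term ββ' and d from
  -- (d - 1)/r.
  set c₁ : ℝ := 2 + 2 * M + d with hc₁
  set C' : ℝ := C * 2 ^ p * c₁ with hC'
  have hC'0 : 0 ≤ C' := by positivity
  -- This lower bound on R puts x₀ on the plateau of the cutoff and keeps the shell at distance at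
  -- least R/2 ≥ 1 from x₀, where the decay of the Green function applies.
  refine ⟨C' * (2 ^ d * V + 1), 2 * ‖x₀‖ + 2, by positivity, fun R hR t ht => ?_⟩
  have hR2 : 2 ≤ R := by linarith [norm_nonneg x₀]
  have hR0 : 0 < R := by linarith
  have hΘ := hβ.isTest (d := d) hR0
  set Θ : E d → ℂ := fun x => (θ (‖x‖ / R) : ℂ) with hΘdef
  set e : E d → ℝ := fun x => β (‖x‖ / R) ^ 2 / R * (‖radialDeriv W x‖ ^ 2 + ‖W x‖ ^ 2) with he
  have hei : Integrable e := by
    refine hβ.integrable_weight_mul hR0 (g := fun x => (∑ i, ‖pd i W x‖) ^ 2 + ‖W x‖ ^ 2)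
      (((measurable_radialDeriv hW).norm.pow_const 2).add
        (hW.continuous.measurable.norm.pow_const 2))
      (((continuous_finsetSum _ fun i _ => (hW.pd i).continuous.norm).pow 2).add
        (hW.continuous.norm.pow 2)) fun x => ?_
    rw [abs_of_nonneg (by positivity)]
    gcongr
    exact norm_radialDeriv_le W x
  have hΘW : IsTest fun x => Θ x * W x := hΘ.mul_right hW
  have hrep := cv_freeGreen_lap_add hd hΘW x₀
  have hΘ0 : Θ x₀ = (κ : ℂ) := by
    rw [hΘdef]
    simp only
    rw [hβ.eq_const _ ((div_le_one hR0).2 (by linarith [norm_nonneg x₀]))]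
  -- Since (Δ + 1)W = 0, only terms with derivatives of Θ survive, and these live on the shell.
  have hL : ∀ x, lap (fun x => Θ x * W x) x + Θ x * W x
      = 2 * ∑ i, pd i Θ x * pd i W x + lap Θ x * W x := fun x => by
    rw [lap_mul hΘ.smooth hW, eq_neg_of_add_eq_zero_left (hH x)]
    ring
  have hLn : ∀ x, x ≠ 0 → ‖lap (fun x => Θ x * W x) x + Θ x * W x‖
      ≤ c₁ / R * (|β (‖x‖ / R)| * ‖radialDeriv W x‖ + |β (‖x‖ / R)| * ‖W x‖) := fun x hx => by
    have hx0 := norm_pos_iff.2 hx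
    rw [hL, hβ.sum_pd_mul_pd hx, hβ.lap_eq hx]
    by_cases h0 : β (‖x‖ / R) = 0
    · rw [h0]; simp
    obtain ⟨h1, -⟩ := hβ.support_le hR0 h0
    set b := β (‖x‖ / R) with hb
    have hb1 : |b| ≤ 1 := hβ.bump_le _
    have hbb : b ^ 2 ≤ |b| := by
      rw [← sq_abs]; nlinarith [abs_nonneg b]
    have hx1 : 1 ≤ ‖x‖ := by linarith
    have n1 : ‖2 * (-((b ^ 2 / R : ℝ) : ℂ) * radialDeriv W x)‖ ≤ 2 / R * (|b| * ‖radialDeriv W x‖) := by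
      rw [norm_mul, norm_mul, norm_neg, Complex.norm_real, Real.norm_of_nonneg (by positivity)]
      simp only [Complex.norm_ofNat]
      calc 2 * (b ^ 2 / R * ‖radialDeriv W x‖) ≤ 2 * (|b| / R * ‖radialDeriv W x‖) := by gcongr
        _ = _ := by ring
    have n2 : |(-(2 * b * deriv β (‖x‖ / R) / R ^ 2) - ((d : ℝ) - 1) / ‖x‖ * (b ^ 2 / R))|
        ≤ (2 * M + d) / R * |b| := by
      have m1 : |2 * b * deriv β (‖x‖ / R) / R ^ 2| ≤ 2 * M / R * |b| := by
        rw [abs_div, abs_mul, abs_mul, abs_two, abs_of_pos (by positivity : 0 < R ^ 2)]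
        have := hβ.deriv_bump_le (‖x‖ / R)
        calc 2 * |b| * |deriv β (‖x‖ / R)| / R ^ 2 ≤ 2 * |b| * M / R := by
              gcongr
              nlinarith
          _ = _ := by ring
      have m2 : |((d : ℝ) - 1) / ‖x‖ * (b ^ 2 / R)| ≤ d / R * |b| := by
        rw [abs_of_nonneg (mul_nonneg (div_nonneg (by linarith) hx0.le) (by positivity))]
        have : ((d : ℝ) - 1) / ‖x‖ ≤ d := by
          rw [div_le_iff₀ hx0]; nlinarith
        calc ((d : ℝ) - 1) / ‖x‖ * (b ^ 2 / R) ≤ d * (|b| / R) := by gcongr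
          _ = _ := by ring
      refine (abs_sub _ _).trans ?_
      rw [abs_neg]
      refine (add_le_add m1 m2).trans (le_of_eq (by ring))
    refine (norm_add_le _ _).trans ?_
    rw [norm_mul (Complex.ofReal _) (W x), Complex.norm_real, Real.norm_eq_abs]
    refine (add_le_add n1 (mul_le_mul_of_nonneg_right n2 (norm_nonneg _))).trans ?_
    have k1 : 2 / R * (|b| * ‖radialDeriv W x‖) ≤ c₁ / R * (|b| * ‖radialDeriv W x‖) := by
      gcongr; rw [hc₁]; linarith
    have k2 : (2 * M + d) / R * (|b| * ‖W x‖) ≤ c₁ / R * (|b| * ‖W x‖) := by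
      gcongr; rw [hc₁]; linarith
    calc _ = 2 / R * (|b| * ‖radialDeriv W x‖) + (2 * M + d) / R * (|b| * ‖W x‖) := by ring
      _ ≤ _ := by rw [mul_add]; exact add_le_add k1 k2
  have hG : ∀ x : E d, R ≤ ‖x‖ → ‖freeGreen d (x₀ - x)‖ ≤ C * 2 ^ p * R ^ (-p) := fun x hx => by
    have h1 : R / 2 ≤ ‖x₀ - x‖ := by
      have := norm_sub_norm_le x x₀
      rw [norm_sub_rev] at this
      linarith
    have h2 : (1 : ℝ) ≤ ‖x₀ - x‖ := by linarith
    rw [freeGreen_eq]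
    refine (hC _ h2).1.trans ?_
    rw [mul_assoc]
    refine mul_le_mul_of_nonneg_left ?_ hC0
    calc ‖x₀ - x‖ ^ (-p) ≤ (R / 2) ^ (-p) :=
          Real.rpow_le_rpow_of_nonpos (by positivity) h1 (by linarith)
      _ = 2 ^ p * R ^ (-p) := by
          rw [Real.div_rpow hR0.le two_pos.le, Real.rpow_neg two_pos.le, div_inv_eq_mul, mul_comm]
  have hbound : ∀ x, x ≠ 0 →
      ‖freeGreen d (x₀ - x) * (lap (fun x => Θ x * W x) x + Θ x * W x)‖
      ≤ (Metric.closedBall (0 : E d) (2 * R)).indicator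
          (fun _ => C' * (t * ((R ^ (-p)) ^ 2 / R))) x + C' * t⁻¹ * e x := fun x hx => by
    by_cases h0 : β (‖x‖ / R) = 0
    · have h1 := hLn x hx
      rw [h0] at h1
      simp only [abs_zero, zero_mul, add_zero, mul_zero] at h1
      rw [norm_mul, le_antisymm h1 (norm_nonneg _), mul_zero]
      refine add_nonneg (Set.indicator_nonneg (fun _ _ => by positivity) _) ?_
      simp only [he]
      positivity
    · obtain ⟨h1, h2⟩ := hβ.support_le hR0 h0
      rw [Set.indicator_of_mem (by simpa using h2), norm_mul]
      refine (mul_le_mul (hG x h1) (hLn x hx) (norm_nonneg _) (by positivity)).trans ?_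
      set b := |β (‖x‖ / R)| with hb
      have hbsq : β (‖x‖ / R) ^ 2 = b ^ 2 := (sq_abs _).symm
      set q := R ^ (-p) with hq
      -- Young's inequality with weight t: the first term sums to O(t) over the shell independently
      -- of R, the second is the energy divided by t.
      have am : ∀ s : ℝ, q * (b * s) ≤ t / 2 * q ^ 2 + t⁻¹ * (b ^ 2 * s ^ 2) := fun s => by
        have h3 : 0 ≤ t⁻¹ * (t * q - b * s) ^ 2 := by positivity
        have h4 : t⁻¹ * (t * q - b * s) ^ 2 = t * q ^ 2 - 2 * (q * (b * s))
            + t⁻¹ * (b ^ 2 * s ^ 2) := by field_simp; ring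
        have h5 : 0 ≤ t⁻¹ * (b ^ 2 * s ^ 2) := by positivity
        linarith
      have a1 := am ‖radialDeriv W x‖
      have a2 := am ‖W x‖
      calc C * 2 ^ p * q * (c₁ / R * (b * ‖radialDeriv W x‖ + b * ‖W x‖))
          = C' / R * (q * (b * ‖radialDeriv W x‖) + q * (b * ‖W x‖)) := by rw [hC']; ring
        _ ≤ C' / R * ((t / 2 * q ^ 2 + t⁻¹ * (b ^ 2 * ‖radialDeriv W x‖ ^ 2))
            + (t / 2 * q ^ 2 + t⁻¹ * (b ^ 2 * ‖W x‖ ^ 2))) := by gcongr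
        _ = _ := by simp only [he, hbsq]; ring
  have hfin : κ * ‖W x₀‖ ≤ ∫ x, ((Metric.closedBall (0 : E d) (2 * R)).indicator
          (fun _ => C' * (t * ((R ^ (-p)) ^ 2 / R))) x + C' * t⁻¹ * e x) := by
    have h1 : κ * ‖W x₀‖ = ‖cv (freeGreen d)
        (fun x => lap (fun x => Θ x * W x) x + Θ x * W x) x₀‖ := by
      rw [hrep, hΘ0, norm_mul, Complex.norm_real, Real.norm_of_nonneg hβ.pos.le]
    rw [h1]
    refine norm_integral_le_of_norm_le
      ((integrable_indicator_closedBall _ _).add (hei.const_mul _)) ?_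
    filter_upwards [hne] with x hx using hbound x hx
  rw [integral_add (integrable_indicator_closedBall _ _) (hei.const_mul _), integral_const_mul,
    integral_indicator_closedBall (by positivity), ← hV] at hfin
  have h7 := rpow_half_sq_mul (d := d) hR0
  rw [← hp] at h7
  have h8 : (2 * R) ^ d * V * (C' * (t * ((R ^ (-p)) ^ 2 / R))) = C' * (2 ^ d * V) * t := by
    calc _ = C' * (2 ^ d * V) * t * ((R ^ (-p)) ^ 2 / R * R ^ d) := by rw [mul_pow]; ring
      _ = _ := by rw [h7, mul_one]
  rw [h8] at hfin
  have he0 : 0 ≤ ∫ x, e x := integral_nonneg fun x => by simp only [he, Pi.zero_apply]; positivity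
  refine hfin.trans ?_
  have k1 : 0 ≤ C' * t := by positivity
  have k2 : 0 ≤ C' * (2 ^ d * V) * (t⁻¹ * ∫ x, e x) := by positivity
  nlinarith

/-- An entire solution of the Helmholtz equation that satisfies the Sommerfeld radiation
condition vanishes. -/
theorem eq_zero_of_sommerfeldRadiation (hd : 1 ≤ d) (hW : ContDiff ℝ ∞ W)
    (hH : ∀ x, lap W x + W x = 0) (hrad : SommerfeldRadiation W) (x₀ : E d) : W x₀ = 0 := by
  obtain ⟨β, θ, κ, M, hβ⟩ := exists_isShellCutoff
  obtain ⟨C, R₁, hC, hR₁⟩ := exists_norm_le_energy hd hβ hW hH x₀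
  have key : ∀ t : ℝ, 0 < t → κ * ‖W x₀‖ ≤ 2 * C * t := fun t ht => by
    -- Making the energy at most t² balances the two terms of the estimate.
    obtain ⟨R₀, hR₀⟩ := exists_energy_le hd hβ hW hH hrad (show 0 < t ^ 2 by positivity)
    have h1 := hR₁ (max R₀ R₁) (le_max_right _ _) t ht
    have h2 := hR₀ (max R₀ R₁) (le_max_left _ _)
    have h3 : t⁻¹ * _ ≤ t⁻¹ * t ^ 2 := mul_le_mul_of_nonneg_left h2 (by positivity)
    have h4 : t⁻¹ * t ^ 2 = t := by field_simp
    rw [h4] at h3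
    refine h1.trans ?_
    calc _ ≤ C * (t + t) := mul_le_mul_of_nonneg_left (by linarith) hC
      _ = 2 * C * t := by ring
  have hlim : Tendsto (fun t : ℝ => 2 * C * t) (𝓝[>] 0) (𝓝 0) := by
    have : Tendsto (fun t : ℝ => 2 * C * t) (𝓝 0) (𝓝 (2 * C * 0)) :=
      (continuous_const.mul continuous_id).tendsto _
    rw [mul_zero] at this
    exact this.mono_left nhdsWithin_le_nhds
  have h0 : κ * ‖W x₀‖ ≤ 0 := ge_of_tendsto hlim (by
    filter_upwards [self_mem_nhdsWithin] with t ht using key t ht)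
  have h1 : ‖W x₀‖ ≤ 0 := by
    by_contra h
    exact absurd h0 (not_le.2 (mul_pos hβ.pos (not_le.1 h)))
  exact norm_le_zero_iff.1 h1

end Uniqueness

/-! ### Eigenfunctions, resonant modes and the spectrum -/

section ResonantModes

variable {d : ℕ}

lemma SommerfeldRadiation.sub {u v : E d → ℂ} (hu : SommerfeldRadiation u)
    (hv : SommerfeldRadiation v) : SommerfeldRadiation fun x => u x - v x := by
  refine ⟨(hu.1.and hv.1).mono fun x hx => hx.1.sub hx.2, ?_⟩
  have h := hu.2.sub hv.2
  rw [sub_zero] at h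
  refine h.congr' ?_
  filter_upwards [hu.1, hv.1] with x h1 h2
  rw [fderiv_fun_sub h1 h2, sub_apply]
  ring

/-- The radiation condition passes to a smooth representative. -/
lemma SommerfeldRadiation.of_ae_eq {z W : E d → ℂ} (hz : SommerfeldRadiation z)
    (hW : ContDiff ℝ ∞ W) (h : z =ᵐ[volume] W) : SommerfeldRadiation W := by
  obtain ⟨r, -, hr⟩ := (hasBasis_cobounded_norm.eventually_iff).1 hz.1
  have hU : IsOpen {x : E d | r < ‖x‖} := isOpen_Ioi.preimage continuous_norm
  -- Differentiability near infinity makes z continuous there, so equality almost everywhere becomes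
  -- equality on an open exterior region, derivatives included.
  have hEq : Set.EqOn z W {x : E d | r < ‖x‖} := by
    refine Measure.eqOn_open_of_ae_eq (ae_restrict_of_ae h) hU (fun x hx => ?_)
      hW.continuous.continuousOn
    exact (hr (show r ≤ ‖x‖ from le_of_lt (show r < ‖x‖ from hx))).continuousAt.continuousWithinAt
  refine ⟨Eventually.of_forall fun x => hW.diffAt x, hz.2.congr' ?_⟩
  filter_upwards [tendsto_norm_cobounded.eventually (eventually_gt_atTop r)] with x hx
  have h1 : z =ᶠ[𝓝 x] W := hEq.eventuallyEq_of_mem (hU.mem_nhds hx)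
  rw [h1.fderiv_eq, h1.self_of_nhds]

/-- An eigenfunction f extends to u = G * (n f 1_D) / λ. Conversely, a mode u differs from v = G *
(n u 1_D) / λ by an entire radiating solution, which is zero, so u solves the integral equation and
its restriction to D is an eigenfunction. -/
lemma hasEigenvalue_iff_exists_isResonantMode (hd : 1 ≤ d) {D : Set (E d)}
    (hD : MeasurableSet D) (hDb : Bornology.IsBounded D) {n : E d → ℝ} {N : ℝ}
    (hn : AEStronglyMeasurable n (volume.restrict D)) (hN : ∀ x ∈ D, |n x| ≤ N)
    {K : Lp ℂ 2 (volume.restrict D) →L[ℂ] Lp ℂ 2 (volume.restrict D)}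
    (hK : IsSourceOperator D n K) {lam : ℂ} (hlam : lam ≠ 0) :
    Module.End.HasEigenvalue (K : Module.End ℂ (Lp ℂ 2 (volume.restrict D))) lam ↔
      ∃ u : E d → ℂ, IsResonantMode D n (1 / lam) u := by
  obtain ⟨R₀, hR₀⟩ := hDb.subset_closedBall 0
  set R := max R₀ 0
  have hR0 : 0 ≤ R := le_max_right _ _
  have hDR : ∀ {y : E d}, R < ‖y‖ → y ∉ D := fun {y} hy hyD => by
    have h1 := hR₀ hyD
    rw [mem_closedBall_zero_iff] at h1
    exact absurd hy (not_lt.2 (h1.trans (le_max_left _ _)))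
  have hsupp : ∀ f : E d → ℂ, ∀ y, R < ‖y‖ → (1 / lam) * sourceTerm D n f y = 0 := fun f y hy => by
    simp [sourceTerm, hDR hy]
  constructor
  · rintro h
    obtain ⟨f, hf⟩ := h.exists_hasEigenvector
    have hf0 : f ≠ 0 := hf.2
    have hKf : K f = lam • f := hf.apply_eq_smul
    have hmem : MemLp (fun y => (1 / lam) * sourceTerm D n f y) 2 :=
      (memLp_sourceTerm hD hn hN (Lp.memLp f)).1.const_mul _
    set u := cv (freeGreen d) fun y => (1 / lam) * sourceTerm D n f y with hu
    have huf : u =ᵐ[volume.restrict D] f := by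
      filter_upwards [hK f, Lp.coeFn_smul lam f] with x h1 h2
      rw [hu, cv_const_mul, ← potential_eq_cv hD, ← h1.2, hKf, h2, Pi.smul_apply, smul_eq_mul]
      field_simp
    refine ⟨u, memH2Loc_cv_freeGreen hd hmem (hsupp f), fun h0 => hf0 ?_,
      ⟨_, hasWeakLaplacian_cv_freeGreen hd hmem (hsupp f), ?_, ?_⟩,
      sommerfeldRadiation_cv_freeGreen hd hR0 (integrable_of_memLp_two_of_norm hmem (hsupp f))
        (hsupp f)⟩
    · refine Lp.ext ((huf.symm.trans (ae_restrict_of_ae h0)).trans (Lp.coeFn_zero _ _ _).symm)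
    · filter_upwards [(ae_restrict_iff' hD).1 huf] with x hx hxD
      rw [← hu, sub_add_cancel, hx hxD, sourceTerm, Set.indicator_of_mem hxD, mul_assoc]
    · refine Eventually.of_forall fun x hxD => ?_
      rw [sub_add_cancel]
      simp [sourceTerm, hxD]
  · rintro ⟨u, hH2, hu0, ⟨w, hw, hwD, hwDc⟩, hrad⟩
    have huD : MemLp u 2 (volume.restrict D) :=
      (hH2.1 _ hDb.isCompact_closure).mono_measure
        (Measure.restrict_mono subset_closure le_rfl)
    set h : E d → ℂ := fun y => (1 / lam) * sourceTerm D n u y with hh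
    have hmem : MemLp h 2 := (memLp_sourceTerm hD hn hN huD).1.const_mul _
    have hwu : ∀ᵐ x, w x = h x - u x := by
      filter_upwards [hwD, hwDc] with x h1 h2
      rw [eq_sub_iff_add_eq]
      by_cases hx : x ∈ D
      · rw [h1 hx, hh]; simp [sourceTerm, hx, mul_assoc]
      · rw [h2 hx, hh]; simp [sourceTerm, hx]
    set v := cv (freeGreen d) h with hv
    have hz : HasWeakLaplacian (fun x => u x - v x) fun x => -(u x - v x) := by
      refine (hw.sub (hasWeakLaplacian_cv_freeGreen hd hmem (hsupp u))).congr_right ?_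
      filter_upwards [hwu] with x hx
      rw [hx, ← hv]; ring
    obtain ⟨W, hW, hzW, hWH⟩ := exists_smooth_of_hasWeakLaplacian hd hz
    have hzr := hrad.sub (sommerfeldRadiation_cv_freeGreen hd hR0
      (integrable_of_memLp_two_of_norm hmem (hsupp u)) (hsupp u))
    have hW0 := eq_zero_of_sommerfeldRadiation hd hW hWH (hzr.of_ae_eq hW hzW)
    have huv : u =ᵐ[volume] v := by
      filter_upwards [hzW] with x hx
      rw [hW0, sub_eq_zero] at hx
      exact hx
    set f := huD.toLp
    have hfu : f =ᵐ[volume.restrict D] u := huD.coeFn_toLp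
    have hcv : cv (freeGreen d) (sourceTerm D n f) = cv (freeGreen d) (sourceTerm D n u) :=
      cv_congr_ae (sourceTerm_congr hD n hfu)
    refine Module.End.hasEigenvalue_of_hasEigenvector (x := f)
      ⟨Module.End.mem_eigenspace_iff.2 ?_, fun hf0 => hu0 ?_⟩
    · refine Lp.ext ?_
      filter_upwards [hK f, Lp.coeFn_smul lam f, ae_restrict_of_ae huv, hfu] with x h1 h2 h3 h4
      change K f x = _
      rw [h2, Pi.smul_apply, h4, h3, h1.2, potential_eq_cv hD, hcv, hv, hh, cv_const_mul,
        smul_eq_mul]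
      field_simp
    -- The integral equation expresses u everywhere through its values in D, so a mode vanishing in
    -- D vanishes identically; no unique continuation is needed.
    · have h1 : u =ᵐ[volume.restrict D] fun _ => 0 := by
        refine hfu.symm.trans ?_
        rw [hf0]
        exact Lp.coeFn_zero _ _ _
      refine huv.trans (Eventually.of_forall fun x => ?_)
      rw [hv, hh, cv_const_mul, cv_congr_ae (sourceTerm_congr hD n h1)]
      simp [cv, sourceTerm]

end ResonantModes

theorem mainTheorem4 (d : ℕ) (hd : 1 ≤ d) (D : Set (E d)) (hDopen : IsOpen D)
    (hDconn : IsConnected D) (hDbdd : Bornology.IsBounded D)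
    (n : E d → ℝ) (hn : IsC1UpToBoundary n D) (hnpos : ∀ x ∈ D, 0 < n x) :
    ∃ K : Lp ℂ 2 (volume.restrict D) →L[ℂ] Lp ℂ 2 (volume.restrict D),
      IsSourceOperator D n K ∧
        ∀ lam : ℂ, lam ≠ 0 →
          (lam ∈ spectrum ℂ K ↔ ∃ u : E d → ℂ, IsResonantMode D n (1 / lam) u) ∧
          (lam ∈ spectrum ℂ (-K) ↔ ∃ u : E d → ℂ, IsResonantMode D n (-(1 / lam)) u) := by
  have hD := hDopen.measurableSet
  have hnm : AEStronglyMeasurable n (volume.restrict D) :=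
    (hn.1.mono subset_closure).aestronglyMeasurable hD
  obtain ⟨N, hN⟩ := hDbdd.isCompact_closure.exists_bound_of_continuousOn hn.1
  have hN' : ∀ x ∈ D, |n x| ≤ max N 0 := fun x hx =>
    (hN x (subset_closure hx)).trans (le_max_left _ _)
  obtain ⟨K, hK, hKc⟩ := exists_compact_sourceOperator hd hD hDbdd hnm hN' (le_max_right _ _)
  have key : ∀ lam : ℂ, lam ≠ 0 →
      (lam ∈ spectrum ℂ K ↔ ∃ u : E d → ℂ, IsResonantMode D n (1 / lam) u) := fun lam hlam => by
    -- Fredholm alternative: nonzero spectral values of a compact operator are eigenvalues.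
    rw [← hKc.hasEigenvalue_iff_mem_spectrum hlam]
    exact hasEigenvalue_iff_exists_isResonantMode hd hD hDbdd hnm hN' hK hlam
  refine ⟨K, hK, fun lam hlam => ⟨key lam hlam, ?_⟩⟩
  -- The spectrum of -K is the reflected spectrum of K, and replacing λ by -λ changes the sign of
  -- 1/λ.
  rw [← spectrum.neg_eq, Set.mem_neg, key (-lam) (neg_ne_zero.2 hlam), div_neg]
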